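/- All variables and parameters are complex. Consider lattices of relativistic Toda type for $q_n(t)$, $p_n=\dot q_n$, $y_n=q_n-q_{n-1}$ (the subscript $n$ is omitted, $p_{\pm1}=p_{n\pm1}$, etc.), $$\dot p=r(p)\bigl(h(y_1)p_1-h(y)p_{-1}+g(y_1)-g(y)\bigr),\qquad \dot y=p-p_{-1},\qquad (1)$$ where $r$ is holomorphic without zeros on a region and $g,h$ are holomorphic on a region (a region is a nonempty connected open subset of $\mathbb C$). The lattice is nondegenerate if $h\not\equiv0$ and $g',h'$ do not both vanish identically; it is linear if the right-hand side of (1) is an affine function of $p_{-1},p,p_1,y,y_1$. Let $a''=1/r$, $c'=h$, and let $T:(p,y)\mapsto(P,Y)$ be the mapping $P=h(y)p+g(y)$, $Y=a'(p)-c(y)$. The lattice (1) admits the duality transformations $$T_+:\ (P,Y)=T(p,y_1),\qquad T_-:\ (\tilde P_{-1},\tilde Y)=T(p,y)$$ if, near some point $(p_0,y_0)$, $T$ is biholomorphic onto its image and, locally, both $(P,Y)$ and $(\tilde P,\tilde Y)$ satisfy by virtue of (1), identically in the dynamical variables, one and the same lattice $\dot P=E(P_{-1},P,P_1,Y,Y_1)$,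 $\dot Y=P-P_{-1}$, which is called dual to (1). Two lattices are identified if one is taken into the other (or, the domains of definition being possibly smaller, into a restriction of the other) by a change $q_n\to\alpha q_n+\beta t+\gamma n$, $t\to\delta t$ with $\alpha\delta\ne0$. **Theorem.** Up to these changes, the nondegenerate nonlinear lattices (1) admitting the duality transformations are exactly the following (with $\dot y=p-p_{-1}$): $$\begin{aligned} (a)\quad&\dot p=p_1e^{y_1}-p_{-1}e^{y}-e^{2y_1}+e^{2y},\\ (b)\quad&\dot p=p\Bigl(\frac{p_1}{y_1}-\frac{p_{-1}}{y}+y_1-y\Bigr),\\ (c_{\mu,\nu})\quad&\dot p=p\Bigl(\frac{p_1}{1+\mu e^{-y_1}}-\frac{p_{-1}}{1+\mu e^{-y}}+\nu(e^{y_1}-e^{y})\Bigr),\quad(\mu,\nu)\ne(0,0),\\ (d)\quad&\dot p=p(p+1)\Bigl(\frac{p_1}{y_1}-\frac{p_{-1}}{y}\Bigr),\\ (e_\mu)\quad&\dot p=p(p-\mu)\Bigl(\frac{p_1}{\mu+e^{y_1}}-\frac{p_{-1}}{\mu+e^{y}}\Bigr),\\ (f_\mu)\quad&\dot p=(p^2+\mu)\Bigl(\frac{p_1-y_1}{\mu+y_1^2}-\frac{p_{-1}-y}{\mu+y^2}\Bigr),\\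 (g_\mu)\quad&\dot p=\tfrac12(p^2+1-\mu^2)\Bigl(\frac{p_1-\sinh y_1}{\mu+\cosh y_1}-\frac{p_{-1}-\sinh y}{\mu+\cosh y}\Bigr). \end{aligned}$$ For each of these the duality transformations exist near every point $(p_0,y_0)$ of its natural domain (where $r(p_0)\ne0$ and $r,g,h$ are given by the formulas above with nonvanishing denominators) at which the Jacobian of $T$ is nonzero. The duality transformations link together (that is, each is, up to the changes above, the dual of the other) the lattices (a) and (b); (d) and $(e_0)$; $(f_\mu)$, for every $\mu\ne0$, and $(g_{\pm1})$; $(c_{\mu,\nu})$ and $(c_{\nu,\mu})$. The lattices $(c_{\mu,\nu})$ with $\mu\nu\ne0$, $(e_\mu)$ with $\mu\ne0$, $(f_0)$, and $(g_\mu)$ with $\mu\ne\pm1$ are self-dual. -/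

import Mathlib

open Complex Set

/-- A first-order lattice system for sequences `p n`, `y n` (where `p n` is the time derivative of
`q n` and `y n = q n - q (n-1)`):
`p' n = F (p (n-1)) (p n) (p (n+1)) (y n) (y (n+1))`, `y' n = p n - p (n-1)`.
The variables `p n` range over `Dp` and the variables `y n` over `Dy`. -/
structure LatticeEq where
  Dp : Set ℂ
  Dy : Set ℂ
  F : ℂ → ℂ → ℂ → ℂ → ℂ → ℂ

/-- The functions `p n`, `y n` of the complex time satisfy the lattice `E` at the moment `t`. -/
def LatticeEq.HoldsAt (E : LatticeEq) (p y : ℤ → ℂ → ℂ) (t : ℂ) : Prop :=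
  ∀ n : ℤ, p n t ∈ E.Dp ∧ y n t ∈ E.Dy ∧
    HasDerivAt (p n) (E.F (p (n - 1) t) (p n t) (p (n + 1) t) (y n t) (y (n + 1) t)) t ∧
    HasDerivAt (y n) (p n t - p (n - 1) t) t

/-- The lattice is linear (its right-hand side is an affine function of the variables). -/
def LatticeEq.IsLinear (E : LatticeEq) : Prop :=
  ∃ k k₁ k₂ k₃ k₄ k₅ : ℂ, ∀ pm ∈ E.Dp, ∀ p ∈ E.Dp, ∀ pp ∈ E.Dp, ∀ y ∈ E.Dy, ∀ y₁ ∈ E.Dy,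
    E.F pm p pp y y₁ = k + k₁ * pm + k₂ * p + k₃ * pp + k₄ * y + k₅ * y₁

/-- `E` becomes (a restriction of) `M` under a change `q n ↦ α q n + β t + γ n`, `t ↦ δ t`.
If `q` solves `E` and `q̃ n t = α q n (δ t) + β t + γ n`, then at corresponding times
`p̃ = α δ p + β`, `ỹ = α y + γ`, and the time derivative of `p̃` is `α δ ^ 2` times that of `p`;
the last clause says that `q̃` solves `M`. -/
def LatticeEq.ReducesTo (E M : LatticeEq) : Prop :=
  ∃ α β γ δ : ℂ, α ≠ 0 ∧ δ ≠ 0 ∧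
    (∀ p ∈ E.Dp, α * δ * p + β ∈ M.Dp) ∧ (∀ y ∈ E.Dy, α * y + γ ∈ M.Dy) ∧
    ∀ pm ∈ E.Dp, ∀ p ∈ E.Dp, ∀ pp ∈ E.Dp, ∀ y ∈ E.Dy, ∀ y₁ ∈ E.Dy,
      α * δ ^ 2 * E.F pm p pp y y₁ =
        M.F (α * δ * pm + β) (α * δ * p + β) (α * δ * pp + β) (α * y + γ) (α * y₁ + γ)

/-- A nonempty connected open subset of the complex plane. -/
def IsRegion (D : Set ℂ) : Prop := IsOpen D ∧ IsConnected D

/-- The data of a lattice of relativistic Toda type: the coefficients `r` (on `Dp`) and `g`, `h`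
(on `Dy`). -/
structure RTL where
  Dp : Set ℂ
  Dy : Set ℂ
  r : ℂ → ℂ
  g : ℂ → ℂ
  h : ℂ → ℂ

namespace RTL

/-- The lattice `p' = r(p) (h(y₁) p₁ - h(y) p₋₁ + g(y₁) - g(y))`, `y' = p - p₋₁`. -/
def eq (L : RTL) : LatticeEq where
  Dp := L.Dp
  Dy := L.Dy
  F pm p pp y y₁ := L.r p * (L.h y₁ * pp - L.h y * pm + L.g y₁ - L.g y)

/-- The coefficients are holomorphic on regions and `r` does not vanish (it is of the form
`1 / a''`). -/
structure IsLattice (L : RTL) : Prop where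
  region_p : IsRegion L.Dp
  region_y : IsRegion L.Dy
  holo_r : DifferentiableOn ℂ L.r L.Dp
  holo_g : DifferentiableOn ℂ L.g L.Dy
  holo_h : DifferentiableOn ℂ L.h L.Dy
  r_ne_zero : ∀ p ∈ L.Dp, L.r p ≠ 0

/-- `h` is not identically zero, and `g'`, `h'` are not both identically zero. -/
def Nondegenerate (L : RTL) : Prop :=
  (∃ y ∈ L.Dy, L.h y ≠ 0) ∧ ∃ y ∈ L.Dy, deriv L.g y ≠ 0 ∨ deriv L.h y ≠ 0

/-- The mapping `(p, y) ↦ (P, Y)`, `P = h(y) p + g(y)`, `Y = a'(p) - c(y)`; here `a'` and `c` are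
(local) primitives of `1 / r` and `h`. -/
def T (L : RTL) (a' c : ℂ → ℂ) (z : ℂ × ℂ) : ℂ × ℂ :=
  (L.h z.2 * z.1 + L.g z.2, a' z.1 - c z.2)

/-- `Δ`, which is minus the Jacobian determinant of `T`. -/
noncomputable def jac (L : RTL) (p y : ℂ) : ℂ :=
  L.h y ^ 2 + (deriv L.h y * p + deriv L.g y) / L.r p

/-- Near `(p₀, y₀)` the lattice `L` admits the duality transformations, and `E` is the dual
lattice. That is, for some choice of primitives on a neighbourhood `U × V`, the mapping `T` is
biholomorphic from `U × V` onto an open set (with inverse `S`) which contains the box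
`E.Dp × E.Dy` around `T (p₀, y₀)`, and both
`T₊ : (P n, Y n) = T (p n, y (n+1))` and `T₋ : (P (n-1), Y n) = T (p n, y n)`
take `L` to `E`. The lattices are considered pointwise in time, that is, as relations between the
dynamical variables (which may take arbitrary values at a given moment) and their time
derivatives. -/
def HasDualAt (L : RTL) (p₀ y₀ : ℂ) (E : LatticeEq) : Prop :=
  ∃ (U V : Set ℂ) (a' c : ℂ → ℂ) (S : ℂ × ℂ → ℂ × ℂ),
    IsRegion U ∧ IsRegion V ∧ U ⊆ L.Dp ∧ V ⊆ L.Dy ∧ p₀ ∈ U ∧ y₀ ∈ V ∧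
    (∀ p ∈ U, HasDerivAt a' (1 / L.r p) p) ∧ (∀ y ∈ V, HasDerivAt c (L.h y) y) ∧
    (∀ z ∈ U ×ˢ V, S (L.T a' c z) = z) ∧
    IsOpen (L.T a' c '' (U ×ˢ V)) ∧ DifferentiableOn ℂ S (L.T a' c '' (U ×ˢ V)) ∧
    IsRegion E.Dp ∧ IsRegion E.Dy ∧
    E.Dp ×ˢ E.Dy ⊆ L.T a' c '' (U ×ˢ V) ∧ L.T a' c (p₀, y₀) ∈ E.Dp ×ˢ E.Dy ∧
    ∀ (p y : ℤ → ℂ → ℂ) (t : ℂ), L.eq.HoldsAt p y t → (∀ n, p n t ∈ U ∧ y n t ∈ V) →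
      (∀ P Y : ℤ → ℂ → ℂ,
        (∀ n s, (P n s, Y n s) = L.T a' c (p n s, y (n + 1) s)) →
        (∀ n, P n t ∈ E.Dp ∧ Y n t ∈ E.Dy) → E.HoldsAt P Y t) ∧
      (∀ P Y : ℤ → ℂ → ℂ,
        (∀ n s, (P (n - 1) s, Y n s) = L.T a' c (p n s, y n s)) →
        (∀ n, P n t ∈ E.Dp ∧ Y n t ∈ E.Dy) → E.HoldsAt P Y t)

/-- `L` admits the duality transformations, with dual lattice `E`, near some point. -/
def HasDual (L : RTL) (E : LatticeEq) : Prop :=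
  ∃ p₀ ∈ L.Dp, ∃ y₀ ∈ L.Dy, L.HasDualAt p₀ y₀ E

/-- `L` admits the duality transformations. -/
def AdmitsDuality (L : RTL) : Prop := ∃ E : LatticeEq, L.HasDual E

/-- `L` admits the duality transformations and, up to the changes of variables, each of its dual
lattices is `M`. -/
def DualIs (L M : RTL) : Prop :=
  L.AdmitsDuality ∧ ∀ E : LatticeEq, L.HasDual E → E.ReducesTo M.eq

/-- The duality transformations link together `L` and `M`. -/
def Linked (L M : RTL) : Prop := L.DualIs M ∧ M.DualIs L

/-- `L` is self-dual (up to the changes of variables). -/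
def SelfDual (L : RTL) : Prop := L.DualIs L

end RTL

/-- Names of the lattices of the list. -/
inductive Kind where
  | a : Kind
  | b : Kind
  | c (μ ν : ℂ) : Kind
  | d : Kind
  | e (μ : ℂ) : Kind
  | f (μ : ℂ) : Kind
  | g (μ : ℂ) : Kind

/-- All the lattices of the list, without the degenerate `c 0 0`. -/
def Kind.Admissible (k : Kind) : Prop := k ≠ Kind.c 0 0

/-- The lattices of the list, on their natural domains. -/
noncomputable def Kind.lattice : Kind → RTL
  | .a =>
    { Dp := univ
      Dy := univ
      r := fun _ => 1
      h := fun y => exp y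
      g := fun y => -exp (2 * y) }
  | .b =>
    { Dp := {p | p ≠ 0}
      Dy := {y | y ≠ 0}
      r := fun p => p
      h := fun y => 1 / y
      g := fun y => y }
  | .c μ ν =>
    { Dp := {p | p ≠ 0}
      Dy := {y | 1 + μ * exp (-y) ≠ 0}
      r := fun p => p
      h := fun y => 1 / (1 + μ * exp (-y))
      g := fun y => ν * exp y }
  | .d =>
    { Dp := {p | p * (p + 1) ≠ 0}
      Dy := {y | y ≠ 0}
      r := fun p => p * (p + 1)
      h := fun y => 1 / y
      g := fun _ => 0 }
  | .e μ =>
    { Dp := {p | p * (p - μ) ≠ 0}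
      Dy := {y | μ + exp y ≠ 0}
      r := fun p => p * (p - μ)
      h := fun y => 1 / (μ + exp y)
      g := fun _ => 0 }
  | .f μ =>
    { Dp := {p | p ^ 2 + μ ≠ 0}
      Dy := {y | μ + y ^ 2 ≠ 0}
      r := fun p => p ^ 2 + μ
      h := fun y => 1 / (μ + y ^ 2)
      g := fun y => -y / (μ + y ^ 2) }
  | .g μ =>
    { Dp := {p | p ^ 2 + 1 - μ ^ 2 ≠ 0}
      Dy := {y | μ + cosh y ≠ 0}
      r := fun p => 1 / 2 * (p ^ 2 + 1 - μ ^ 2)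
      h := fun y => 1 / (μ + cosh y)
      g := fun y => -sinh y / (μ + cosh y) }

/-! Let S = (A, B) be a local inverse of T and D = h²r + h'p + g' (`dualCoeff`), so that Δ = D/r.
Both T₊ and T₋ give Y' = P − P₋₁ automatically, and they express P' through S by two explicit
formulas, `ratePlus` and `rateMinus`. Duality therefore means that these two functions of five
independent variables coincide (`transformsTo_iff`).

Specialising the arguments shows that A is affine in P with slope hr/D, and that D depends on P = hp
+ g alone. Two derivatives in p then give r''(p) = r''(τ), where τ sweeps out a neighbourhood of p
as y varies, so r is a quadratic r2 p² + r1 p + r0. Hence D = r2 P² + k1 P − j, and comparing powers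
of p yields a pair of differential equations for h and g with a first integral: this is
`HasConstants`. Conversely, these equations make hr/D independent of P, which restores the equality
of the two rates (`hasDerivAt_slope`, `exists_hasDualAt`).

The dual lattice has r = D, and its h and g are the slope and intercept of A. It satisfies the same
system with r0 ↔ −j, r1 ↔ k1 and r2, k2 fixed (`exists_dual`), and this symmetry produces the links.

The list comes from integrating the system. If r2 = 0, the vanishing of r1 and k1 separates (a),
(b), (c). If r2 ≠ 0, completing squares leaves x = 1/h with x'² = 4 r2 (κx² + kx − ρ), and the cases
are governed by κ, k and the discriminant k² + 4ρκ: (d) and (f) for κ = 0, (e) for zero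
discriminant, (g) otherwise. Duality exchanges ρ with −κ and fixes k and the discriminant. The
constants alone do not detect some degenerate solutions of the system; there the explicit relation
between the variables of a lattice and of its dual decides. -/

open scoped Topology

/-! ### The system with constants, and changes of variables -/

namespace RTL

/-- The lattices whose coefficient `r` is a quadratic polynomial and whose coefficients `g`, `h`
solve a pair of quadratic differential equations with a first integral. -/
structure HasConstants (L : RTL) (r0 r1 r2 k1 k2 j : ℂ) : Prop where
  lattice : L.IsLattice
  h_ne : ∀ y ∈ L.Dy, L.h y ≠ 0
  r_eq : ∀ p ∈ L.Dp, L.r p = r2 * p ^ 2 + r1 * p + r0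
  deriv_h : ∀ y ∈ L.Dy, HasDerivAt L.h (L.h y * (2 * r2 * L.g y - r1 * L.h y + k1)) y
  deriv_g : ∀ y ∈ L.Dy, HasDerivAt L.g (L.h y * (r1 * L.g y - 2 * r0 * L.h y + k2)) y
  integral : ∀ y ∈ L.Dy,
    r2 * L.g y ^ 2 + k1 * L.g y - r1 * L.g y * L.h y + r0 * L.h y ^ 2 - k2 * L.h y = j

end RTL

theorem IsRegion.exists_const {D : Set ℂ} (hD : IsRegion D) {f : ℂ → ℂ}
    (hf : ∀ y ∈ D, HasDerivAt f 0 y) : ∃ C, ∀ y ∈ D, f y = C := by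
  obtain ⟨C, hC⟩ := hD.1.exists_is_const_of_deriv_eq_zero hD.2.isPreconnected
    (fun y hy => (hf y hy).differentiableAt.differentiableWithinAt)
    (fun y hy => (hf y hy).deriv)
  exact ⟨C, hC⟩

/-- Only differences of g enter the lattice, so g need match only up to an additive constant c.
Scaling r by `lam` is compensated in g and h, and a shift of p moves a multiple of h into g. -/
theorem RTL.reducesTo_of {L M : RTL} (α β γ δ lam s c : ℂ) (hα : α ≠ 0) (hδ : δ ≠ 0)
    (hr : ∀ p ∈ L.Dp, L.r p = lam * M.r (α * δ * (p + s) + β))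
    (hh : ∀ y ∈ L.Dy, lam * δ * L.h y = M.h (α * y + γ))
    (hg : ∀ y ∈ L.Dy, α * δ ^ 2 * lam * (L.g y - s * L.h y) =
      M.g (α * y + γ) + β * M.h (α * y + γ) + c)
    (hp : ∀ p ∈ L.Dp, α * δ * (p + s) + β ∈ M.Dp) (hy : ∀ y ∈ L.Dy, α * y + γ ∈ M.Dy) :
    L.eq.ReducesTo M.eq := by
  have e : ∀ p, α * δ * p + (β + α * δ * s) = α * δ * (p + s) + β := fun p => by ring
  refine ⟨α, β + α * δ * s, γ, δ, hα, hδ, ?_, hy, ?_⟩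
  · intro p hp'
    rw [e]; exact hp p hp'
  · intro pm _ p hp' pp _ y hy y₁ hy₁
    have hg1 := hg y hy
    have hg2 := hg y₁ hy₁
    rw [← hh y hy] at hg1
    rw [← hh y₁ hy₁] at hg2
    simp only [RTL.eq, e]
    rw [hr p hp', ← hh y hy, ← hh y₁ hy₁]
    linear_combination M.r (α * δ * (p + s) + β) * (hg2 - hg1)

/-! ### Normal forms with r of degree at most one: (a), (b), (c) -/

namespace RTL.HasConstants

variable {L : RTL} {r0 r1 r2 k1 k2 j : ℂ}

/-- Here h' = k1 h, so h = C exp(k1 y), and the first integral gives g as a quadratic polynomial in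
h. The shift of y turns r0 h into a pure exponential; β = k2 absorbs the term of g linear in h. -/
theorem reducesTo_a (H : L.HasConstants r0 0 0 k1 k2 j) (hk : k1 ≠ 0) :
    L.eq.ReducesTo Kind.a.lattice.eq := by
  obtain ⟨C, hC⟩ := H.lattice.region_y.exists_const (f := fun y => L.h y * exp (-(k1 * y)))
    (fun y hy => by
      exact ((H.deriv_h y hy).mul (((hasDerivAt_id y).const_mul k1).neg.cexp)).congr_deriv
        (by simp; ring))
  have hh : ∀ y ∈ L.Dy, L.h y = C * exp (k1 * y) := fun y hy => by
    rw [← hC y hy, mul_assoc, ← Complex.exp_add]; simp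
  obtain ⟨y0, hy0⟩ := H.lattice.region_y.2.nonempty
  obtain ⟨p0, hp0⟩ := H.lattice.region_p.2.nonempty
  have hC0 : C ≠ 0 := fun h => H.h_ne y0 hy0 (by rw [hh y0 hy0, h, zero_mul])
  have hr0 : r0 ≠ 0 := fun h => H.lattice.r_ne_zero p0 hp0 (by rw [H.r_eq p0 hp0, h]; ring)
  have he : exp (log (r0 * C)) = r0 * C := exp_log (mul_ne_zero hr0 hC0)
  have e1 : ∀ y ∈ L.Dy, exp (k1 * y + log (r0 * C)) = r0 * L.h y := fun y hy => by
    rw [Complex.exp_add, he, hh y hy]; ring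
  refine RTL.reducesTo_of k1 k2 (log (r0 * C)) 1 r0 0 (r0 * j) hk one_ne_zero ?_ ?_ ?_ ?_ ?_
  · intro p hp; simp [Kind.lattice, H.r_eq p hp]
  · intro y hy; simp [Kind.lattice, e1 y hy]
  · intro y hy
    have e2 : exp (2 * (k1 * y + log (r0 * C))) = (r0 * L.h y) ^ 2 := by
      rw [← e1 y hy, ← Complex.exp_nat_mul]; norm_num
    simp only [Kind.lattice, e1 y hy, e2]
    linear_combination r0 * H.integral y hy
  · intro p _; trivial
  · intro y _; trivial

theorem inv_hasDerivAt (H : L.HasConstants r0 r1 r2 k1 k2 j) {y : ℂ} (hy : y ∈ L.Dy) :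
    HasDerivAt (fun y => (L.h y)⁻¹) (r1 - (2 * r2 * L.g y + k1) * (L.h y)⁻¹) y := by
  have h0 := H.h_ne y hy
  exact ((H.deriv_h y hy).inv h0).congr_deriv (by field_simp; ring)

/-- Here (1/h)' = r1, so −j/h is an affine function of y and serves as the new y. The first integral
reads r1 g = r0 h − k2 − j/h, hence g is the new y up to a multiple of h and a constant. -/
theorem reducesTo_b (H : L.HasConstants r0 r1 0 0 k2 j) (hr1 : r1 ≠ 0) (hj : j ≠ 0) :
    L.eq.ReducesTo Kind.b.lattice.eq := by
  obtain ⟨C, hC⟩ := H.lattice.region_y.exists_const (f := fun y => (L.h y)⁻¹ - r1 * y)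
    (fun y hy => by
      exact ((H.inv_hasDerivAt hy).sub ((hasDerivAt_id y).const_mul r1)).congr_deriv (by simp))
  have hx : ∀ y ∈ L.Dy, -(r1 * j) * y + -(j * C) = -j * (L.h y)⁻¹ := fun y hy => by
    rw [← hC y hy]; ring
  have hr : ∀ p, -(r1 * j) * 1 * (p + 0) + -(r0 * j) = -j * (r1 * p + r0) := fun p => by ring
  have hinv : j * j⁻¹ = 1 := mul_inv_cancel₀ hj
  refine RTL.reducesTo_of (-(r1 * j)) (-(r0 * j)) (-(j * C)) 1 (-j⁻¹) 0 (-k2)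
    (by simp [hr1, hj]) one_ne_zero ?_ ?_ ?_ ?_ ?_
  · intro p hp
    simp only [Kind.lattice, hr, H.r_eq p hp]
    linear_combination -(r1 * p + r0) * hinv
  · intro y hy
    have := H.h_ne y hy
    simp only [Kind.lattice, hx y hy]
    field_simp
  · intro y hy
    have := H.h_ne y hy
    have hi := H.integral y hy
    simp only [Kind.lattice, hx y hy]
    field_simp
    linear_combination -hi
  · intro p hp
    have := H.lattice.r_ne_zero p hp
    simp only [Kind.lattice, hr, mem_ofPred_eq]
    rw [H.r_eq p hp] at this
    simpa [hj] using this
  · intro y hy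
    have := H.h_ne y hy
    simp only [Kind.lattice, hx y hy, mem_ofPred_eq]
    simp [hj, this]

/-- The system has two constants of integration, C for 1/h and N for g, corresponding to μ and ν. A
shift of y rescales μ and a change of the time unit rescales ν, so only the vanishing of each
parameter matters. The constants of the system do not record it when C or N is zero, which is why it
is assumed separately. -/
theorem reducesTo_c (H : L.HasConstants r0 r1 0 k1 k2 j) (hr1 : r1 ≠ 0) (hk : k1 ≠ 0) {μ ν : ℂ}
    (hμ : μ = 0 ↔ ∀ y ∈ L.Dy, k1 - r1 * L.h y = 0)
    (hν : ν = 0 ↔ ∀ y ∈ L.Dy, r1 * L.g y - r0 * L.h y + k2 - k1 * r0 / r1 = 0) :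
    L.eq.ReducesTo (Kind.c μ ν).lattice.eq := by
  obtain ⟨C, hC⟩ := H.lattice.region_y.exists_const
    (f := fun y => ((L.h y)⁻¹ - r1 / k1) * exp (k1 * y))
    (fun y hy => by
      exact (((H.inv_hasDerivAt hy).sub_const (r1 / k1)).mul
        (((hasDerivAt_id y).const_mul k1).cexp)).congr_deriv (by simp; field_simp; ring))
  obtain ⟨N, hN⟩ := H.lattice.region_y.exists_const
    (f := fun y => (r1 * L.g y - r0 * L.h y + k2 - k1 * r0 / r1) * L.h y * exp (-(k1 * y)))
    (fun y hy => by
      exact (((((((H.deriv_g y hy).const_mul r1).sub ((H.deriv_h y hy).const_mul r0)).add_const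
        k2).sub_const (k1 * r0 / r1)).mul (H.deriv_h y hy)).mul
        (((hasDerivAt_id y).const_mul k1).neg.cexp)).congr_deriv (by simp; field_simp; ring))
  obtain ⟨y0, hy0⟩ := H.lattice.region_y.2.nonempty
  have hμC : μ = 0 ↔ C = 0 := by
    rw [hμ]
    constructor
    · intro h
      have h1 := h y0 hy0
      have h2 := H.h_ne y0 hy0
      rw [← hC y0 hy0]
      field_simp
      linear_combination exp (k1 * y0) * h1
    · rintro rfl y hy
      have h2 := H.h_ne y hy
      have h1 := hC y hy
      have := Complex.exp_ne_zero (k1 * y)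
      field_simp at h1
      simp only [mul_zero, mul_eq_zero, this, or_false] at h1
      linear_combination h1
  have hνN : ν = 0 ↔ N = 0 := by
    rw [hν]
    constructor
    · intro h
      rw [← hN y0 hy0, h y0 hy0]; ring
    · rintro rfl y hy
      have h2 := H.h_ne y hy
      have h1 := hN y hy
      have := Complex.exp_ne_zero (-(k1 * y))
      simpa [h2] using h1
  -- ε is the exponential of the shift of y, chosen to carry C to μ; below, the time scale δ carries
  -- N to ν. If the constant is zero, any nonzero scale does.
  obtain ⟨ε, hε0, hε⟩ : ∃ ε : ℂ, ε ≠ 0 ∧ C * ε = r1 / k1 * μ := by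
    by_cases h : C = 0
    · exact ⟨1, one_ne_zero, by rw [h, hμC.2 h]; ring⟩
    · have : μ ≠ 0 := fun h' => h (hμC.1 h')
      exact ⟨r1 / k1 * μ / C, by simp [hr1, hk, this, h], by field_simp⟩
  obtain ⟨δ, hδ0, hδ⟩ : ∃ δ : ℂ, δ ≠ 0 ∧ ν * ε * k1 = δ * N * r1 := by
    by_cases h : N = 0
    · exact ⟨1, one_ne_zero, by rw [h, hνN.2 h]; ring⟩
    · have : ν ≠ 0 := fun h' => h (hνN.1 h')
      exact ⟨ν * ε * k1 / (N * r1), by simp [hr1, hk, this, h, hε0], by field_simp⟩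
  have hexp : exp (log ε) = ε := exp_log hε0
  have hx : ∀ y ∈ L.Dy, 1 + μ * exp (-(k1 * y + log ε)) = k1 / r1 * (L.h y)⁻¹ := fun y hy => by
    have e1 := Complex.exp_ne_zero (k1 * y)
    have h2 := H.h_ne y hy
    have : exp (-(k1 * y + log ε)) = (exp (k1 * y))⁻¹ * ε⁻¹ := by
      rw [Complex.exp_neg, Complex.exp_add, hexp, mul_inv]
    rw [this]
    have h1 := hC y hy
    have h3 : μ = k1 / r1 * (C * ε) := by rw [hε]; field_simp
    rw [h3, ← h1]
    field_simp
    ring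
  have hG : ∀ y ∈ L.Dy, (r1 * L.g y - r0 * L.h y + k2 - k1 * r0 / r1)
      = N * (r1 / k1 * exp (k1 * y) + C) := fun y hy => by
    have e1 := Complex.exp_ne_zero (k1 * y)
    have h2 := H.h_ne y hy
    rw [← hC y hy, ← hN y hy, Complex.exp_neg]
    field_simp
    ring
  have hr : ∀ p, k1 * δ * (p + 0) + r0 * (k1 * δ / r1) = k1 * δ / r1 * (r1 * p + r0) :=
    fun p => by field_simp; ring
  refine RTL.reducesTo_of k1 (r0 * (k1 * δ / r1)) (log ε) δ (r1 / (k1 * δ)) 0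
    (δ * (N * C - k2 + k1 * r0 / r1)) hk hδ0 ?_ ?_ ?_ ?_ ?_
  · intro p hp
    simp only [Kind.lattice, hr, H.r_eq p hp]
    field_simp
    ring
  · intro y hy
    have := H.h_ne y hy
    simp only [Kind.lattice, hx y hy]
    field_simp
  · intro y hy
    have := H.h_ne y hy
    have hi := hG y hy
    simp only [Kind.lattice, hx y hy, Complex.exp_add, hexp]
    have e1 : ν * (exp (k1 * y) * ε) = δ * N * r1 / k1 * exp (k1 * y) := by
      rw [← hδ]; field_simp
    rw [e1]
    have e2 : 1 / (k1 / r1 * (L.h y)⁻¹) = r1 / k1 * L.h y := by field_simp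
    rw [e2]
    have e3 : k1 * δ ^ 2 * (r1 / (k1 * δ)) * (L.g y - 0 * L.h y) = δ * (r1 * L.g y) := by
      field_simp; ring
    rw [e3]
    have e4 : r0 * (k1 * δ / r1) * (r1 / k1 * L.h y) = δ * (r0 * L.h y) := by field_simp
    rw [e4]
    linear_combination δ * hi
  · intro p hp
    have := H.lattice.r_ne_zero p hp
    simp only [Kind.lattice, hr, mem_ofPred_eq]
    rw [H.r_eq p hp] at this
    simpa [hk, hδ0, hr1] using this
  · intro y hy
    have := H.h_ne y hy
    simp only [Kind.lattice, hx y hy, mem_ofPred_eq]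
    simp [hk, hr1, this]

end RTL.HasConstants

/-! ### Normal forms with r of degree two: (d), (e), (f), (g) -/

namespace RTL

/-- A lattice with quadratic `r`, in terms of the polynomial in the shifted variable `p + s`, of
`x = 1 / h` and of the derivative `z` of `x`. -/
structure IsCentered (L : RTL) (r2 s ρ k κ c : ℂ) (z : ℂ → ℂ) : Prop where
  lattice : L.IsLattice
  r2_ne : r2 ≠ 0
  h_ne : ∀ y ∈ L.Dy, L.h y ≠ 0
  r_eq : ∀ p ∈ L.Dp, L.r p = r2 * (p + s) ^ 2 + ρ
  deriv_inv : ∀ y ∈ L.Dy, HasDerivAt (fun y => (L.h y)⁻¹) (z y) y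
  deriv_z : ∀ y ∈ L.Dy, HasDerivAt z (4 * r2 * κ * (L.h y)⁻¹ + 2 * r2 * k) y
  z_sq : ∀ y ∈ L.Dy, z y ^ 2 = 4 * r2 * (κ * (L.h y)⁻¹ ^ 2 + k * (L.h y)⁻¹ - ρ)
  g_eq : ∀ y ∈ L.Dy, 2 * r2 * (L.g y - s * L.h y) = c - z y * L.h y

/-- Completing the square in r gives s and ρ; completing it in r2 P² + k1 P − j gives −κ. The first
integral becomes an energy equation for x = 1/h, and g is recovered from x and z = x'. Exchanging r0
↔ −j and r1 ↔ k1 exchanges ρ ↔ −κ and fixes k. -/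
theorem HasConstants.isCentered {L : RTL} {r0 r1 r2 k1 k2 j : ℂ}
    (H : L.HasConstants r0 r1 r2 k1 k2 j) (hr2 : r2 ≠ 0) :
    L.IsCentered r2 (r1 / (2 * r2)) (r0 - r1 ^ 2 / (4 * r2)) (k2 - r1 * k1 / (2 * r2))
      (j + k1 ^ 2 / (4 * r2)) (-k1) (fun y => r1 - (2 * r2 * L.g y + k1) * (L.h y)⁻¹) where
  lattice := H.lattice
  r2_ne := hr2
  h_ne := H.h_ne
  r_eq p hp := by rw [H.r_eq p hp]; field_simp; ring
  deriv_inv y hy := H.inv_hasDerivAt hy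
  deriv_z y hy := by
    have h0 := H.h_ne y hy
    refine ((((((H.deriv_g y hy).const_mul (2 * r2)).add_const k1).mul
      (H.inv_hasDerivAt hy))).const_sub r1).congr_deriv ?_
    rw [← H.integral y hy]
    field_simp
    ring
  z_sq y hy := by
    have h0 := H.h_ne y hy
    rw [← H.integral y hy]
    field_simp
    ring
  g_eq y hy := by
    have h0 := H.h_ne y hy
    field_simp
    ring

namespace IsCentered

variable {L : RTL} {r2 s ρ k κ c : ℂ} {z : ℂ → ℂ}

/-- For κ = 0 the function z is affine in y, so x is a quadratic polynomial in y. Scaling changes ρ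
by any nonzero factor, so only its vanishing has to agree with that of μ. -/
theorem reducesTo_f (H : L.IsCentered r2 s ρ k 0 c z) (hk : k ≠ 0) {μ : ℂ} (hμ : μ = 0 ↔ ρ = 0) :
    L.eq.ReducesTo (Kind.f μ).lattice.eq := by
  have hr2 := H.r2_ne
  obtain ⟨C, hC⟩ := H.lattice.region_y.exists_const (f := fun y => z y - 2 * r2 * k * y)
    (fun y hy => by
      exact ((H.deriv_z y hy).sub ((hasDerivAt_id y).const_mul (2 * r2 * k))).congr_deriv
        (by simp))
  obtain ⟨lam, hl0, hl⟩ : ∃ lam : ℂ, lam ≠ 0 ∧ lam * μ = ρ := by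
    by_cases h : μ = 0
    · exact ⟨1, one_ne_zero, by rw [hμ.1 h, h]; ring⟩
    · exact ⟨ρ / μ, div_ne_zero (fun h' => h (hμ.2 h')) h, by field_simp⟩
  obtain ⟨α, hα⟩ := IsAlgClosed.exists_pow_nat_eq (r2 * k ^ 2 / lam) (n := 2) (by norm_num)
  have hα0 : α ≠ 0 := by
    rintro rfl
    have : r2 * k ^ 2 / lam ≠ 0 := by simp [hr2, hk, hl0]
    exact this (by rw [← hα]; ring)
  have hα' : lam * α ^ 2 = r2 * k ^ 2 := by rw [hα]; field_simp
  have hz : ∀ y ∈ L.Dy, z y = 2 * r2 * k / α * (α * y + α * C / (2 * r2 * k)) := fun y hy => by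
    have h2 := hC y hy
    field_simp
    linear_combination h2
  have hx : ∀ y ∈ L.Dy, μ + (α * y + α * C / (2 * r2 * k)) ^ 2 = k / lam * (L.h y)⁻¹ :=
    fun y hy => by
      have h1 := H.z_sq y hy
      rw [hz y hy] at h1
      generalize α * y + α * C / (2 * r2 * k) = Y at *
      rw [← hl] at h1
      have h3 : (2 * r2 * k / α * Y) ^ 2 = 4 * r2 * (lam * Y ^ 2) := by
        field_simp
        linear_combination (-4) * Y ^ 2 * hα'
      rw [h3] at h1
      have h4 := mul_left_cancel₀ (by simp [hr2] : 4 * r2 ≠ 0) h1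
      have h5 : k / lam * (L.h y)⁻¹ = (k * (L.h y)⁻¹) / lam := by ring
      rw [h5, eq_div_iff hl0]
      linear_combination h4
  have hr : ∀ p ∈ L.Dp, L.r p = lam * ((α * (1 / k) * (p + s) + 0) ^ 2 + μ) := fun p hp => by
    rw [H.r_eq p hp, ← hl]
    field_simp
    linear_combination -(p + s) ^ 2 * hα'
  refine RTL.reducesTo_of α 0 (α * C / (2 * r2 * k)) (1 / k) lam s
    (α * (1 / k) ^ 2 * lam * c / (2 * r2)) hα0 (by simp [hk]) hr ?_ ?_ ?_ ?_
  · intro y hy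
    have := H.h_ne y hy
    simp only [Kind.lattice, hx y hy]
    field_simp
  · intro y hy
    have := H.h_ne y hy
    have hg := H.g_eq y hy
    simp only [Kind.lattice, hx y hy]
    rw [hz y hy] at hg
    generalize α * y + α * C / (2 * r2 * k) = Y at *
    field_simp at hg ⊢
    linear_combination hg
  · intro p hp
    have := H.lattice.r_ne_zero p hp
    rw [hr p hp] at this
    exact right_ne_zero_of_mul this
  · intro y hy
    have := H.h_ne y hy
    simp only [Kind.lattice, hx y hy, mem_ofPred_eq]
    simp [hk, hl0, this]

/-- For κ = k = 0, z is a constant b with b² = −4 r2 ρ ≠ 0. Thus x is affine and r has two distinct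
roots, which are moved to 0 and −1. -/
theorem reducesTo_d (H : L.IsCentered r2 s ρ 0 0 c z) (hρ : ρ ≠ 0) :
    L.eq.ReducesTo Kind.d.lattice.eq := by
  have hr2 := H.r2_ne
  obtain ⟨b, hb⟩ := H.lattice.region_y.exists_const (f := z)
    (fun y hy => (H.deriv_z y hy).congr_deriv (by ring))
  obtain ⟨C, hC⟩ := H.lattice.region_y.exists_const (f := fun y => (L.h y)⁻¹ - b * y)
    (fun y hy => by
      exact ((H.deriv_inv y hy).sub ((hasDerivAt_id y).const_mul b)).congr_deriv
        (by rw [hb y hy]; simp))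
  obtain ⟨y0, hy0⟩ := H.lattice.region_y.2.nonempty
  have hbρ : b ^ 2 = -4 * r2 * ρ := by
    rw [← hb y0 hy0, H.z_sq y0 hy0]; ring
  have hb0 : b ≠ 0 := by
    rintro rfl
    have : -4 * r2 * ρ ≠ 0 := by simp [hr2, hρ]
    exact this (by rw [← hbρ]; ring)
  have hx : ∀ y ∈ L.Dy, r2 / b * y + C * r2 / b ^ 2 = r2 / b ^ 2 * (L.h y)⁻¹ := fun y hy => by
    rw [← hC y hy]; field_simp; ring
  have hr : ∀ p ∈ L.Dp, L.r p = b ^ 2 / r2 * ((r2 / b * 1 * (p + s) + -1 / 2) *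
      (r2 / b * 1 * (p + s) + -1 / 2 + 1)) := fun p hp => by
    have : ρ = -b ^ 2 / (4 * r2) := by rw [hbρ]; field_simp
    rw [H.r_eq p hp, this]
    field_simp
    ring
  refine RTL.reducesTo_of (r2 / b) (-1 / 2) (C * r2 / b ^ 2) 1 (b ^ 2 / r2) s (b * c / (2 * r2))
    (by simp [hb0, hr2]) one_ne_zero hr ?_ ?_ ?_ ?_
  · intro y hy
    have := H.h_ne y hy
    simp only [Kind.lattice, hx y hy]
    field_simp
  · intro y hy
    have := H.h_ne y hy
    have hg := H.g_eq y hy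
    simp only [Kind.lattice, hx y hy]
    rw [hb y hy] at hg
    field_simp
    linear_combination b * hg
  · intro p hp
    have := H.lattice.r_ne_zero p hp
    rw [hr p hp] at this
    exact right_ne_zero_of_mul this
  · intro y hy
    have := H.h_ne y hy
    simp only [Kind.lattice, hx y hy, mem_ofPred_eq]
    simp [hr2, hb0, this]

/-- The reciprocal of `h` is a combination of exponential functions. -/
theorem exists_exp (H : L.IsCentered r2 s ρ k κ c z) (hκ : κ ≠ 0) (θ : ℂ) (hθ : θ ^ 2 = 4 * r2 * κ) :
    ∃ A B : ℂ, 16 * κ ^ 2 * (A * B) = k ^ 2 + 4 * ρ * κ ∧ ∀ y ∈ L.Dy,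
      (L.h y)⁻¹ + k / (2 * κ) = A * exp (θ * y) + B * exp (-(θ * y)) ∧
      z y = θ * (A * exp (θ * y) - B * exp (-(θ * y))) := by
  have hr2 := H.r2_ne
  have hθ0 : θ ≠ 0 := by
    rintro rfl
    have : 4 * r2 * κ ≠ 0 := by simp [hr2, hκ]
    exact this (by rw [← hθ]; ring)
  have hκ' : κ = θ ^ 2 / (4 * r2) := by rw [hθ]; field_simp
  -- X = x + k/(2κ) satisfies X'' = θ²X, so X ± X'/θ are multiples of exp(±θy). The product of the
  -- two coefficients is fixed by the energy equation.
  obtain ⟨A, hA⟩ := H.lattice.region_y.exists_const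
    (f := fun y => ((L.h y)⁻¹ + k / (2 * κ) + z y / θ) * exp (-(θ * y)))
    (fun y hy => by
      exact ((((H.deriv_inv y hy).add_const (k / (2 * κ))).add
        ((H.deriv_z y hy).div_const θ)).mul
        (((hasDerivAt_id y).const_mul θ).neg.cexp)).congr_deriv
          (by simp [hκ']; field_simp; ring))
  obtain ⟨B, hB⟩ := H.lattice.region_y.exists_const
    (f := fun y => ((L.h y)⁻¹ + k / (2 * κ) - z y / θ) * exp (θ * y))
    (fun y hy => by
      exact ((((H.deriv_inv y hy).add_const (k / (2 * κ))).sub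
        ((H.deriv_z y hy).div_const θ)).mul
        (((hasDerivAt_id y).const_mul θ).cexp)).congr_deriv
          (by simp [hκ']; field_simp; ring))
  refine ⟨A / 2, B / 2, ?_, ?_⟩
  · obtain ⟨y0, hy0⟩ := H.lattice.region_y.2.nonempty
    have e1 := Complex.exp_ne_zero (θ * y0)
    have h0 := H.h_ne y0 hy0
    have h1 := H.z_sq y0 hy0
    rw [← hA y0 hy0, ← hB y0 hy0, Complex.exp_neg]
    generalize z y0 = Z at *
    have e2 : ((L.h y0)⁻¹ + k / (2 * κ) + Z / θ) * (exp (θ * y0))⁻¹ / 2 *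
      (((L.h y0)⁻¹ + k / (2 * κ) - Z / θ) * exp (θ * y0) / 2) =
      (((L.h y0)⁻¹ + k / (2 * κ)) ^ 2 - Z ^ 2 / θ ^ 2) / 4 := by
        field_simp
        ring
    rw [e2, h1, hθ]
    field_simp
    ring
  · intro y hy
    have e1 := Complex.exp_ne_zero (θ * y)
    rw [← hA y hy, ← hB y hy, Complex.exp_neg]
    generalize (L.h y)⁻¹ + k / (2 * κ) = X
    constructor <;> field_simp <;> ring

/-- A nonzero discriminant makes both exponentials present in x, and a shift of y balances them: x =
Λ(m + cosh Y). Reversing the sign of Λ reverses that of m, so only m² is determined. -/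
theorem reducesTo_g (H : L.IsCentered r2 s ρ k κ c z) (hκ : κ ≠ 0) {m : ℂ}
    (hD : k ^ 2 + 4 * ρ * κ ≠ 0) (hm : m ^ 2 * (k ^ 2 + 4 * ρ * κ) = k ^ 2) :
    L.eq.ReducesTo (Kind.g m).lattice.eq := by
  have hr2 := H.r2_ne
  obtain ⟨θ, hθ⟩ := IsAlgClosed.exists_pow_nat_eq (4 * r2 * κ) (n := 2) (by norm_num)
  have hθ0 : θ ≠ 0 := by
    rintro rfl
    have : 4 * r2 * κ ≠ 0 := by simp [hr2, hκ]
    exact this (by rw [← hθ]; ring)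
  obtain ⟨A, B, hAB, hx⟩ := H.exists_exp hκ θ hθ
  have hA : A ≠ 0 := by rintro rfl; exact hD (by rw [← hAB]; ring)
  -- The root Λ of 4AB is chosen with the sign that fits the prescribed m; both signs work only if m
  -- = 0.
  obtain ⟨Λ, hΛ, hΛm⟩ : ∃ Λ : ℂ, Λ ^ 2 = 4 * (A * B) ∧ Λ * m = -k / (2 * κ) := by
    by_cases h : m = 0
    · obtain ⟨Λ, hΛ⟩ := IsAlgClosed.exists_pow_nat_eq (4 * (A * B)) (n := 2) (by norm_num)
      have hk : k = 0 := by
        have : k ^ 2 = 0 := by rw [← hm, h]; ring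
        simpa using this
      exact ⟨Λ, hΛ, by rw [hk, h]; simp⟩
    · refine ⟨-k / (2 * κ) / m, ?_, by field_simp⟩
      rw [← hAB] at hm
      field_simp
      linear_combination -hm
  have hΛ0 : Λ ≠ 0 := by
    rintro rfl
    exact hD (by rw [← hAB]; linear_combination (-4) * κ ^ 2 * hΛ)
  have he : exp (log (2 * A / Λ)) = 2 * A / Λ := exp_log (by simp [hA, hΛ0])
  have hB : B = Λ ^ 2 / (4 * A) := by rw [hΛ]; field_simp
  have hk : k = -(2 * κ * (Λ * m)) := by rw [hΛm]; field_simp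
  have hρ : ρ = κ * Λ ^ 2 * (1 - m ^ 2) := by
    have h1 : 4 * κ * ρ = 4 * κ * (κ * Λ ^ 2 * (1 - m ^ 2)) := by
      rw [hk] at hAB
      linear_combination -hAB - 4 * κ ^ 2 * hΛ
    exact mul_left_cancel₀ (by simp [hκ]) h1
  have hE : ∀ y, exp (θ * y + log (2 * A / Λ)) = exp (θ * y) * (2 * A / Λ) := fun y => by
    rw [Complex.exp_add, he]
  have hcosh : ∀ y ∈ L.Dy, m + cosh (θ * y + log (2 * A / Λ)) = Λ⁻¹ * (L.h y)⁻¹ := fun y hy => by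
    have e1 := Complex.exp_ne_zero (θ * y)
    have h1 := (hx y hy).1
    rw [Complex.cosh, Complex.exp_neg, hE, eq_sub_of_add_eq h1, hB, hk, Complex.exp_neg]
    field_simp
    ring
  have hsinh : ∀ y ∈ L.Dy, sinh (θ * y + log (2 * A / Λ)) = Λ⁻¹ * θ⁻¹ * z y := fun y hy => by
    have e1 := Complex.exp_ne_zero (θ * y)
    rw [Complex.sinh, Complex.exp_neg, hE, (hx y hy).2, hB, Complex.exp_neg]
    field_simp
    ring
  have hr : ∀ p ∈ L.Dp, L.r p = 2 * κ * Λ ^ 2 * (1 / 2 *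
      ((θ * (1 / (2 * κ * Λ)) * (p + s) + 0) ^ 2 + 1 - m ^ 2)) := fun p hp => by
    rw [H.r_eq p hp, hρ]
    field_simp
    linear_combination -(p + s) ^ 2 * hθ
  refine RTL.reducesTo_of θ 0 (log (2 * A / Λ)) (1 / (2 * κ * Λ)) (2 * κ * Λ ^ 2) s
    (c / θ) hθ0 (by simp [hκ, hΛ0]) hr ?_ ?_ ?_ ?_
  · intro y hy
    have := H.h_ne y hy
    simp only [Kind.lattice, hcosh y hy]
    field_simp
  · intro y hy
    have := H.h_ne y hy
    have hg := H.g_eq y hy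
    simp only [Kind.lattice, hcosh y hy, hsinh y hy]
    field_simp
    linear_combination 2 * κ * hg + (L.g y - s * L.h y) * hθ
  · intro p hp
    have := H.lattice.r_ne_zero p hp
    rw [hr p hp] at this
    exact right_ne_zero_of_mul (right_ne_zero_of_mul this)
  · intro y hy
    have := H.h_ne y hy
    simp only [Kind.lattice, hcosh y hy, mem_ofPred_eq]
    simp [hΛ0, this]

/-- With zero discriminant, AB = 0 and x is a constant plus a single exponential. The equations also
allow x to be constant, and `hz` excludes this. The time scale maps k to m, so only the vanishing of
k matters. -/
theorem reducesTo_e (H : L.IsCentered r2 s ρ k κ c z) (hκ : κ ≠ 0) {m : ℂ}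
    (hD : k ^ 2 + 4 * ρ * κ = 0) (hm : m = 0 ↔ k = 0) (hz : ∃ y ∈ L.Dy, z y ≠ 0) :
    L.eq.ReducesTo (Kind.e m).lattice.eq := by
  have hr2 := H.r2_ne
  obtain ⟨θ, A, hθ, hx⟩ : ∃ θ A : ℂ, θ ^ 2 = 4 * r2 * κ ∧ ∀ y ∈ L.Dy,
      (L.h y)⁻¹ + k / (2 * κ) = A * exp (θ * y) ∧ z y = θ * (A * exp (θ * y)) := by
    obtain ⟨θ, hθ⟩ := IsAlgClosed.exists_pow_nat_eq (4 * r2 * κ) (n := 2) (by norm_num)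
    obtain ⟨A, B, hAB, hx⟩ := H.exists_exp hκ θ hθ
    rw [hD] at hAB
    have : A = 0 ∨ B = 0 := by simpa [hκ] using hAB
    rcases this with rfl | rfl
    -- If the surviving exponential is exp(−θy), the other square root is used in place of θ.
    · exact ⟨-θ, B, by rw [← hθ]; ring, fun y hy => by simpa using hx y hy⟩
    · exact ⟨θ, A, hθ, fun y hy => by simpa using hx y hy⟩
  have hθ0 : θ ≠ 0 := by
    rintro rfl
    have : 4 * r2 * κ ≠ 0 := by simp [hr2, hκ]
    exact this (by rw [← hθ]; ring)
  have hA : A ≠ 0 := by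
    rintro rfl
    obtain ⟨y, hy, h⟩ := hz
    exact h (by rw [(hx y hy).2]; ring)
  obtain ⟨δ, hδ0, hδ⟩ : ∃ δ : ℂ, δ ≠ 0 ∧ m = -(2 * δ * k) := by
    by_cases h : m = 0
    · exact ⟨1, one_ne_zero, by rw [hm.1 h, h]; ring⟩
    · have : k ≠ 0 := fun h' => h (hm.2 h')
      exact ⟨-m / (2 * k), by simp [h, this], by field_simp⟩
  have he : exp (log (4 * κ * δ * A)) = 4 * κ * δ * A := exp_log (by simp [hA, hκ, hδ0])
  have hρ : ρ = -k ^ 2 / (4 * κ) := by field_simp; linear_combination hD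
  have hE : ∀ y ∈ L.Dy, m + exp (θ * y + log (4 * κ * δ * A)) = 4 * κ * δ * (L.h y)⁻¹ :=
    fun y hy => by
      rw [Complex.exp_add, he, hδ, eq_sub_of_add_eq (hx y hy).1]
      field_simp
      ring
  have hr : ∀ p ∈ L.Dp, L.r p = 1 / (4 * κ * δ ^ 2) * ((θ * δ * (p + s) + m / 2) *
      (θ * δ * (p + s) + m / 2 - m)) := fun p hp => by
    rw [H.r_eq p hp, hρ, hδ]
    field_simp
    linear_combination -(p + s) ^ 2 * hθ
  refine RTL.reducesTo_of θ (m / 2) (log (4 * κ * δ * A)) δ (1 / (4 * κ * δ ^ 2)) s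
    ((c - θ) / (2 * θ)) hθ0 hδ0 hr ?_ ?_ ?_ ?_
  · intro y hy
    have := H.h_ne y hy
    simp only [Kind.lattice, hE y hy]
    field_simp
  · intro y hy
    have := H.h_ne y hy
    have hg := H.g_eq y hy
    rw [(hx y hy).2, ← (hx y hy).1] at hg
    simp only [Kind.lattice, hE y hy]
    rw [hδ]
    field_simp at hg ⊢
    linear_combination 2 * hg + 2 * (L.g y - s * L.h y) * hθ
  · intro p hp
    have := H.lattice.r_ne_zero p hp
    rw [hr p hp] at this
    exact right_ne_zero_of_mul this
  · intro y hy
    have := H.h_ne y hy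
    simp only [Kind.lattice, hE y hy, mem_ofPred_eq]
    simp [hκ, hδ0, this]

end IsCentered
end RTL

/-! ### The listed lattices: natural domains and constants -/

/-- The plane has real dimension two, so removing countably many points leaves it connected. -/
theorem isRegion_ne_zero {f : ℂ → ℂ} (hf : Continuous f) (hc : {z | f z = 0}.Countable) :
    IsRegion {z | f z ≠ 0} :=
  ⟨isOpen_ne_fun hf continuous_const,
    hc.isConnected_compl_of_one_lt_rank (by simp [Complex.rank_real_complex])⟩

theorem isRegion_univ : IsRegion (univ : Set ℂ) := ⟨isOpen_univ, isConnected_univ⟩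

theorem finite_quadratic_eq_zero (b c : ℂ) : {w : ℂ | w ^ 2 + b * w + c = 0}.Finite := by
  obtain ⟨d, hd⟩ := IsAlgClosed.exists_pow_nat_eq (b ^ 2 - 4 * c) (n := 2) (by norm_num)
  refine (Set.toFinite {(-b + d) / 2, (-b - d) / 2}).subset fun w hw => ?_
  have hw' : w ^ 2 + b * w + c = 0 := hw
  have h : (2 * w + b - d) * (2 * w + b + d) = 0 := by linear_combination 4 * hw' - hd
  rcases mul_eq_zero.1 h with h | h
  · left; linear_combination h / 2
  · right
    rw [mem_singleton_iff]
    linear_combination h / 2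

namespace RTL

theorem hasConstants_of {L : RTL} {r0 r1 r2 k1 k2 j : ℂ} (hp : IsRegion L.Dp) (hy : IsRegion L.Dy)
    (hr0 : ∀ p ∈ L.Dp, L.r p ≠ 0) (hr : ∀ p ∈ L.Dp, L.r p = r2 * p ^ 2 + r1 * p + r0)
    (h_ne : ∀ y ∈ L.Dy, L.h y ≠ 0)
    (deriv_h : ∀ y ∈ L.Dy, HasDerivAt L.h (L.h y * (2 * r2 * L.g y - r1 * L.h y + k1)) y)
    (deriv_g : ∀ y ∈ L.Dy, HasDerivAt L.g (L.h y * (r1 * L.g y - 2 * r0 * L.h y + k2)) y)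
    (integral : ∀ y ∈ L.Dy,
      r2 * L.g y ^ 2 + k1 * L.g y - r1 * L.g y * L.h y + r0 * L.h y ^ 2 - k2 * L.h y = j) :
    L.HasConstants r0 r1 r2 k1 k2 j where
  lattice :=
    { region_p := hp
      region_y := hy
      holo_r := DifferentiableOn.congr (f := fun p => r2 * p ^ 2 + r1 * p + r0)
        (by fun_prop) hr
      holo_g := fun y h => (deriv_g y h).differentiableAt.differentiableWithinAt
      holo_h := fun y h => (deriv_h y h).differentiableAt.differentiableWithinAt
      r_ne_zero := hr0 }
  h_ne := h_ne
  r_eq := hr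
  deriv_h := deriv_h
  deriv_g := deriv_g
  integral := integral

end RTL

theorem isRegion_ne_zero_id : IsRegion {y : ℂ | y ≠ 0} :=
  isRegion_ne_zero continuous_id (by simp)

theorem isRegion_of_quadratic {f : ℂ → ℂ} (b c : ℂ) (h : ∀ w, f w = w ^ 2 + b * w + c) :
    IsRegion {w : ℂ | f w ≠ 0} := by
  simp only [h]
  exact isRegion_ne_zero (by fun_prop) (finite_quadratic_eq_zero b c).countable

theorem isRegion_of_cexp {f : ℂ → ℂ} (hf : Continuous f) {b c : ℂ}
    (h : ∀ y, f y = 0 → exp y ^ 2 + b * exp y + c = 0) : IsRegion {y | f y ≠ 0} :=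
  isRegion_ne_zero hf ((finite_quadratic_eq_zero b c).countable.preimage_cexp.mono fun y hy => h y hy)

namespace Kind

theorem hasConstants_a : Kind.a.lattice.HasConstants 1 0 0 1 0 0 := by
  refine RTL.hasConstants_of isRegion_univ isRegion_univ (by simp [Kind.lattice])
    (by simp [Kind.lattice]) (by simp [Kind.lattice]) ?_ ?_ ?_
  · intro y _
    exact (hasDerivAt_exp y).congr_deriv (by simp [Kind.lattice])
  · intro y _
    refine (((hasDerivAt_id y).const_mul 2).cexp).neg.congr_deriv ?_
    simp only [Kind.lattice, id]
    rw [two_mul y, Complex.exp_add]; ring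
  · intro y _
    simp only [Kind.lattice]
    rw [two_mul y, Complex.exp_add]; ring

theorem hasConstants_b : Kind.b.lattice.HasConstants 0 1 0 0 0 (-1) := by
  refine RTL.hasConstants_of isRegion_ne_zero_id isRegion_ne_zero_id (by simp [Kind.lattice])
    (by simp [Kind.lattice]) (by simp [Kind.lattice]) ?_ ?_ ?_
  · intro y hy
    have hy : y ≠ 0 := hy
    simp only [Kind.lattice, one_div]
    exact (hasDerivAt_inv hy).congr_deriv (by field_simp; ring)
  · intro y hy
    have hy : y ≠ 0 := hy
    exact (hasDerivAt_id y).congr_deriv (by simp only [Kind.lattice]; field_simp; ring)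
  · intro y hy
    have hy : y ≠ 0 := hy
    simp only [Kind.lattice]; field_simp; ring

theorem hasConstants_c (μ ν : ℂ) : (Kind.c μ ν).lattice.HasConstants 0 1 0 1 (μ * ν) 0 := by
  refine RTL.hasConstants_of isRegion_ne_zero_id
    (isRegion_of_cexp (b := μ) (c := 0) (by fun_prop) ?_) (by simp [Kind.lattice])
    (by simp [Kind.lattice]) (fun y hy => one_div_ne_zero hy) ?_ ?_ ?_
  · intro y h
    have e := Complex.exp_ne_zero y
    rw [Complex.exp_neg] at h
    field_simp at h
    linear_combination exp y * h
  · intro y hy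
    have hy : 1 + μ * exp (-y) ≠ 0 := hy
    simp only [Kind.lattice, one_div]
    refine HasDerivAt.congr_deriv
      ((((hasDerivAt_id y).neg.cexp.const_mul μ).const_add 1).fun_inv hy) ?_
    simp only [Pi.neg_apply, id]
    field_simp
    ring
  · intro y hy
    have hy : 1 + μ * exp (-y) ≠ 0 := hy
    refine ((hasDerivAt_exp y).const_mul ν).congr_deriv ?_
    simp only [Kind.lattice]
    have e : exp (-y) * exp y = 1 := by rw [← Complex.exp_add]; simp
    field_simp
    linear_combination ν * μ * (1 + μ * exp (-y)) * e
  · intro y hy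
    have hy : 1 + μ * exp (-y) ≠ 0 := hy
    have e : exp (-y) * exp y = 1 := by rw [← Complex.exp_add]; simp
    simp only [Kind.lattice]
    field_simp
    linear_combination ν * μ * (1 + μ * exp (-y)) * e

theorem hasConstants_d : Kind.d.lattice.HasConstants 0 1 1 0 0 0 := by
  refine RTL.hasConstants_of ?_ isRegion_ne_zero_id (fun p hp => hp)
    (fun p _ => by simp only [Kind.lattice]; ring) (by simp [Kind.lattice]) ?_ ?_ ?_
  · exact isRegion_of_quadratic (f := fun p => p * (p + 1)) 1 0 (fun w => by ring)
  · intro y hy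
    have hy : y ≠ 0 := hy
    simp only [Kind.lattice, one_div]
    exact (hasDerivAt_inv hy).congr_deriv (by field_simp; ring)
  · intro y _
    exact (hasDerivAt_const y (0 : ℂ)).congr_deriv (by simp [Kind.lattice])
  · intro y _
    simp [Kind.lattice]

theorem hasConstants_e (μ : ℂ) : (Kind.e μ).lattice.HasConstants 0 (-μ) 1 (-1) 0 0 := by
  refine RTL.hasConstants_of ?_ (isRegion_of_cexp (b := μ) (c := 0) (by fun_prop) ?_)
    (fun p hp => hp) (fun p _ => by simp only [Kind.lattice]; ring)
    (fun y hy => one_div_ne_zero hy) ?_ ?_ ?_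
  · exact isRegion_of_quadratic (f := fun p => p * (p - μ)) (-μ) 0 (fun w => by ring)
  · intro y h
    linear_combination exp y * h
  · intro y hy
    have hy : μ + exp y ≠ 0 := hy
    simp only [Kind.lattice, one_div]
    refine HasDerivAt.congr_deriv (((hasDerivAt_exp y).const_add μ).fun_inv hy) ?_
    field_simp
    ring
  · intro y _
    exact (hasDerivAt_const y (0 : ℂ)).congr_deriv (by simp [Kind.lattice])
  · intro y _
    simp [Kind.lattice]

theorem hasConstants_f (μ : ℂ) : (Kind.f μ).lattice.HasConstants μ 0 1 0 1 0 := by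
  refine RTL.hasConstants_of ?_ ?_
    (fun p hp => hp) (fun p _ => by simp only [Kind.lattice]; ring)
    (fun y hy => one_div_ne_zero hy) ?_ ?_ ?_
  · exact isRegion_of_quadratic (f := fun p => p ^ 2 + μ) 0 μ (fun w => by ring)
  · exact isRegion_of_quadratic (f := fun y => μ + y ^ 2) 0 μ (fun w => by ring)
  · intro y hy
    have hy : μ + y ^ 2 ≠ 0 := hy
    simp only [Kind.lattice, one_div]
    refine HasDerivAt.congr_deriv (((hasDerivAt_pow 2 y).const_add μ).fun_inv hy) ?_
    field_simp
    ring
  · intro y hy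
    have hy : μ + y ^ 2 ≠ 0 := hy
    refine HasDerivAt.congr_deriv
      ((hasDerivAt_id y).neg.div ((hasDerivAt_pow 2 y).const_add μ) hy) ?_
    simp [Kind.lattice]
    field_simp
    ring
  · intro y hy
    have hy : μ + y ^ 2 ≠ 0 := hy
    simp only [Kind.lattice]
    field_simp
    ring

theorem hasConstants_g (μ : ℂ) :
    (Kind.g μ).lattice.HasConstants ((1 - μ ^ 2) / 2) 0 (1 / 2) 0 (-μ) (1 / 2) := by
  refine RTL.hasConstants_of ?_
    (isRegion_of_cexp (b := 2 * μ) (c := 1) (by fun_prop) ?_)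
    (fun p hp => mul_ne_zero (by norm_num) hp) (fun p _ => by simp only [Kind.lattice]; ring)
    (fun y hy => one_div_ne_zero hy) ?_ ?_ ?_
  · exact isRegion_of_quadratic (f := fun p => p ^ 2 + 1 - μ ^ 2) 0 (1 - μ ^ 2) (fun w => by ring)
  · intro y h
    have e : exp (-y) * exp y = 1 := by rw [← Complex.exp_add]; simp
    rw [Complex.cosh] at h
    linear_combination 2 * exp y * h - e
  · intro y hy
    have hy : μ + cosh y ≠ 0 := hy
    simp only [Kind.lattice, one_div]
    refine HasDerivAt.congr_deriv (((hasDerivAt_cosh y).const_add μ).fun_inv hy) ?_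
    field_simp
    ring
  · intro y hy
    have hy : μ + cosh y ≠ 0 := hy
    refine HasDerivAt.congr_deriv
      ((hasDerivAt_sinh y).neg.div ((hasDerivAt_cosh y).const_add μ) hy) ?_
    have e := Complex.cosh_sq y
    simp [Kind.lattice]
    field_simp
    linear_combination -e
  · intro y hy
    have hy : μ + cosh y ≠ 0 := hy
    have e := Complex.cosh_sq y
    simp only [Kind.lattice]
    field_simp
    linear_combination -e

end Kind

/-! ### The transformations T₊ and T₋ in terms of the inverse of T -/

namespace RTL

/-- The numerator of `Δ`, which becomes the coefficient `r` of the dual lattice. -/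
noncomputable def dualCoeff (L : RTL) (z : ℂ × ℂ) : ℂ :=
  L.h z.2 ^ 2 * L.r z.1 + deriv L.h z.2 * z.1 + deriv L.g z.2

theorem jac_eq (L : RTL) {p : ℂ} (y : ℂ) (hp : L.r p ≠ 0) : L.jac p y = L.dualCoeff (p, y) / L.r p := by
  rw [jac, dualCoeff]
  field_simp
  ring

/-- The box `E.Dp × E.Dy` lies in the image of `U × V` under `T`, which is biholomorphic with
inverse `S`. -/
structure IsChart (L : RTL) (U V : Set ℂ) (a' c : ℂ → ℂ) (S : ℂ × ℂ → ℂ × ℂ) (E : LatticeEq) :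
    Prop where
  subset_p : U ⊆ L.Dp
  subset_y : V ⊆ L.Dy
  deriv_a : ∀ p ∈ U, HasDerivAt a' (1 / L.r p) p
  deriv_c : ∀ y ∈ V, HasDerivAt c (L.h y) y
  left_inv : ∀ z ∈ U ×ˢ V, S (L.T a' c z) = z
  isOpen_image : IsOpen (L.T a' c '' (U ×ˢ V))
  holo : DifferentiableOn ℂ S (L.T a' c '' (U ×ˢ V))
  region_p : IsRegion E.Dp
  region_y : IsRegion E.Dy
  subset_image : E.Dp ×ˢ E.Dy ⊆ L.T a' c '' (U ×ˢ V)

/-- The clause of `HasDualAt` about the transformations `T₊`, `T₋`. -/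
def TransformsTo (L : RTL) (U V : Set ℂ) (a' c : ℂ → ℂ) (E : LatticeEq) : Prop :=
  ∀ (p y : ℤ → ℂ → ℂ) (t : ℂ), L.eq.HoldsAt p y t → (∀ n, p n t ∈ U ∧ y n t ∈ V) →
    (∀ P Y : ℤ → ℂ → ℂ,
      (∀ n s, (P n s, Y n s) = L.T a' c (p n s, y (n + 1) s)) →
      (∀ n, P n t ∈ E.Dp ∧ Y n t ∈ E.Dy) → E.HoldsAt P Y t) ∧
    (∀ P Y : ℤ → ℂ → ℂ,
      (∀ n s, (P (n - 1) s, Y n s) = L.T a' c (p n s, y n s)) →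
      (∀ n, P n t ∈ E.Dp ∧ Y n t ∈ E.Dy) → E.HoldsAt P Y t)

theorem hasDualAt_iff (L : RTL) (p₀ y₀ : ℂ) (E : LatticeEq) :
    L.HasDualAt p₀ y₀ E ↔ ∃ U V a' c S, IsRegion U ∧ IsRegion V ∧ p₀ ∈ U ∧ y₀ ∈ V ∧
      L.IsChart U V a' c S E ∧ L.T a' c (p₀, y₀) ∈ E.Dp ×ˢ E.Dy ∧ L.TransformsTo U V a' c E := by
  constructor
  · rintro ⟨U, V, a', c, S, h1, h2, h3, h4, h5, h6, h7, h8, h9, h10, h11, h12, h13, h14, h15, h16⟩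
    exact ⟨U, V, a', c, S, h1, h2, h5, h6, ⟨h3, h4, h7, h8, h9, h10, h11, h12, h13, h14⟩, h15, h16⟩
  · rintro ⟨U, V, a', c, S, h1, h2, h5, h6, ⟨h3, h4, h7, h8, h9, h10, h11, h12, h13, h14⟩, h15, h16⟩
    exact ⟨U, V, a', c, S, h1, h2, h3, h4, h5, h6, h7, h8, h9, h10, h11, h12, h13, h14, h15, h16⟩

/-- The time derivative of `P` produced by the transformation `T₊`. -/
noncomputable def ratePlus (L : RTL) (S : ℂ × ℂ → ℂ × ℂ) (Pm P Pp Y Y₁ : ℂ) : ℂ :=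
  L.dualCoeff (S (P, Y)) * ((S (Pp, Y₁)).1 - (S (P, Y)).1) +
    L.h (S (P, Y)).2 * L.r (S (P, Y)).1 * (P - Pm)

/-- The time derivative of `P` produced by the transformation `T₋`. -/
noncomputable def rateMinus (L : RTL) (S : ℂ × ℂ → ℂ × ℂ) (Pm P Pp Y Y₁ : ℂ) : ℂ :=
  L.dualCoeff (S (P, Y₁)) * ((S (P, Y₁)).1 - (S (Pm, Y)).1) +
    L.h (S (P, Y₁)).2 * L.r (S (P, Y₁)).1 * (Pp - P)

theorem IsLattice.hasDerivAt_h {L : RTL} (H : L.IsLattice) {y : ℂ} (hy : y ∈ L.Dy) :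
    HasDerivAt L.h (deriv L.h y) y :=
  (H.holo_h.differentiableAt (H.region_y.1.mem_nhds hy)).hasDerivAt

theorem IsLattice.hasDerivAt_g {L : RTL} (H : L.IsLattice) {y : ℂ} (hy : y ∈ L.Dy) :
    HasDerivAt L.g (deriv L.g y) y :=
  (H.holo_g.differentiableAt (H.region_y.1.mem_nhds hy)).hasDerivAt

theorem IsLattice.hasDerivAt_r {L : RTL} (H : L.IsLattice) {p : ℂ} (hp : p ∈ L.Dp) :
    HasDerivAt L.r (deriv L.r p) p :=
  (H.holo_r.differentiableAt (H.region_p.1.mem_nhds hp)).hasDerivAt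

theorem IsLattice.hasDerivAt_T {L : RTL} (H : L.IsLattice) {a' c p y : ℂ → ℂ} {t p' y' : ℂ}
    (hy : y t ∈ L.Dy) (ha : HasDerivAt a' (1 / L.r (p t)) (p t))
    (hc : HasDerivAt c (L.h (y t)) (y t)) (dp : HasDerivAt p p' t) (dy : HasDerivAt y y' t) :
    HasDerivAt (fun s => (L.T a' c (p s, y s)).1)
      (L.h (y t) * p' + (deriv L.h (y t) * p t + deriv L.g (y t)) * y') t ∧
    HasDerivAt (fun s => (L.T a' c (p s, y s)).2) (p' / L.r (p t) - L.h (y t) * y') t := by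
  constructor
  · exact ((((H.hasDerivAt_h hy).comp t dy).mul dp).add ((H.hasDerivAt_g hy).comp t dy)).congr_deriv
      (by simp only [Function.comp]; ring)
  · exact ((ha.comp t dp).sub (hc.comp t dy)).congr_deriv (by ring)

theorem eq_T_iff (L : RTL) {a' c p y P Y : ℂ → ℂ}
    (h : ∀ s, (P s, Y s) = L.T a' c (p s, y s)) :
    (P = fun s => (L.T a' c (p s, y s)).1) ∧ (Y = fun s => (L.T a' c (p s, y s)).2) :=
  ⟨funext fun s => congrArg Prod.fst (h s), funext fun s => congrArg Prod.snd (h s)⟩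

namespace IsChart

variable {L : RTL} {U V : Set ℂ} {a' c : ℂ → ℂ} {S : ℂ × ℂ → ℂ × ℂ} {E : LatticeEq}

theorem mem_S (C : L.IsChart U V a' c S E) {P Y : ℂ} (hP : P ∈ E.Dp) (hY : Y ∈ E.Dy) :
    (S (P, Y)).1 ∈ U ∧ (S (P, Y)).2 ∈ V ∧ L.T a' c (S (P, Y)) = (P, Y) := by
  obtain ⟨z, hz, e⟩ := C.subset_image (mk_mem_prod hP hY)
  rw [← e, C.left_inv z hz]
  exact ⟨hz.1, hz.2, rfl⟩

/-- In Y' = p'/r − h(y₁)(p₁ − p) the factor r and the terms with p₁ cancel, which leaves P − P₋₁ for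
every lattice of the class. Only the equation for P restricts the coefficients; the same happens for
T₋. -/
theorem hasDerivAt_plus (C : L.IsChart U V a' c S E) (H : L.IsLattice) {p y : ℤ → ℂ → ℂ} {t : ℂ}
    (hL : L.eq.HoldsAt p y t) (hUV : ∀ n, p n t ∈ U ∧ y n t ∈ V) {P Y : ℤ → ℂ → ℂ}
    (hT : ∀ n s, (P n s, Y n s) = L.T a' c (p n s, y (n + 1) s)) (n : ℤ) :
    HasDerivAt (P n)
      (L.ratePlus S (P (n - 1) t) (P n t) (P (n + 1) t) (Y n t) (Y (n + 1) t)) t ∧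
    HasDerivAt (Y n) (P n t - P (n - 1) t) t := by
  obtain ⟨h1, -, h3, -⟩ := hL n
  obtain ⟨-, g2, -, g4⟩ := hL (n + 1)
  have hr := H.r_ne_zero _ h1
  have key := H.hasDerivAt_T g2 (C.deriv_a _ (hUV n).1) (C.deriv_c _ (hUV (n + 1)).2) h3 g4
  have hS : ∀ m, S (P m t, Y m t) = (p m t, y (m + 1) t) := fun m => by
    rw [hT]; exact C.left_inv _ ⟨(hUV m).1, (hUV (m + 1)).2⟩
  obtain ⟨e1, e2⟩ := L.eq_T_iff (hT n)
  have f1 : P n t = L.h (y (n + 1) t) * p n t + L.g (y (n + 1) t) := congrArg Prod.fst (hT n t)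
  have f2 : P (n - 1) t = L.h (y n t) * p (n - 1) t + L.g (y n t) := by
    have := congrArg Prod.fst (hT (n - 1) t)
    rwa [sub_add_cancel] at this
  rw [add_sub_cancel_right] at key
  constructor
  · refine (e1 ▸ key.1).congr_deriv ?_
    simp only [ratePlus, hS, dualCoeff, RTL.eq]
    rw [f1, f2]
    ring
  · refine (e2 ▸ key.2).congr_deriv ?_
    simp only [RTL.eq]
    rw [f1, f2]
    field_simp
    ring

theorem hasDerivAt_minus (C : L.IsChart U V a' c S E) (H : L.IsLattice) {p y : ℤ → ℂ → ℂ} {t : ℂ}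
    (hL : L.eq.HoldsAt p y t) (hUV : ∀ n, p n t ∈ U ∧ y n t ∈ V) {P Y : ℤ → ℂ → ℂ}
    (hT : ∀ n s, (P (n - 1) s, Y n s) = L.T a' c (p n s, y n s)) (n : ℤ) :
    HasDerivAt (P n)
      (L.rateMinus S (P (n - 1) t) (P n t) (P (n + 1) t) (Y n t) (Y (n + 1) t)) t ∧
    HasDerivAt (Y n) (P n t - P (n - 1) t) t := by
  have hT' : ∀ n s, (P n s, Y (n + 1) s) = L.T a' c (p (n + 1) s, y (n + 1) s) := fun n s => by
    rw [← hT, add_sub_cancel_right]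
  have hS : ∀ m, S (P m t, Y (m + 1) t) = (p (m + 1) t, y (m + 1) t) := fun m => by
    rw [hT']; exact C.left_inv _ ⟨(hUV (m + 1)).1, (hUV (m + 1)).2⟩
  have f0 : ∀ m, P m t = L.h (y (m + 1) t) * p (m + 1) t + L.g (y (m + 1) t) := fun m =>
    congrArg Prod.fst (hT' m t)
  have key : ∀ n, HasDerivAt (fun s => (L.T a' c (p n s, y n s)).1)
      (L.rateMinus S (P (n - 1 - 1) t) (P (n - 1) t) (P n t) (Y (n - 1) t) (Y n t)) t ∧
      HasDerivAt (fun s => (L.T a' c (p n s, y n s)).2) (P n t - P (n - 1) t) t := fun n => by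
    obtain ⟨h1, h2, h3, h4⟩ := hL n
    have hr := H.r_ne_zero _ h1
    have key := H.hasDerivAt_T h2 (C.deriv_a _ (hUV n).1) (C.deriv_c _ (hUV n).2) h3 h4
    have s1 := hS (n - 1)
    have s2 := hS (n - 1 - 1)
    have f1 := f0 (n - 1)
    rw [sub_add_cancel] at s1 s2 f1
    constructor
    · refine key.1.congr_deriv ?_
      simp only [rateMinus, s1, s2, dualCoeff, RTL.eq]
      rw [f1, f0 n]
      ring
    · refine key.2.congr_deriv ?_
      simp only [RTL.eq]
      rw [f1, f0 n]
      field_simp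
      ring
  constructor
  · have := (key (n + 1)).1
    rw [add_sub_cancel_right] at this
    exact this.congr_of_eventuallyEq
      (Filter.Eventually.of_forall fun s => congrFun (L.eq_T_iff (hT' n)).1 s)
  · rw [(L.eq_T_iff (hT n)).2]
    exact (key n).2

/-- The equations are imposed at one moment only, so functions affine in time with the right
velocities suffice; no differential equation has to be solved. -/
theorem exists_holdsAt (L : RTL) (p₀ y₀ : ℤ → ℂ) (hp : ∀ n, p₀ n ∈ L.Dp) (hy : ∀ n, y₀ n ∈ L.Dy) :
    ∃ p y : ℤ → ℂ → ℂ, (∀ n, p n 0 = p₀ n) ∧ (∀ n, y n 0 = y₀ n) ∧ L.eq.HoldsAt p y 0 := by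
  refine ⟨fun n s => s * L.eq.F (p₀ (n - 1)) (p₀ n) (p₀ (n + 1)) (y₀ n) (y₀ (n + 1)) + p₀ n,
    fun n s => s * (p₀ n - p₀ (n - 1)) + y₀ n, by simp, by simp, fun n => ?_⟩
  simp only [zero_mul, zero_add]
  refine ⟨hp n, hy n, ?_, ?_⟩
  · exact (((hasDerivAt_id (0 : ℂ)).mul_const _).add_const (p₀ n)).congr_deriv (one_mul _)
  · exact (((hasDerivAt_id (0 : ℂ)).mul_const _).add_const (y₀ n)).congr_deriv (one_mul _)

/-- The two transformations take `L` to `E` if and only if the right-hand side of `E` is given by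
both formulas. -/
theorem transformsTo_iff (C : L.IsChart U V a' c S E) (H : L.IsLattice) :
    L.TransformsTo U V a' c E ↔
    ∀ Pm ∈ E.Dp, ∀ P ∈ E.Dp, ∀ Pp ∈ E.Dp, ∀ Y ∈ E.Dy, ∀ Y₁ ∈ E.Dy,
      E.F Pm P Pp Y Y₁ = L.ratePlus S Pm P Pp Y Y₁ ∧
      E.F Pm P Pp Y Y₁ = L.rateMinus S Pm P Pp Y Y₁ := by
  constructor
  · intro hT Pm hPm P hP Pp hPp Y hY Y₁ hY₁
    -- The equation at index 0 involves P at −1, 0, 1 and Y at 0, 1. These five values are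
    -- arbitrary; the other indices only have to stay in the box. The data for L are then the
    -- preimages under T₊, and below under T₋.
    let Ps : ℤ → ℂ := fun n => if n = -1 then Pm else if n = 0 then P else Pp
    let Ys : ℤ → ℂ := fun n => if n = 0 then Y else Y₁
    have hPs : ∀ n, Ps n ∈ E.Dp := fun n => by
      simp only [Ps]; split_ifs <;> assumption
    have hYs : ∀ n, Ys n ∈ E.Dy := fun n => by
      simp only [Ys]; split_ifs <;> assumption
    constructor
    · obtain ⟨p, y, hp, hy, hL⟩ := exists_holdsAt L (fun n => (S (Ps n, Ys n)).1)
        (fun n => (S (Ps (n - 1), Ys (n - 1))).2)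
        (fun n => C.subset_p (C.mem_S (hPs n) (hYs n)).1)
        (fun n => C.subset_y (C.mem_S (hPs (n - 1)) (hYs (n - 1))).2.1)
      have hUV : ∀ n, p n 0 ∈ U ∧ y n 0 ∈ V := fun n => by
        rw [hp, hy]
        exact ⟨(C.mem_S (hPs n) (hYs n)).1, (C.mem_S (hPs (n - 1)) (hYs (n - 1))).2.1⟩
      have e : ∀ n, L.T a' c (p n 0, y (n + 1) 0) = (Ps n, Ys n) := fun n => by
        rw [hp, hy, add_sub_cancel_right]
        exact (C.mem_S (hPs n) (hYs n)).2.2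
      have e1 : ∀ n, (L.T a' c (p n 0, y (n + 1) 0)).1 = Ps n := fun n => by rw [e]
      have e2 : ∀ n, (L.T a' c (p n 0, y (n + 1) 0)).2 = Ys n := fun n => by rw [e]
      have h1 := (hT p y 0 hL hUV).1 (fun n s => (L.T a' c (p n s, y (n + 1) s)).1)
        (fun n s => (L.T a' c (p n s, y (n + 1) s)).2) (fun n s => rfl)
        (fun n => by rw [e1, e2]; exact ⟨hPs n, hYs n⟩) 0
      have h2 := (C.hasDerivAt_plus H hL hUV
        (P := fun n s => (L.T a' c (p n s, y (n + 1) s)).1)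
        (Y := fun n s => (L.T a' c (p n s, y (n + 1) s)).2) (fun n s => rfl) 0).1
      have h3 := h1.2.2.1.unique h2
      simp only [e1, e2] at h3
      simpa [Ps, Ys] using h3
    · obtain ⟨p, y, hp, hy, hL⟩ := exists_holdsAt L (fun n => (S (Ps (n - 1), Ys n)).1)
        (fun n => (S (Ps (n - 1), Ys n)).2)
        (fun n => C.subset_p (C.mem_S (hPs (n - 1)) (hYs n)).1)
        (fun n => C.subset_y (C.mem_S (hPs (n - 1)) (hYs n)).2.1)
      have hUV : ∀ n, p n 0 ∈ U ∧ y n 0 ∈ V := fun n => by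
        rw [hp, hy]
        exact ⟨(C.mem_S (hPs (n - 1)) (hYs n)).1, (C.mem_S (hPs (n - 1)) (hYs n)).2.1⟩
      have e : ∀ n, L.T a' c (p n 0, y n 0) = (Ps (n - 1), Ys n) := fun n => by
        rw [hp, hy]
        exact (C.mem_S (hPs (n - 1)) (hYs n)).2.2
      have e1 : ∀ n, (L.T a' c (p (n + 1) 0, y (n + 1) 0)).1 = Ps n := fun n => by
        rw [e, add_sub_cancel_right]
      have e2 : ∀ n, (L.T a' c (p n 0, y n 0)).2 = Ys n := fun n => by rw [e]
      have hPY : ∀ (n : ℤ) (s : ℂ), ((L.T a' c (p (n - 1 + 1) s, y (n - 1 + 1) s)).1,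
          (L.T a' c (p n s, y n s)).2) = L.T a' c (p n s, y n s) := fun n s => by
        rw [sub_add_cancel]
      have h1 := (hT p y 0 hL hUV).2 (fun n s => (L.T a' c (p (n + 1) s, y (n + 1) s)).1)
        (fun n s => (L.T a' c (p n s, y n s)).2) hPY
        (fun n => by rw [e1, e2]; exact ⟨hPs n, hYs n⟩) 0
      have h2 := (C.hasDerivAt_minus H hL hUV
        (P := fun n s => (L.T a' c (p (n + 1) s, y (n + 1) s)).1)
        (Y := fun n s => (L.T a' c (p n s, y n s)).2) hPY 0).1
      have h3 := h1.2.2.1.unique h2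
      simp only [e1, e2] at h3
      simpa [Ps, Ys] using h3
  · intro hF p y t hL hUV
    refine ⟨fun P Y hT hPY n => ?_, fun P Y hT hPY n => ?_⟩
    · refine ⟨(hPY n).1, (hPY n).2, ?_, (C.hasDerivAt_plus H hL hUV hT n).2⟩
      rw [(hF _ (hPY (n - 1)).1 _ (hPY n).1 _ (hPY (n + 1)).1 _ (hPY n).2 _ (hPY (n + 1)).2).1]
      exact (C.hasDerivAt_plus H hL hUV hT n).1
    · refine ⟨(hPY n).1, (hPY n).2, ?_, (C.hasDerivAt_minus H hL hUV hT n).2⟩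
      rw [(hF _ (hPY (n - 1)).1 _ (hPY n).1 _ (hPY (n + 1)).1 _ (hPY n).2 _ (hPY (n + 1)).2).2]
      exact (C.hasDerivAt_minus H hL hUV hT n).1

end IsChart
end RTL

/-! ### Tools from complex analysis -/

theorem IsRegion.eqOn_of_eventuallyEq {D : Set ℂ} (hD : IsRegion D) {f g : ℂ → ℂ}
    (hf : DifferentiableOn ℂ f D) (hg : DifferentiableOn ℂ g D) {z : ℂ} (hz : z ∈ D)
    (h : f =ᶠ[𝓝 z] g) : EqOn f g D :=
  (hf.analyticOnNhd hD.1).eqOn_of_preconnected_of_eventuallyEq (hg.analyticOnNhd hD.1)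
    hD.2.isPreconnected hz h

theorem IsRegion.eventually_ne_zero {D : Set ℂ} (hD : IsRegion D) {f : ℂ → ℂ}
    (hf : DifferentiableOn ℂ f D) (h : ∃ w ∈ D, f w ≠ 0) {z : ℂ} (hz : z ∈ D) :
    ∀ᶠ w in 𝓝[≠] z, f w ≠ 0 := by
  rcases (hf.analyticOnNhd hD.1 z hz).eventually_eq_zero_or_eventually_ne_zero with h0 | h0
  · obtain ⟨w, hw, hfw⟩ := h
    exact absurd (hD.eqOn_of_eventuallyEq hf (differentiableOn_const 0) hz h0 hw) hfw
  · exact h0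

theorem isRegion_ball (z : ℂ) {ε : ℝ} (hε : 0 < ε) : IsRegion (Metric.ball z ε) :=
  ⟨Metric.isOpen_ball, (convex_ball z ε).isConnected ⟨z, Metric.mem_ball_self hε⟩⟩

/-- A solution of `h' = h φ` which vanishes at a point vanishes identically. -/
theorem IsRegion.ne_zero_of_linear_ode {D : Set ℂ} (hD : IsRegion D) {h φ : ℂ → ℂ}
    (hφ : DifferentiableOn ℂ φ D) (hh : ∀ y ∈ D, HasDerivAt h (h y * φ y) y)
    (h0 : ∃ y ∈ D, h y ≠ 0) : ∀ y ∈ D, h y ≠ 0 := by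
  intro y hy hzero
  obtain ⟨ε, hε, hb⟩ := Metric.isOpen_iff.1 hD.1 y hy
  -- On a ball φ has a primitive Φ, and h exp(−Φ) is constant there; a zero at the centre makes h
  -- vanish on the ball, hence everywhere.
  obtain ⟨Φ, hΦ⟩ := (hφ.mono hb).isExactOn_ball
  obtain ⟨C, hC⟩ := (isRegion_ball y hε).exists_const (f := fun w => h w * exp (-Φ w))
    (fun w hw => ((hh w (hb hw)).mul (hΦ w hw).fun_neg.cexp).congr_deriv (by ring))
  have hC0 : C = 0 := by rw [← hC y (Metric.mem_ball_self hε), hzero, zero_mul]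
  have hev : h =ᶠ[𝓝 y] fun _ => 0 := by
    filter_upwards [Metric.ball_mem_nhds y hε] with w hw
    have := hC w hw
    rw [hC0] at this
    exact (mul_eq_zero.1 this).resolve_right (Complex.exp_ne_zero _)
  obtain ⟨w, hw, hhw⟩ := h0
  exact hhw (hD.eqOn_of_eventuallyEq
    (fun v hv => (hh v hv).differentiableAt.differentiableWithinAt)
    (differentiableOn_const 0) hy hev hw)

/-- A function with locally constant second derivative is locally a quadratic polynomial. -/
theorem exists_quadratic_of_deriv_deriv {f : ℂ → ℂ} {p : ℂ} {C : ℂ}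
    (hf : ∀ᶠ q in 𝓝 p, DifferentiableAt ℂ f q)
    (h : ∀ᶠ q in 𝓝 p, deriv (deriv f) q = C) :
    ∃ r0 r1 r2 : ℂ, ∀ᶠ q in 𝓝 p, f q = r2 * q ^ 2 + r1 * q + r0 := by
  obtain ⟨ε, hε, hb⟩ := Metric.eventually_nhds_iff_ball.1 (hf.and h)
  have hR := isRegion_ball p hε
  have hd : DifferentiableOn ℂ f (Metric.ball p ε) := fun q hq =>
    (hb q hq).1.differentiableWithinAt
  obtain ⟨r1, h1⟩ := hR.exists_const (f := fun q => deriv f q - C * q) (fun q hq => by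
    have := (hd.deriv hR.1).differentiableAt (hR.1.mem_nhds hq)
    exact (this.hasDerivAt.sub ((hasDerivAt_id q).const_mul C)).congr_deriv
      (by rw [(hb q hq).2]; ring))
  obtain ⟨r0, h0⟩ := hR.exists_const (f := fun q => f q - (C / 2 * q ^ 2 + r1 * q)) (fun q hq => by
    refine ((hb q hq).1.hasDerivAt.sub (((hasDerivAt_pow 2 q).const_mul (C / 2)).add
      ((hasDerivAt_id q).const_mul r1))).congr_deriv ?_
    rw [← h1 q hq]
    simp
    ring)
  refine ⟨r0, r1, C / 2, ?_⟩
  filter_upwards [Metric.ball_mem_nhds p hε] with q hq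
  rw [← h0 q hq]; ring

theorem quadratic_coeff_eq_zero {a b c p : ℂ} (h : ∀ᶠ q in 𝓝 p, a * q ^ 2 + b * q + c = 0) :
    a = 0 ∧ b = 0 ∧ c = 0 := by
  have d0 : (fun q : ℂ => a * q ^ 2 + b * q + c) =ᶠ[𝓝 p] fun _ => 0 := h
  have e0 : deriv (fun q : ℂ => a * q ^ 2 + b * q + c) = fun q => 2 * a * q + b := by
    funext q
    refine HasDerivAt.deriv (((((hasDerivAt_pow 2 q).const_mul a).add
      ((hasDerivAt_id q).const_mul b)).add_const c).congr_deriv ?_)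
    simp
    ring
  have d1 := d0.deriv
  rw [e0] at d1
  have e1 : deriv (fun q : ℂ => 2 * a * q + b) = fun q => 2 * a := by
    funext q
    exact HasDerivAt.deriv ((((hasDerivAt_id q).const_mul (2 * a)).add_const b).congr_deriv
      (by ring))
  have d2 := d1.deriv
  rw [e1] at d2
  have h2 := d2.eq_of_nhds
  have h1 := d1.eq_of_nhds
  have h0 := d0.eq_of_nhds
  simp only [deriv_const'] at h0 h1 h2
  have ha : a = 0 := by linear_combination h2 / 2
  subst ha
  have hb : b = 0 := by linear_combination h1
  subst hb
  exact ⟨rfl, rfl, by linear_combination h0⟩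

/-! ### Duality forces the system with constants -/

namespace RTL

/-- The coefficients of p² agree trivially, those of p by the equation for h, and the free terms by
the equation for g together with the first integral. -/
theorem HasConstants.dualCoeff_eq {L : RTL} {r0 r1 r2 k1 k2 j : ℂ}
    (H : L.HasConstants r0 r1 r2 k1 k2 j) {p y : ℂ} (hp : p ∈ L.Dp) (hy : y ∈ L.Dy) :
    L.dualCoeff (p, y) =
      r2 * (L.h y * p + L.g y) ^ 2 + k1 * (L.h y * p + L.g y) - j := by
  rw [dualCoeff, (H.deriv_h y hy).deriv, (H.deriv_g y hy).deriv, H.r_eq p hp, ← H.integral y hy]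
  ring

namespace IsChart

variable {L : RTL} {U V : Set ℂ} {a' c : ℂ → ℂ} {S : ℂ × ℂ → ℂ × ℂ} {E : LatticeEq}

/-- Equate the two rates at P₋₁ = P and Y₁ = Y: one term of each drops out. The result says that A
is affine in P with slope hr/D. -/
theorem slope_eq (C : L.IsChart U V a' c S E) (H : L.IsLattice) (hT : L.TransformsTo U V a' c E)
    {P P₁ Y : ℂ} (hP : P ∈ E.Dp) (hP₁ : P₁ ∈ E.Dp) (hY : Y ∈ E.Dy) :
    L.dualCoeff (S (P, Y)) * ((S (P₁, Y)).1 - (S (P, Y)).1) =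
      L.h (S (P, Y)).2 * L.r (S (P, Y)).1 * (P₁ - P) := by
  obtain ⟨h1, h2⟩ := (C.transformsTo_iff H).1 hT P hP P hP P₁ hP₁ Y hY Y hY
  rw [h1, ratePlus, rateMinus] at h2
  linear_combination h2

theorem exists_ne (C : L.IsChart U V a' c S E) {P : ℂ} (hP : P ∈ E.Dp) : ∃ P₁ ∈ E.Dp, P₁ ≠ P := by
  have h1 : ∀ᶠ Q in 𝓝[≠] P, Q ∈ E.Dp :=
    nhdsWithin_le_nhds (C.region_p.1.mem_nhds hP)
  obtain ⟨Q, hQ, hne⟩ := (h1.and self_mem_nhdsWithin).exists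
  exact ⟨Q, hQ, hne⟩

theorem hr_ne (C : L.IsChart U V a' c S E) (H : L.IsLattice)
    {P Y : ℂ} (hP : P ∈ E.Dp) (hY : Y ∈ E.Dy) (h0 : L.h (S (P, Y)).2 ≠ 0) :
    L.h (S (P, Y)).2 * L.r (S (P, Y)).1 ≠ 0 :=
  mul_ne_zero h0 (H.r_ne_zero _ (C.subset_p (C.mem_S hP hY).1))

/-- A zero of D would annihilate the left side of `slope_eq`, whereas the right side is nonzero at
distinct values of P. -/
theorem dualCoeff_ne (C : L.IsChart U V a' c S E) (H : L.IsLattice)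
    (hT : L.TransformsTo U V a' c E) {P Y : ℂ} (hP : P ∈ E.Dp) (hY : Y ∈ E.Dy)
    (h0 : L.h (S (P, Y)).2 ≠ 0) : L.dualCoeff (S (P, Y)) ≠ 0 := by
  obtain ⟨P₁, hP₁, hne⟩ := C.exists_ne hP
  intro h
  have := C.slope_eq H hT hP hP₁ hY
  rw [h, zero_mul] at this
  exact mul_ne_zero (C.hr_ne H hP hY h0) (sub_ne_zero.2 hne) this.symm

/-- With P₋₁ = P and P₁ = Q arbitrary, the two rates and `slope_eq` give (D(P,Y) − D(P,Y₁))(A(Q,Y₁)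
− A(P,Y)) = 0. Since A(·,Y₁) is not constant, the first factor vanishes. -/
theorem dualCoeff_eq (C : L.IsChart U V a' c S E) (H : L.IsLattice)
    (hT : L.TransformsTo U V a' c E) {P Y Y₁ : ℂ} (hP : P ∈ E.Dp) (hY : Y ∈ E.Dy) (hY₁ : Y₁ ∈ E.Dy)
    (h0 : L.h (S (P, Y₁)).2 ≠ 0) : L.dualCoeff (S (P, Y)) = L.dualCoeff (S (P, Y₁)) := by
  have key : ∀ Q ∈ E.Dp, (L.dualCoeff (S (P, Y)) - L.dualCoeff (S (P, Y₁))) *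
      ((S (Q, Y₁)).1 - (S (P, Y)).1) = 0 := fun Q hQ => by
    obtain ⟨h1, h2⟩ := (C.transformsTo_iff H).1 hT P hP P hP Q hQ Y hY Y₁ hY₁
    rw [h1, ratePlus, rateMinus] at h2
    linear_combination h2 - C.slope_eq H hT hP hQ hY₁
  by_contra hne
  have hne' := sub_ne_zero.2 hne
  obtain ⟨P₁, hP₁, hneP⟩ := C.exists_ne hP
  have e1 := (mul_eq_zero.1 (key P hP)).resolve_left hne'
  have e2 := (mul_eq_zero.1 (key P₁ hP₁)).resolve_left hne'
  have := C.slope_eq H hT hP hP₁ hY₁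
  have e3 : (S (P₁, Y₁)).1 - (S (P, Y₁)).1 = 0 := by linear_combination e2 - e1
  rw [e3, mul_zero] at this
  exact mul_ne_zero (C.hr_ne H hP hY₁ h0) (sub_ne_zero.2 hneP) this.symm

theorem continuousAt_T (C : L.IsChart U V a' c S E) (H : L.IsLattice) {p y : ℂ} (hp : p ∈ U)
    (hy : y ∈ V) : ContinuousAt (L.T a' c) (p, y) := by
  have h1 : ContinuousAt (fun z : ℂ × ℂ => L.h z.2) (p, y) :=
    ContinuousAt.comp (f := Prod.snd) (H.hasDerivAt_h (C.subset_y hy)).continuousAt continuousAt_snd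
  have h2 : ContinuousAt (fun z : ℂ × ℂ => L.g z.2) (p, y) :=
    ContinuousAt.comp (f := Prod.snd) (H.hasDerivAt_g (C.subset_y hy)).continuousAt continuousAt_snd
  have h3 : ContinuousAt (fun z : ℂ × ℂ => c z.2) (p, y) :=
    ContinuousAt.comp (f := Prod.snd) (C.deriv_c y hy).continuousAt continuousAt_snd
  have h4 : ContinuousAt (fun z : ℂ × ℂ => a' z.1) (p, y) :=
    ContinuousAt.comp (f := Prod.fst) (C.deriv_a p hp).continuousAt continuousAt_fst
  exact ((h1.mul continuousAt_fst).add h2).prodMk (h4.sub h3)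

/-- The function `h² r + h' p + g'` depends only on `P = h p + g`. -/
theorem eventually_dualCoeff_eq (C : L.IsChart U V a' c S E) (H : L.IsLattice)
    (hT : L.TransformsTo U V a' c E) {p y : ℂ} (hU : U ∈ 𝓝 p) (hV : V ∈ 𝓝 y)
    (hE : L.T a' c (p, y) ∈ E.Dp ×ˢ E.Dy) (h0 : L.h y ≠ 0) :
    ∀ᶠ z in 𝓝 (p, y), L.dualCoeff z =
      L.dualCoeff ((L.h z.2 * z.1 + L.g z.2 - L.g y) / L.h y, y) := by
  have hp := mem_of_mem_nhds hU
  have hy := mem_of_mem_nhds hV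
  have hTc := C.continuousAt_T H hp hy
  have hbox : E.Dp ×ˢ E.Dy ∈ 𝓝 (L.T a' c (p, y)) :=
    (C.region_p.1.prod C.region_y.1).mem_nhds hE
  have hUV : U ×ˢ V ∈ 𝓝 (p, y) := prod_mem_nhds hU hV
  -- This maps z to the point on the line with second coordinate y at which P has the same value as
  -- at z.
  have hτ : ContinuousAt (fun z : ℂ × ℂ => ((L.h z.2 * z.1 + L.g z.2 - L.g y) / L.h y, y)) (p, y) :=
    ((hTc.fst.sub continuousAt_const).div_const _).prodMk continuousAt_const
  have hτ0 : (L.h y * p + L.g y - L.g y) / L.h y = p := by field_simp; ring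
  have hτ' : Filter.Tendsto (fun z : ℂ × ℂ => ((L.h z.2 * z.1 + L.g z.2 - L.g y) / L.h y, y))
      (𝓝 (p, y)) (𝓝 (p, y)) := by
    have := hτ.tendsto
    simp only [hτ0] at this
    exact this
  filter_upwards [hUV, hTc hbox, hτ' hUV, hτ' (hTc hbox)] with z hz1 hz2 hz3 hz4
  have e1 : (L.T a' c ((L.h z.2 * z.1 + L.g z.2 - L.g y) / L.h y, y)).1 = (L.T a' c z).1 := by
    simp only [RTL.T]; field_simp; ring
  have hS1 : S ((L.T a' c z).1, (L.T a' c z).2) = z := C.left_inv z hz1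
  have hS2 : S ((L.T a' c z).1,
      (L.T a' c ((L.h z.2 * z.1 + L.g z.2 - L.g y) / L.h y, y)).2) =
      ((L.h z.2 * z.1 + L.g z.2 - L.g y) / L.h y, y) := by
    rw [← e1]; exact C.left_inv _ hz3
  have := C.dualCoeff_eq H hT (P := (L.T a' c z).1) (Y := (L.T a' c z).2)
    (Y₁ := (L.T a' c ((L.h z.2 * z.1 + L.g z.2 - L.g y) / L.h y, y)).2) hz2.1 hz2.2 hz4.2
    (by rw [hS2]; exact h0)
  rwa [hS1, hS2] at this

end IsChart
end RTL

namespace RTL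

theorem IsLattice.hasDerivAt_dualCoeff {L : RTL} (H : L.IsLattice) {p : ℂ} (y : ℂ)
    (hp : p ∈ L.Dp) :
    HasDerivAt (fun q => L.dualCoeff (q, y)) (L.h y ^ 2 * deriv L.r p + deriv L.h y) p :=
  ((((H.hasDerivAt_r hp).const_mul (L.h y ^ 2)).add
    ((hasDerivAt_id p).const_mul (deriv L.h y))).add_const (deriv L.g y)).congr_deriv (by ring)

theorem IsLattice.hasDerivAt_deriv_dualCoeff {L : RTL} (H : L.IsLattice) {p : ℂ} (y : ℂ)
    (hp : p ∈ L.Dp) :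
    HasDerivAt (deriv fun q => L.dualCoeff (q, y)) (L.h y ^ 2 * deriv (deriv L.r) p) p := by
  have h1 : (deriv fun q => L.dualCoeff (q, y)) =ᶠ[𝓝 p]
      fun q => L.h y ^ 2 * deriv L.r q + deriv L.h y := by
    filter_upwards [H.region_p.1.mem_nhds hp] with q hq
    exact (H.hasDerivAt_dualCoeff y hq).deriv
  have h2 := (H.holo_r.deriv H.region_p.1).differentiableAt (H.region_p.1.mem_nhds hp)
  exact ((h2.hasDerivAt.const_mul (L.h y ^ 2)).add_const (deriv L.h y)).congr_of_eventuallyEq h1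

/-- If `h² r + h' p + g'` depends only on `h p + g`, then `r` is a quadratic polynomial. -/
theorem IsLattice.exists_quadratic {L : RTL} (H : L.IsLattice) {p y : ℂ} (hp : p ∈ L.Dp)
    (hy : y ∈ L.Dy) (h0 : L.h y ≠ 0) (h1 : deriv L.h y * p + deriv L.g y ≠ 0)
    (hev : ∀ᶠ z in 𝓝 (p, y), L.dualCoeff z =
      L.dualCoeff ((L.h z.2 * z.1 + L.g z.2 - L.g y) / L.h y, y)) :
    ∃ r0 r1 r2 : ℂ, ∀ q ∈ L.Dp, L.r q = r2 * q ^ 2 + r1 * q + r0 := by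
  have hslice : Filter.Tendsto (fun w : ℂ => (p, w)) (𝓝 y) (𝓝 (p, y)) :=
    (Continuous.prodMk_right p).continuousAt
  have hslice' : ∀ w : ℂ, Filter.Tendsto (fun q : ℂ => (q, w)) (𝓝 p) (𝓝 ((p, w) : ℂ × ℂ)) := fun w =>
    (Continuous.prodMk_left w).continuousAt
  have hdτ : HasStrictDerivAt (fun w => (L.h w * p + L.g w - L.g y) / L.h y)
      ((deriv L.h y * p + deriv L.g y) / L.h y) y := by
    have a1 := (H.holo_h.analyticAt (H.region_y.1.mem_nhds hy)).hasStrictDerivAt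
    have a2 := (H.holo_g.analyticAt (H.region_y.1.mem_nhds hy)).hasStrictDerivAt
    exact HasStrictDerivAt.mul_const
      (HasDerivAtFilter.sub_const (L.g y) ((HasStrictDerivAt.mul_const a1 p).add a2)) (L.h y)⁻¹
  have hτ0 : (L.h y * p + L.g y - L.g y) / L.h y = p := by field_simp; ring
  -- The speed (h'p + g')/h of τ at y is nonzero, so τ maps neighbourhoods of y onto neighbourhoods
  -- of p. Constancy of r'' along τ becomes constancy of r'' near p.
  have hmap := HasStrictDerivAt.map_nhds_eq hdτ (div_ne_zero h1 h0)
  rw [hτ0] at hmap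
  have hmem : ∀ᶠ w in 𝓝 y, (L.h w * p + L.g w - L.g y) / L.h y ∈ L.Dp := by
    have := (HasStrictDerivAt.hasDerivAt hdτ).continuousAt.tendsto
    rw [hτ0] at this
    exact this (H.region_p.1.mem_nhds hp)
  -- Differentiate D(q, w) = D(τ(q, w), y) twice in q. The left side gives h(w)² r''(p), and the
  -- right side gives h(y)² r''(τ) times the squared slope (h(w)/h(y))².
  have key : ∀ᶠ w in 𝓝 y,
      deriv (deriv L.r) ((L.h w * p + L.g w - L.g y) / L.h y) = deriv (deriv L.r) p := by
    filter_upwards [hslice hev.eventually_nhds, hmem,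
      (H.hasDerivAt_h hy).continuousAt.eventually_ne h0] with w hw hτ hw0
    have e : (fun q => L.dualCoeff (q, w)) =ᶠ[𝓝 p]
        ((fun q => L.dualCoeff (q, y)) ∘ fun q => L.h w / L.h y * q + (L.g w - L.g y) / L.h y) := by
      filter_upwards [hslice' w hw] with q hq
      rw [hq, Function.comp]
      congr 2
      field_simp
      ring
    have hτe : (L.h w * p + L.g w - L.g y) / L.h y =
        L.h w / L.h y * p + (L.g w - L.g y) / L.h y := by field_simp; ring
    rw [hτe] at hτ ⊢
    have hlin : ∀ q, HasDerivAt (fun q => L.h w / L.h y * q + (L.g w - L.g y) / L.h y)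
        (L.h w / L.h y) q := fun q =>
      (((hasDerivAt_id q).const_mul (L.h w / L.h y)).add_const _).congr_deriv (by simp)
    have hmem' : ∀ᶠ q in 𝓝 p, L.h w / L.h y * q + (L.g w - L.g y) / L.h y ∈ L.Dp :=
      (hlin p).continuousAt (H.region_p.1.mem_nhds hτ)
    have e2 : deriv ((fun q => L.dualCoeff (q, y)) ∘
        fun q => L.h w / L.h y * q + (L.g w - L.g y) / L.h y) =ᶠ[𝓝 p]
        fun q => (deriv (fun q => L.dualCoeff (q, y)))
          (L.h w / L.h y * q + (L.g w - L.g y) / L.h y) * (L.h w / L.h y) := by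
      filter_upwards [hmem'] with q hq
      exact (((H.hasDerivAt_dualCoeff y hq).differentiableAt.hasDerivAt).comp q (hlin q)).deriv
    have e3 := ((H.hasDerivAt_deriv_dualCoeff y hτ).comp p (hlin p)).mul_const (L.h w / L.h y)
    have e4 := (H.hasDerivAt_deriv_dualCoeff w hp).unique
      (e3.congr_of_eventuallyEq (e.deriv.trans e2))
    have e5 : L.h w ^ 2 * deriv (deriv L.r) p = L.h w ^ 2 *
        deriv (deriv L.r) (L.h w / L.h y * p + (L.g w - L.g y) / L.h y) := by
      rw [e4]; field_simp
    exact (mul_left_cancel₀ (pow_ne_zero 2 hw0) e5).symm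
  have key' : ∀ᶠ q in 𝓝 p, deriv (deriv L.r) q = deriv (deriv L.r) p := by
    rw [← hmap]; exact key
  obtain ⟨r0, r1, r2, h⟩ := exists_quadratic_of_deriv_deriv
    (H.holo_r.eventually_differentiableAt (H.region_p.1.mem_nhds hp)) key'
  exact ⟨r0, r1, r2, H.region_p.eqOn_of_eventuallyEq H.holo_r (by fun_prop) hp h⟩

/-- Now D is a quadratic polynomial in P, and comparing powers of p at each nearby value of y gives
differential equations for h and g. These extend to the whole region by the identity theorem, and
the linear form of the equation for h keeps h from vanishing. -/
theorem hasConstants_of_quadratic {L : RTL} (H : L.IsLattice) {p y r0 r1 r2 : ℂ} (hp : p ∈ L.Dp)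
    (hy : y ∈ L.Dy) (h0 : L.h y ≠ 0) (hr : ∀ q ∈ L.Dp, L.r q = r2 * q ^ 2 + r1 * q + r0)
    (hev : ∀ᶠ z in 𝓝 (p, y), L.dualCoeff z =
      L.dualCoeff ((L.h z.2 * z.1 + L.g z.2 - L.g y) / L.h y, y)) :
    ∃ k1 k2 j : ℂ, L.HasConstants r0 r1 r2 k1 k2 j := by
  obtain ⟨k1, j, hkj⟩ : ∃ k1 j : ℂ, ∀ P, (P - L.g y) / L.h y ∈ L.Dp →
      L.dualCoeff ((P - L.g y) / L.h y, y) = r2 * P ^ 2 + k1 * P - j := by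
    -- These are the coefficients of D(·, y) rewritten as a polynomial in P = hp + g at the fixed y.
    refine ⟨-2 * r2 * L.g y + r1 * L.h y + deriv L.h y / L.h y, -(r2 * L.g y ^ 2 -
      (r1 * L.h y + deriv L.h y / L.h y) * L.g y + r0 * L.h y ^ 2 + deriv L.g y), fun P hP => ?_⟩
    rw [dualCoeff, hr _ hP]
    field_simp
    ring
  have hτ : ContinuousAt (fun z : ℂ × ℂ => (L.h z.2 * z.1 + L.g z.2 - L.g y) / L.h y) (p, y) := by
    have h1 : ContinuousAt (fun z : ℂ × ℂ => L.h z.2) (p, y) :=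
      ContinuousAt.comp (f := Prod.snd) (H.hasDerivAt_h hy).continuousAt continuousAt_snd
    have h2 : ContinuousAt (fun z : ℂ × ℂ => L.g z.2) (p, y) :=
      ContinuousAt.comp (f := Prod.snd) (H.hasDerivAt_g hy).continuousAt continuousAt_snd
    exact (((h1.mul continuousAt_fst).add h2).sub continuousAt_const).div_const _
  have hτ0 : (L.h y * p + L.g y - L.g y) / L.h y = p := by field_simp; ring
  have hev2 : ∀ᶠ z in 𝓝 (p, y), z.1 ∈ L.Dp ∧
      L.dualCoeff z = r2 * (L.h z.2 * z.1 + L.g z.2) ^ 2 + k1 * (L.h z.2 * z.1 + L.g z.2) - j := by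
    have hDp : L.Dp ∈ 𝓝 ((L.h (p, y).2 * (p, y).1 + L.g (p, y).2 - L.g y) / L.h y) := by
      rw [hτ0]; exact H.region_p.1.mem_nhds hp
    filter_upwards [hev, hτ hDp, continuousAt_fst (H.region_p.1.mem_nhds hp)] with z hz1 hz2 hz3
    exact ⟨hz3, by rw [hz1, hkj _ hz2]⟩
  rw [nhds_prod_eq] at hev2
  have hcoef : ∀ᶠ w in 𝓝 y, deriv L.h w = L.h w * (2 * r2 * L.g w - r1 * L.h w + k1) ∧
      deriv L.g w = r2 * L.g w ^ 2 + k1 * L.g w - r0 * L.h w ^ 2 - j := by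
    have hsw := (Filter.tendsto_prod_swap.eventually hev2 :
      ∀ᶠ z in 𝓝 y ×ˢ 𝓝 p, _)
    filter_upwards [hsw.curry] with w hw
    obtain ⟨-, h1, h2⟩ := quadratic_coeff_eq_zero (p := p) (a := 0)
      (b := L.h w ^ 2 * r1 + deriv L.h w - 2 * r2 * L.h w * L.g w - k1 * L.h w)
      (c := L.h w ^ 2 * r0 + deriv L.g w - (r2 * L.g w ^ 2 + k1 * L.g w - j))
      (by
        filter_upwards [hw] with q hq
        have h3 := hq.2
        simp only [Prod.swap, dualCoeff] at h3
        rw [hr q hq.1] at h3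
        linear_combination h3)
    exact ⟨by linear_combination h1, by linear_combination h2⟩
  have hhd : DifferentiableOn ℂ (fun w => 2 * r2 * L.g w - r1 * L.h w + k1) L.Dy :=
    ((H.holo_g.const_mul _).sub (H.holo_h.const_mul _)).add_const _
  have hh : ∀ w ∈ L.Dy, HasDerivAt L.h (L.h w * (2 * r2 * L.g w - r1 * L.h w + k1)) w := by
    intro w hw
    have := H.region_y.eqOn_of_eventuallyEq (H.holo_h.deriv H.region_y.1) (H.holo_h.mul hhd) hy
      (hcoef.mono fun w h => h.1) hw
    exact (H.hasDerivAt_h hw).congr_deriv this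
  have hg : ∀ w ∈ L.Dy,
      HasDerivAt L.g (r2 * L.g w ^ 2 + k1 * L.g w - r0 * L.h w ^ 2 - j) w := by
    intro w hw
    have := H.region_y.eqOn_of_eventuallyEq (H.holo_g.deriv H.region_y.1)
      (((((H.holo_g.pow 2).const_mul r2).add (H.holo_g.const_mul k1)).sub
        ((H.holo_h.pow 2).const_mul r0)).sub_const j) hy
      (hcoef.mono fun w h => h.2) hw
    exact (H.hasDerivAt_g hw).congr_deriv this
  have hne := H.region_y.ne_zero_of_linear_ode hhd hh ⟨y, hy, h0⟩
  -- k2 is the constant of integration of the pair of equations; solving for j turns its definition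
  -- into the first integral and the equation for g into its final form.
  obtain ⟨k2, hk2⟩ := H.region_y.exists_const
    (f := fun w => (r2 * L.g w ^ 2 + k1 * L.g w - r1 * (L.g w * L.h w) + r0 * L.h w ^ 2 - j) / L.h w)
    (fun w hw => by
      have h1 := hne w hw
      refine (((((((hg w hw).pow 2).const_mul r2).add ((hg w hw).const_mul k1)).sub
        (((hg w hw).mul (hh w hw)).const_mul r1)).add (((hh w hw).pow 2).const_mul r0)).sub_const
        j |>.div (hh w hw) h1).congr_deriv ?_
      rw [div_eq_zero_iff]
      left
      simp
      ring)
  have hk2' : ∀ w ∈ L.Dy, r2 * L.g w ^ 2 + k1 * L.g w - r1 * (L.g w * L.h w) + r0 * L.h w ^ 2 - j =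
      k2 * L.h w := fun w hw => (div_eq_iff (hne w hw)).1 (hk2 w hw)
  exact ⟨k1, k2, j, H, hne, hr, hh,
    fun w hw => (hg w hw).congr_deriv (by linear_combination hk2' w hw),
    fun w hw => by linear_combination hk2' w hw⟩

/-- The given base point may be a zero of h or of h'p + g'. Zeros of nontrivial holomorphic
functions are isolated, so a nearby y is chosen first, and then p, in which h'p + g' is affine. -/
theorem IsChart.exists_point {L : RTL} {U V : Set ℂ} {a' c : ℂ → ℂ} {S : ℂ × ℂ → ℂ × ℂ}
    {E : LatticeEq} (C : L.IsChart U V a' c S E) (H : L.IsLattice) (hN : L.Nondegenerate)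
    {p y : ℂ} (hU : U ∈ 𝓝 p) (hV : V ∈ 𝓝 y) (hE : L.T a' c (p, y) ∈ E.Dp ×ˢ E.Dy) :
    ∃ p₁ ∈ U, ∃ y₁ ∈ V, L.T a' c (p₁, y₁) ∈ E.Dp ×ˢ E.Dy ∧ L.h y₁ ≠ 0 ∧
      deriv L.h y₁ * p₁ + deriv L.g y₁ ≠ 0 := by
  have hyV := mem_of_mem_nhds hV
  have hy := C.subset_y hyV
  have hbox := C.continuousAt_T H (mem_of_mem_nhds hU) hyV
    ((C.region_p.1.prod C.region_y.1).mem_nhds hE)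
  have hev : ∀ᶠ z in 𝓝 y ×ˢ 𝓝 p, z.2 ∈ U ∧ z.1 ∈ V ∧ L.T a' c (z.2, z.1) ∈ E.Dp ×ˢ E.Dy := by
    have h1 : ∀ᶠ z in 𝓝 p ×ˢ 𝓝 y, z.1 ∈ U ∧ z.2 ∈ V ∧ L.T a' c z ∈ E.Dp ×ˢ E.Dy := by
      rw [← nhds_prod_eq]
      filter_upwards [prod_mem_nhds hU hV, hbox] with z hz1 hz2
      exact ⟨hz1.1, hz1.2, hz2⟩
    exact Filter.tendsto_prod_swap.eventually h1
  have hh := H.region_y.eventually_ne_zero H.holo_h hN.1 hy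
  have hd : ∀ᶠ w in 𝓝[≠] y, deriv L.h w ≠ 0 ∨ deriv L.g w ≠ 0 := by
    obtain ⟨w, hw, h⟩ := hN.2
    rcases h with h | h
    · exact (H.region_y.eventually_ne_zero (H.holo_g.deriv H.region_y.1) ⟨w, hw, h⟩ hy).mono
        fun _ h => Or.inr h
    · exact (H.region_y.eventually_ne_zero (H.holo_h.deriv H.region_y.1) ⟨w, hw, h⟩ hy).mono
        fun _ h => Or.inl h
  obtain ⟨w, hw1, hw2, hw3⟩ :=
    ((hev.curry.filter_mono nhdsWithin_le_nhds).and (hh.and hd)).exists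
  have hp : ∀ᶠ q in 𝓝[≠] p, deriv L.h w * q + deriv L.g w ≠ 0 := by
    refine isRegion_univ.eventually_ne_zero (f := fun q => deriv L.h w * q + deriv L.g w)
      (by fun_prop) ?_ (mem_univ p)
    by_contra hcon
    push Not at hcon
    have e0 := hcon 0 (mem_univ _)
    have e1 := hcon 1 (mem_univ _)
    have g0 : deriv L.g w = 0 := by linear_combination e0
    rcases hw3 with h | h
    · exact h (by linear_combination e1 - g0)
    · exact h g0
  obtain ⟨q, hq1, hq2⟩ := ((hw1.filter_mono nhdsWithin_le_nhds).and hp).exists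
  exact ⟨q, hq1.1, w, hq1.2.1, hq1.2.2, hw2, hq2⟩

theorem exists_hasConstants {L : RTL} (H : L.IsLattice) (hN : L.Nondegenerate)
    (hA : L.AdmitsDuality) : ∃ r0 r1 r2 k1 k2 j : ℂ, L.HasConstants r0 r1 r2 k1 k2 j ∧
      ¬ (r2 = 0 ∧ k1 = 0 ∧ j = 0) := by
  obtain ⟨E, p, hp, y, hy, hE⟩ := hA
  obtain ⟨U, V, a', c, S, hU, hV, hpU, hyV, C, hbox, hT⟩ := (L.hasDualAt_iff p y E).1 hE
  obtain ⟨p₁, hp₁, y₁, hy₁, hbox₁, h0, h1⟩ :=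
    C.exists_point H hN (hU.1.mem_nhds hpU) (hV.1.mem_nhds hyV) hbox
  have hev := C.eventually_dualCoeff_eq H hT (hU.1.mem_nhds hp₁) (hV.1.mem_nhds hy₁) hbox₁ h0
  obtain ⟨r0, r1, r2, hr⟩ := H.exists_quadratic (C.subset_p hp₁) (C.subset_y hy₁) h0 h1 hev
  obtain ⟨k1, k2, j, hC⟩ := hasConstants_of_quadratic H (C.subset_p hp₁) (C.subset_y hy₁) h0 hr hev
  refine ⟨r0, r1, r2, k1, k2, j, hC, ?_⟩
  rintro ⟨rfl, rfl, rfl⟩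
  have hS : S ((L.T a' c (p₁, y₁)).1, (L.T a' c (p₁, y₁)).2) = (p₁, y₁) :=
    C.left_inv _ ⟨hp₁, hy₁⟩
  have := C.dualCoeff_ne H hT hbox₁.1 hbox₁.2 (by rw [hS]; exact h0)
  rw [hS, hC.dualCoeff_eq (C.subset_p hp₁) (C.subset_y hy₁)] at this
  exact this (by ring)

end RTL

/-! ### Local inversion of T and the derivatives of the inverse -/

/-- The linear map with the matrix `!![h, k; ρ, -h]`, where `h ^ 2 + k * ρ ≠ 0`. -/
noncomputable def jacobianEquiv (h k ρ : ℂ) (hΔ : h ^ 2 + k * ρ ≠ 0) : (ℂ × ℂ) ≃L[ℂ] (ℂ × ℂ) :=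
  ContinuousLinearEquiv.equivOfInverse
    ((h • ContinuousLinearMap.fst ℂ ℂ ℂ + k • ContinuousLinearMap.snd ℂ ℂ ℂ).prod
      (ρ • ContinuousLinearMap.fst ℂ ℂ ℂ - h • ContinuousLinearMap.snd ℂ ℂ ℂ))
    -- The matrix has zero trace, so its square is the scalar h² + kρ and its inverse is a multiple
    -- of itself.
    ((h ^ 2 + k * ρ)⁻¹ • (h • ContinuousLinearMap.fst ℂ ℂ ℂ + k • ContinuousLinearMap.snd ℂ ℂ ℂ).prod
      (ρ • ContinuousLinearMap.fst ℂ ℂ ℂ - h • ContinuousLinearMap.snd ℂ ℂ ℂ))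
    (fun z => by
      have e := mul_inv_cancel₀ hΔ
      ext
      · simp
        linear_combination z.1 * e
      · simp
        linear_combination z.2 * e)
    (fun z => by
      have e := mul_inv_cancel₀ hΔ
      ext
      · simp
        linear_combination z.1 * e
      · simp
        linear_combination z.2 * e)

namespace RTL

theorem IsLattice.jacobian_ne_zero {L : RTL} (H : L.IsLattice) {p y : ℂ} (hp : p ∈ L.Dp)
    (h : L.dualCoeff (p, y) ≠ 0) :
    L.h y ^ 2 + (deriv L.h y * p + deriv L.g y) * (1 / L.r p) ≠ 0 := by
  have hr := H.r_ne_zero p hp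
  intro h'
  apply h
  field_simp at h'
  rw [dualCoeff]
  linear_combination h'

theorem IsLattice.hasStrictFDerivAt_T {L : RTL} (H : L.IsLattice) {U V : Set ℂ} {a' c : ℂ → ℂ}
    (hU : IsOpen U) (hV : IsOpen V) (hUp : U ⊆ L.Dp) (hVy : V ⊆ L.Dy)
    (ha : ∀ p ∈ U, HasDerivAt a' (1 / L.r p) p) (hc : ∀ y ∈ V, HasDerivAt c (L.h y) y)
    {p y : ℂ} (hp : p ∈ U) (hy : y ∈ V) (h : L.dualCoeff (p, y) ≠ 0) :
    HasStrictFDerivAt (L.T a' c) (jacobianEquiv (L.h y) (deriv L.h y * p + deriv L.g y) (1 / L.r p)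
      (H.jacobian_ne_zero (hUp hp) h) : (ℂ × ℂ) →L[ℂ] (ℂ × ℂ)) (p, y) := by
  have s1 : HasStrictDerivAt L.h (deriv L.h y) y :=
    (H.holo_h.analyticAt (H.region_y.1.mem_nhds (hVy hy))).hasStrictDerivAt
  have s2 : HasStrictDerivAt L.g (deriv L.g y) y :=
    (H.holo_g.analyticAt (H.region_y.1.mem_nhds (hVy hy))).hasStrictDerivAt
  have s3 : HasStrictDerivAt a' (1 / L.r p) p := by
    rw [← (ha p hp).deriv]
    exact (DifferentiableOn.analyticAt
      (fun q hq => (ha q hq).differentiableAt.differentiableWithinAt)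
      (hU.mem_nhds hp)).hasStrictDerivAt
  have s4 : HasStrictDerivAt c (L.h y) y := by
    rw [← (hc y hy).deriv]
    exact (DifferentiableOn.analyticAt
      (fun q hq => (hc q hq).differentiableAt.differentiableWithinAt)
      (hV.mem_nhds hy)).hasStrictDerivAt
  have hf : HasStrictFDerivAt (Prod.fst : ℂ × ℂ → ℂ) (ContinuousLinearMap.fst ℂ ℂ ℂ) (p, y) :=
    hasStrictFDerivAt_fst
  have hs : HasStrictFDerivAt (Prod.snd : ℂ × ℂ → ℂ) (ContinuousLinearMap.snd ℂ ℂ ℂ) (p, y) :=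
    hasStrictFDerivAt_snd
  have t1 := HasStrictDerivAt.comp_hasStrictFDerivAt (f := (Prod.snd : ℂ × ℂ → ℂ)) (p, y) s1 hs
  have t2 := HasStrictDerivAt.comp_hasStrictFDerivAt (f := (Prod.snd : ℂ × ℂ → ℂ)) (p, y) s2 hs
  have t3 := HasStrictDerivAt.comp_hasStrictFDerivAt (f := (Prod.fst : ℂ × ℂ → ℂ)) (p, y) s3 hf
  have t4 := HasStrictDerivAt.comp_hasStrictFDerivAt (f := (Prod.snd : ℂ × ℂ → ℂ)) (p, y) s4 hs
  refine HasStrictFDerivAt.congr_fderiv (((t1.mul hf).add t2).prodMk (t3.sub t4)) ?_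
  ext <;> (simp [jacobianEquiv]; try ring)

theorem IsLattice.continuousAt_dualCoeff {L : RTL} (H : L.IsLattice) {p y : ℂ} (hp : p ∈ L.Dp)
    (hy : y ∈ L.Dy) : ContinuousAt L.dualCoeff (p, y) := by
  have n := H.region_y.1.mem_nhds hy
  have dh : ContinuousAt (deriv L.h) y :=
    ((H.holo_h.deriv H.region_y.1).differentiableAt n).continuousAt
  have dg : ContinuousAt (deriv L.g) y :=
    ((H.holo_g.deriv H.region_y.1).differentiableAt n).continuousAt
  have h1 : ContinuousAt (fun z : ℂ × ℂ => L.h z.2) (p, y) :=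
    ContinuousAt.comp (f := Prod.snd) (H.hasDerivAt_h hy).continuousAt continuousAt_snd
  have h2 : ContinuousAt (fun z : ℂ × ℂ => deriv L.h z.2) (p, y) :=
    ContinuousAt.comp (g := deriv L.h) (f := Prod.snd) dh continuousAt_snd
  have h3 : ContinuousAt (fun z : ℂ × ℂ => deriv L.g z.2) (p, y) :=
    ContinuousAt.comp (g := deriv L.g) (f := Prod.snd) dg continuousAt_snd
  have h4 : ContinuousAt (fun z : ℂ × ℂ => L.r z.1) (p, y) :=
    ContinuousAt.comp (f := Prod.fst) (H.hasDerivAt_r hp).continuousAt continuousAt_fst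
  exact (((h1.pow 2).mul h4).add (h2.mul continuousAt_fst)).add h3

theorem exists_ball_prod_subset {s : Set (ℂ × ℂ)} {p y : ℂ} (hs : s ∈ 𝓝 (p, y)) :
    ∃ ε > 0, Metric.ball p ε ×ˢ Metric.ball y ε ⊆ s := by
  obtain ⟨ε, hε, h⟩ := Metric.mem_nhds_iff.1 hs
  exact ⟨ε, hε, by rwa [ball_prod_same]⟩

/-- By the inverse function theorem, `T` is biholomorphic near any point where its Jacobian does
not vanish. -/
theorem IsLattice.exists_chart {L : RTL} (H : L.IsLattice) {p y : ℂ} (hp : p ∈ L.Dp)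
    (hy : y ∈ L.Dy) (h : L.dualCoeff (p, y) ≠ 0) :
    ∃ U V a' c S Dp' Dy', IsRegion U ∧ IsRegion V ∧ p ∈ U ∧ y ∈ V ∧
      (∀ z ∈ U ×ˢ V, L.dualCoeff z ≠ 0) ∧ L.T a' c (p, y) ∈ Dp' ×ˢ Dy' ∧
      ∀ F, L.IsChart U V a' c S ⟨Dp', Dy', F⟩ := by
  have hnhds : {z | z ∈ L.Dp ×ˢ L.Dy ∧ L.dualCoeff z ≠ 0} ∈ 𝓝 (p, y) :=
    ((H.region_p.1.prod H.region_y.1).eventually_mem (show (p, y) ∈ _ from ⟨hp, hy⟩)).and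
      ((H.continuousAt_dualCoeff hp hy).eventually_ne h)
  obtain ⟨ε, hε, hb⟩ := exists_ball_prod_subset hnhds
  have hpε := Metric.mem_ball_self (x := p) hε
  have hyε := Metric.mem_ball_self (x := y) hε
  have hbp : Metric.ball p ε ⊆ L.Dp := fun q hq => (hb (mk_mem_prod hq hyε)).1.1
  have hby : Metric.ball y ε ⊆ L.Dy := fun q hq => (hb (mk_mem_prod hpε hq)).1.2
  obtain ⟨a', ha⟩ : IsExactOn (fun q => 1 / L.r q) (Metric.ball p ε) :=
    DifferentiableOn.isExactOn_ball ((differentiableOn_const 1).div (H.holo_r.mono hbp)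
      fun q hq => H.r_ne_zero q (hbp hq))
  obtain ⟨c, hc⟩ := (H.holo_h.mono hby).isExactOn_ball
  have hT : ∀ z ∈ Metric.ball p ε ×ˢ Metric.ball y ε, ∃ M : (ℂ × ℂ) ≃L[ℂ] (ℂ × ℂ),
      HasStrictFDerivAt (L.T a' c) (M : (ℂ × ℂ) →L[ℂ] (ℂ × ℂ)) z := fun z hz =>
    ⟨_, H.hasStrictFDerivAt_T Metric.isOpen_ball Metric.isOpen_ball hbp hby ha hc hz.1 hz.2
      (hb hz).2⟩
  obtain ⟨M, hM⟩ := hT (p, y) ⟨hpε, hyε⟩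
  let Ψ := hM.toOpenPartialHomeomorph (L.T a' c)
  have hΨ : ∀ z, Ψ z = L.T a' c z := fun z => by
    rw [hM.toOpenPartialHomeomorph_coe]
  have hsrc : Ψ.source ∩ Metric.ball p ε ×ˢ Metric.ball y ε ∈ 𝓝 (p, y) :=
    Filter.inter_mem (Ψ.open_source.mem_nhds hM.mem_toOpenPartialHomeomorph_source)
      (prod_mem_nhds (Metric.ball_mem_nhds p hε) (Metric.ball_mem_nhds y hε))
  obtain ⟨η, hη, hbη⟩ := exists_ball_prod_subset hsrc
  have hpη := Metric.mem_ball_self (x := p) hη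
  have hyη := Metric.mem_ball_self (x := y) hη
  have hsub : ∀ z ∈ Metric.ball p η ×ˢ Metric.ball y η, z ∈ Ψ.source := fun z hz => (hbη hz).1
  have hηp : Metric.ball p η ⊆ Metric.ball p ε := fun q hq => (hbη (mk_mem_prod hq hyη)).2.1
  have hηy : Metric.ball y η ⊆ Metric.ball y ε := fun q hq => (hbη (mk_mem_prod hpη hq)).2.2
  have himg : L.T a' c '' (Metric.ball p η ×ˢ Metric.ball y η) =
      Ψ '' (Metric.ball p η ×ˢ Metric.ball y η) := image_congr fun z _ => (hΨ z).symm
  have hopen : IsOpen (L.T a' c '' (Metric.ball p η ×ˢ Metric.ball y η)) := by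
    rw [himg]
    exact Ψ.isOpen_image_of_subset_source (Metric.isOpen_ball.prod Metric.isOpen_ball) hsub
  have hinv : ∀ z ∈ Metric.ball p η ×ˢ Metric.ball y η, Ψ.symm (L.T a' c z) = z := fun z hz => by
    rw [← hΨ]; exact Ψ.left_inv (hsub z hz)
  have hmem : L.T a' c (p, y) ∈ L.T a' c '' (Metric.ball p η ×ˢ Metric.ball y η) :=
    mem_image_of_mem _ ⟨hpη, hyη⟩
  obtain ⟨ζ, hζ, hbζ⟩ := exists_ball_prod_subset (p := (L.T a' c (p, y)).1)
    (y := (L.T a' c (p, y)).2) (hopen.mem_nhds hmem)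
  refine ⟨Metric.ball p η, Metric.ball y η, a', c, Ψ.symm, Metric.ball (L.T a' c (p, y)).1 ζ,
    Metric.ball (L.T a' c (p, y)).2 ζ, isRegion_ball p hη, isRegion_ball y hη, hpη, hyη,
    fun z hz => (hb (hbη hz).2).2, ⟨Metric.mem_ball_self hζ, Metric.mem_ball_self hζ⟩, fun F => ?_⟩
  exact
    { subset_p := hηp.trans hbp
      subset_y := hηy.trans hby
      deriv_a := fun q hq => ha q (hηp hq)
      deriv_c := fun q hq => hc q (hηy hq)
      left_inv := hinv
      isOpen_image := hopen
      holo := by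
        rintro _ ⟨z, hz, rfl⟩
        obtain ⟨M', hM'⟩ := hT z (hbη hz).2
        have ht : L.T a' c z ∈ Ψ.target := by
          rw [← hΨ]; exact Ψ.map_source (hsub z hz)
        have hd : HasFDerivAt Ψ (M' : (ℂ × ℂ) →L[ℂ] (ℂ × ℂ)) (Ψ.symm (L.T a' c z)) := by
          rw [hinv z hz]
          exact hM'.hasFDerivAt.congr_of_eventuallyEq (Filter.Eventually.of_forall hΨ)
        exact (Ψ.hasFDerivAt_symm ht hd).differentiableAt.differentiableWithinAt
      region_p := isRegion_ball _ hζ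
      region_y := isRegion_ball _ hζ
      subset_image := hbζ }

namespace IsChart

variable {L : RTL} {U V : Set ℂ} {a' c : ℂ → ℂ} {S : ℂ × ℂ → ℂ × ℂ} {E : LatticeEq}

/-- The derivatives of the components of `S` along a curve in the box. -/
theorem curve_eqs (C : L.IsChart U V a' c S E) (H : L.IsLattice) {P Y : ℂ → ℂ} {t P' Y' : ℂ}
    (hP : HasDerivAt P P' t) (hY : HasDerivAt Y Y' t) (hPt : P t ∈ E.Dp) (hYt : Y t ∈ E.Dy) :
    ∃ A' B' : ℂ, HasDerivAt (fun s => (S (P s, Y s)).1) A' t ∧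
      HasDerivAt (fun s => (S (P s, Y s)).2) B' t ∧
      L.h (S (P t, Y t)).2 * A' + (deriv L.h (S (P t, Y t)).2 * (S (P t, Y t)).1 +
        deriv L.g (S (P t, Y t)).2) * B' = P' ∧
      A' / L.r (S (P t, Y t)).1 - L.h (S (P t, Y t)).2 * B' = Y' := by
  have hd : DifferentiableAt ℂ (fun s => S (P s, Y s)) t :=
    (C.holo.differentiableAt (C.isOpen_image.mem_nhds
      (C.subset_image (mk_mem_prod hPt hYt)))).comp t (hP.differentiableAt.prodMk hY.differentiableAt)
  have hA := hd.fst.hasDerivAt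
  have hB := hd.snd.hasDerivAt
  obtain ⟨hU, hV, -⟩ := C.mem_S hPt hYt
  obtain ⟨k1, k2⟩ := H.hasDerivAt_T (C.subset_y hV) (C.deriv_a _ hU) (C.deriv_c _ hV) hA hB
  have hev : ∀ᶠ s in 𝓝 t, L.T a' c ((S (P s, Y s)).1, (S (P s, Y s)).2) = (P s, Y s) := by
    filter_upwards [hP.continuousAt (C.region_p.1.mem_nhds hPt),
      hY.continuousAt (C.region_y.1.mem_nhds hYt)] with s h1 h2
    exact (C.mem_S h1 h2).2.2
  refine ⟨_, _, hA, hB, ?_, ?_⟩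
  · exact k1.unique (hP.congr_of_eventuallyEq (hev.mono fun s h => congrArg Prod.fst h))
  · exact k2.unique (hY.congr_of_eventuallyEq (hev.mono fun s h => congrArg Prod.snd h))

theorem hasDerivAt_S_fst (C : L.IsChart U V a' c S E) (H : L.IsLattice) {P Y : ℂ} (hP : P ∈ E.Dp)
    (hY : Y ∈ E.Dy) (h : L.dualCoeff (S (P, Y)) ≠ 0) :
    HasDerivAt (fun Q => (S (Q, Y)).1)
      (L.h (S (P, Y)).2 * L.r (S (P, Y)).1 / L.dualCoeff (S (P, Y))) P ∧
    HasDerivAt (fun Q => (S (Q, Y)).2) (1 / L.dualCoeff (S (P, Y))) P := by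
  obtain ⟨A', B', hA, hB, e1, e2⟩ :=
    C.curve_eqs H (hasDerivAt_id P) (hasDerivAt_const P Y) hP hY
  have hr := H.r_ne_zero _ (C.subset_p (C.mem_S hP hY).1)
  simp only [id] at hA hB e1 e2
  have e3 : A' = L.h (S (P, Y)).2 * L.r (S (P, Y)).1 * B' := by
    field_simp at e2
    linear_combination e2
  have e4 : B' = 1 / L.dualCoeff (S (P, Y)) := by
    rw [eq_div_iff h, dualCoeff]
    rw [e3] at e1
    linear_combination e1
  exact ⟨hA.congr_deriv (by rw [e3, e4]; ring), hB.congr_deriv e4⟩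

theorem hasDerivAt_S_snd (C : L.IsChart U V a' c S E) (H : L.IsLattice) {P Y : ℂ} (hP : P ∈ E.Dp)
    (hY : Y ∈ E.Dy) (h : L.dualCoeff (S (P, Y)) ≠ 0) :
    HasDerivAt (fun Z => (S (P, Z)).1)
      (L.r (S (P, Y)).1 * (deriv L.h (S (P, Y)).2 * (S (P, Y)).1 + deriv L.g (S (P, Y)).2) /
        L.dualCoeff (S (P, Y))) Y ∧
    HasDerivAt (fun Z => (S (P, Z)).2)
      (-(L.h (S (P, Y)).2 * L.r (S (P, Y)).1) / L.dualCoeff (S (P, Y))) Y := by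
  obtain ⟨A', B', hA, hB, e1, e2⟩ :=
    C.curve_eqs H (hasDerivAt_const Y P) (hasDerivAt_id Y) hP hY
  have hr := H.r_ne_zero _ (C.subset_p (C.mem_S hP hY).1)
  simp only [id] at hA hB e1 e2
  have e3 : A' = L.r (S (P, Y)).1 * (1 + L.h (S (P, Y)).2 * B') := by
    field_simp at e2
    linear_combination e2
  have e4 : B' = -(L.h (S (P, Y)).2 * L.r (S (P, Y)).1) / L.dualCoeff (S (P, Y)) := by
    rw [eq_div_iff h, dualCoeff]
    rw [e3] at e1
    linear_combination e1
  refine ⟨hA.congr_deriv ?_, hB.congr_deriv e4⟩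
  rw [e3, e4]
  field_simp
  rw [dualCoeff]
  ring

end IsChart
end RTL

/-! ### Constants imply duality, and the constants of the dual lattice -/

namespace RTL

theorem HasConstants.hasDerivAt_r {L : RTL} {r0 r1 r2 k1 k2 j : ℂ}
    (H : L.HasConstants r0 r1 r2 k1 k2 j) {p : ℂ} (hp : p ∈ L.Dp) :
    HasDerivAt L.r (2 * r2 * p + r1) p := by
  refine HasDerivAt.congr_of_eventuallyEq (f := fun q => r2 * q ^ 2 + r1 * q + r0)
    (((((hasDerivAt_pow 2 p).const_mul r2).add
      ((hasDerivAt_id p).const_mul r1)).add_const r0).congr_deriv (by simp; ring)) ?_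
  filter_upwards [H.lattice.region_p.1.mem_nhds hp] with q hq
  exact H.r_eq q hq

namespace IsChart

variable {L : RTL} {U V : Set ℂ} {a' c : ℂ → ℂ} {S : ℂ × ℂ → ℂ × ℂ} {E : LatticeEq}
variable {r0 r1 r2 k1 k2 j : ℂ}

theorem h_mul_add (C : L.IsChart U V a' c S E) {P Y : ℂ} (hP : P ∈ E.Dp) (hY : Y ∈ E.Dy) :
    L.h (S (P, Y)).2 * (S (P, Y)).1 + L.g (S (P, Y)).2 = P :=
  congrArg Prod.fst (C.mem_S hP hY).2.2

theorem dualCoeff_S (C : L.IsChart U V a' c S E) (H : L.HasConstants r0 r1 r2 k1 k2 j) {P Y : ℂ}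
    (hP : P ∈ E.Dp) (hY : Y ∈ E.Dy) : L.dualCoeff (S (P, Y)) = r2 * P ^ 2 + k1 * P - j := by
  have hS := C.mem_S hP hY
  have := H.dualCoeff_eq (C.subset_p hS.1) (C.subset_y hS.2.1)
  rwa [C.h_mul_add hP hY] at this

/-- In the logarithmic derivative of hr along P, the terms ±r1 h cancel. There remains (2 r2 (hp +
g) + k1)/D = (2 r2 P + k1)/D, the logarithmic derivative of D. -/
theorem hasDerivAt_slope (C : L.IsChart U V a' c S E) (H : L.HasConstants r0 r1 r2 k1 k2 j)
    {P Y : ℂ} (hP : P ∈ E.Dp) (hY : Y ∈ E.Dy) (h0 : L.dualCoeff (S (P, Y)) ≠ 0) :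
    HasDerivAt (fun Q => L.h (S (Q, Y)).2 * L.r (S (Q, Y)).1 / (r2 * Q ^ 2 + k1 * Q - j)) 0 P := by
  have hS := C.mem_S hP hY
  obtain ⟨hA, hB⟩ := C.hasDerivAt_S_fst H.lattice hP hY h0
  have hPe := C.h_mul_add hP hY
  rw [C.dualCoeff_S H hP hY] at hA hB h0
  have hD : HasDerivAt (fun Q => r2 * Q ^ 2 + k1 * Q - j) (2 * r2 * P + k1) P :=
    ((((hasDerivAt_pow 2 P).const_mul r2).add
      ((hasDerivAt_id P).const_mul k1)).sub_const j).congr_deriv (by simp; ring)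
  refine ((((H.deriv_h _ (C.subset_y hS.2.1)).comp P hB).mul
    ((H.hasDerivAt_r (C.subset_p hS.1)).comp P hA)).div hD h0).congr_deriv ?_
  simp only [Function.comp, Pi.mul_apply]
  generalize hDe : r2 * P ^ 2 + k1 * P - j = D at *
  rw [div_eq_zero_iff]
  left
  generalize L.r (S (P, Y)).1 = r at *
  generalize L.h (S (P, Y)).2 = h at *
  generalize L.g (S (P, Y)).2 = g at *
  generalize (S (P, Y)).1 = p at *
  field_simp
  rw [← hPe]
  ring

theorem slope_eq_of_hasConstants (C : L.IsChart U V a' c S E)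
    (H : L.HasConstants r0 r1 r2 k1 k2 j)
    (h0 : ∀ P ∈ E.Dp, ∀ Y ∈ E.Dy, L.dualCoeff (S (P, Y)) ≠ 0)
    {P Q Y : ℂ} (hP : P ∈ E.Dp) (hQ : Q ∈ E.Dp) (hY : Y ∈ E.Dy) :
    L.h (S (P, Y)).2 * L.r (S (P, Y)).1 * (Q - P) =
      L.dualCoeff (S (P, Y)) * ((S (Q, Y)).1 - (S (P, Y)).1) := by
  obtain ⟨u, hu⟩ := C.region_p.exists_const
    (fun P hP => C.hasDerivAt_slope H hP hY (h0 P hP Y hY))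
  obtain ⟨v, hv⟩ := C.region_p.exists_const (f := fun P => (S (P, Y)).1 - u * P) (fun P hP => by
    refine ((C.hasDerivAt_S_fst H.lattice hP hY (h0 P hP Y hY)).1.sub
      ((hasDerivAt_id P).const_mul u)).congr_deriv ?_
    rw [← hu P hP, C.dualCoeff_S H hP hY]
    ring)
  have hD := h0 P hP Y hY
  rw [C.dualCoeff_S H hP hY] at hD ⊢
  have e := (div_eq_iff hD).1 (hu P hP)
  rw [e]
  linear_combination (r2 * P ^ 2 + k1 * P - j) * (hv P hP - hv Q hQ)

end IsChart

/-- Under the conditions of `HasConstants`, the duality transformations exist near each point where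
the Jacobian of `T` does not vanish. -/
theorem HasConstants.exists_hasDualAt {L : RTL} {r0 r1 r2 k1 k2 j : ℂ}
    (H : L.HasConstants r0 r1 r2 k1 k2 j) {p y : ℂ} (hp : p ∈ L.Dp) (hy : y ∈ L.Dy)
    (h : L.dualCoeff (p, y) ≠ 0) : ∃ E, L.HasDualAt p y E := by
  obtain ⟨U, V, a', c, S, Dp', Dy', hU, hV, hpU, hyV, hne, hbox, hC⟩ :=
    H.lattice.exists_chart hp hy h
  have C := hC (L.ratePlus S)
  refine ⟨⟨Dp', Dy', L.ratePlus S⟩, (L.hasDualAt_iff p y _).2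
    ⟨U, V, a', c, S, hU, hV, hpU, hyV, C, hbox, (C.transformsTo_iff H.lattice).2 ?_⟩⟩
  intro Pm hPm P hP Pp hPp Y hY Y₁ hY₁
  -- The right-hand side is defined by the first rate. For the second, A is affine in P with slope
  -- hr/D, and D does not depend on Y, so the rates agree.
  refine ⟨rfl, ?_⟩
  have h0 : ∀ P ∈ Dp', ∀ Y ∈ Dy', L.dualCoeff (S (P, Y)) ≠ 0 := fun P hP Y hY =>
    hne _ ⟨(C.mem_S hP hY).1, (C.mem_S hP hY).2.1⟩
  have e1 := C.slope_eq_of_hasConstants H h0 hP hPm hY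
  have e2 := C.slope_eq_of_hasConstants H h0 hP hPp hY₁
  have e3 : L.dualCoeff (S (P, Y)) = L.dualCoeff (S (P, Y₁)) := by
    rw [C.dualCoeff_S H hP hY, C.dualCoeff_S H hP hY₁]
  simp only [ratePlus, rateMinus]
  rw [e3] at e1 ⊢
  linear_combination -e1 - e2

/-- A dual lattice of a lattice with constants is, on its box, again a lattice with constants;
its variables are related to those of the original lattice. -/
theorem HasConstants.exists_dual {L : RTL} {r0 r1 r2 k1 k2 j : ℂ}
    (H : L.HasConstants r0 r1 r2 k1 k2 j) {E : LatticeEq} (hE : L.HasDual E) :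
    ∃ M : RTL, M.HasConstants (-j) k1 r2 r1 k2 (-r0) ∧
      (∀ K : LatticeEq, M.eq.ReducesTo K → E.ReducesTo K) ∧
      (∀ P ∈ M.Dp, ∀ Y ∈ M.Dy, ∃ p ∈ L.Dp, ∃ y ∈ L.Dy,
        P = L.h y * p + L.g y ∧ p = M.h Y * P + M.g Y ∧
        M.h Y * M.r P = L.h y * L.r p) := by
  obtain ⟨p₀, hp₀, y₀, hy₀, hE⟩ := hE
  obtain ⟨U, V, a', c, S, hU, hV, hpU, hyV, C, hbox, hT⟩ := (L.hasDualAt_iff p₀ y₀ E).1 hE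
  have hl := H.lattice
  have hh : ∀ P ∈ E.Dp, ∀ Y ∈ E.Dy, L.h (S (P, Y)).2 ≠ 0 := fun P hP Y hY =>
    H.h_ne _ (C.subset_y (C.mem_S hP hY).2.1)
  have hD0 : ∀ P ∈ E.Dp, ∀ Y ∈ E.Dy, r2 * P ^ 2 + k1 * P - j ≠ 0 := fun P hP Y hY => by
    rw [← C.dualCoeff_S H hP hY]
    exact C.dualCoeff_ne hl hT hP hY (hh P hP Y hY)
  obtain ⟨P₀, hP₀⟩ := C.region_p.2.nonempty
  obtain ⟨Y₀, hY₀⟩ := C.region_y.2.nonempty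
  -- u and v are the slope and intercept of the affine function A(·, Y), computed at a fixed P₀.
  -- They become h and g of the dual lattice.
  obtain ⟨u, hu⟩ : ∃ u : ℂ → ℂ, u = fun Y =>
    L.h (S (P₀, Y)).2 * L.r (S (P₀, Y)).1 / (r2 * P₀ ^ 2 + k1 * P₀ - j) := ⟨_, rfl⟩
  obtain ⟨v, hv⟩ : ∃ v : ℂ → ℂ, v = fun Y => (S (P₀, Y)).1 - u Y * P₀ := ⟨_, rfl⟩
  have hu₀ : ∀ Y ∈ E.Dy, u Y * (r2 * P₀ ^ 2 + k1 * P₀ - j) =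
      L.h (S (P₀, Y)).2 * L.r (S (P₀, Y)).1 := fun Y hY => by
    rw [hu]; exact div_mul_cancel₀ _ (hD0 P₀ hP₀ Y hY)
  have hv₀ : ∀ Y, v Y = (S (P₀, Y)).1 - u Y * P₀ := fun Y => by rw [hv]
  have hA : ∀ P ∈ E.Dp, ∀ Y ∈ E.Dy, (S (P, Y)).1 = u Y * P + v Y := fun P hP Y hY => by
    have e := C.slope_eq hl hT hP₀ hP hY
    rw [C.dualCoeff_S H hP₀ hY, ← hu₀ Y hY] at e
    have e' := mul_left_cancel₀ (hD0 P₀ hP₀ Y hY) (e.trans (by ring :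
      _ = (r2 * P₀ ^ 2 + k1 * P₀ - j) * (u Y * (P - P₀))))
    rw [hv₀]
    linear_combination e'
  have hK : ∀ P ∈ E.Dp, ∀ Y ∈ E.Dy, u Y * (r2 * P ^ 2 + k1 * P - j) =
      L.h (S (P, Y)).2 * L.r (S (P, Y)).1 := fun P hP Y hY => by
    by_cases hPP : P = P₀
    · rw [hPP]; exact hu₀ Y hY
    · have e := C.slope_eq hl hT hP hP₀ hY
      rw [C.dualCoeff_S H hP hY, hA P₀ hP₀ Y hY] at e
      have hne : P₀ - P ≠ 0 := sub_ne_zero.2 (Ne.symm hPP)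
      apply mul_right_cancel₀ hne
      linear_combination e + (r2 * P ^ 2 + k1 * P - j) * hA P hP Y hY
  have hu_ne : ∀ Y ∈ E.Dy, u Y ≠ 0 := fun Y hY h => by
    have := hu₀ Y hY
    rw [h, zero_mul] at this
    exact C.hr_ne hl hP₀ hY (hh P₀ hP₀ Y hY) this.symm
  have hPe : ∀ Y ∈ E.Dy, P₀ = L.h (S (P₀, Y)).2 * (S (P₀, Y)).1 + L.g (S (P₀, Y)).2 :=
    fun Y hY => (C.h_mul_add hP₀ hY).symm
  have hre : ∀ Y ∈ E.Dy, L.r (S (P₀, Y)).1 = r2 * (S (P₀, Y)).1 ^ 2 + r1 * (S (P₀, Y)).1 + r0 :=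
    fun Y hY => H.r_eq _ (C.subset_p (C.mem_S hP₀ hY).1)
  have hint : ∀ Y ∈ E.Dy, _ := fun Y hY => H.integral _ (C.subset_y (C.mem_S hP₀ hY).2.1)
  have hdc : ∀ Y ∈ E.Dy, deriv L.h (S (P₀, Y)).2 * (S (P₀, Y)).1 + deriv L.g (S (P₀, Y)).2 =
      (r2 * P₀ ^ 2 + k1 * P₀ - j) - L.h (S (P₀, Y)).2 ^ 2 * L.r (S (P₀, Y)).1 := fun Y hY => by
    rw [← C.dualCoeff_S H hP₀ hY, dualCoeff]; ring
  have hdu : ∀ Y ∈ E.Dy, HasDerivAt u (u Y * (2 * r2 * v Y - k1 * u Y + r1)) Y := fun Y hY => by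
    have hS := C.mem_S hP₀ hY
    have h0 := C.dualCoeff_ne hl hT hP₀ hY (hh P₀ hP₀ Y hY)
    obtain ⟨dA, dB⟩ := C.hasDerivAt_S_snd hl hP₀ hY h0
    rw [hdc Y hY] at dA
    rw [C.dualCoeff_S H hP₀ hY] at dA dB
    have h1 := hD0 P₀ hP₀ Y hY
    have hP := hPe Y hY
    have d := (((H.deriv_h _ (C.subset_y hS.2.1)).comp Y dB).mul
      ((H.hasDerivAt_r (C.subset_p hS.1)).comp Y dA)).div_const (r2 * P₀ ^ 2 + k1 * P₀ - j)
    rw [hv₀, show u Y = _ from congrFun hu Y]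
    rw [hu]
    refine d.congr_deriv ?_
    simp only [Function.comp]
    generalize r2 * P₀ ^ 2 + k1 * P₀ - j = D at *
    generalize L.r (S (P₀, Y)).1 = r at *
    generalize L.h (S (P₀, Y)).2 = h at *
    generalize L.g (S (P₀, Y)).2 = g at *
    generalize (S (P₀, Y)).1 = p at *
    field_simp
    rw [hP]
    ring
  have hdv : ∀ Y ∈ E.Dy, HasDerivAt v (u Y * (k1 * v Y - 2 * (-j) * u Y + k2)) Y := fun Y hY => by
    have hS := C.mem_S hP₀ hY
    have h0 := C.dualCoeff_ne hl hT hP₀ hY (hh P₀ hP₀ Y hY)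
    have dA := (C.hasDerivAt_S_snd hl hP₀ hY h0).1
    rw [hdc Y hY, C.dualCoeff_S H hP₀ hY] at dA
    have h1 := hD0 P₀ hP₀ Y hY
    have hP := hPe Y hY
    have hr := hre Y hY
    have hj := hint Y hY
    have hu' := hu₀ Y hY
    have hv' := hv₀ Y
    have d := dA.sub ((hdu Y hY).mul_const P₀)
    have d' : HasDerivAt v _ Y := d.congr_of_eventuallyEq (Filter.Eventually.of_forall hv₀)
    refine d'.congr_deriv ?_
    generalize u Y = u at *
    generalize v Y = v at *
    generalize L.r (S (P₀, Y)).1 = r at *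
    generalize L.h (S (P₀, Y)).2 = h at *
    generalize L.g (S (P₀, Y)).2 = g at *
    generalize (S (P₀, Y)).1 = p at *
    rw [sub_eq_iff_eq_add, div_eq_iff h1]
    subst hv'
    subst hr
    subst hP
    subst hj
    linear_combination (-(2 * r2 * (p - u * (h * p + g)) - k1 * u + r1) * (h * p + g) -
      (k1 * (p - u * (h * p + g)) + 2 * (r2 * g ^ 2 + k1 * g - r1 * g * h + r0 * h ^ 2 - k2 * h) * u
        + k2) + 2 * h * (r2 * p ^ 2 + r1 * p + r0)) * hu'
  -- The dual coefficient r is D as a function of P. The inverse relation p = uP + v has the same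
  -- form as P = hp + g, which explains the exchange of the constants.
  have hM : RTL.HasConstants
      ⟨E.Dp, E.Dy, fun P => r2 * P ^ 2 + k1 * P - j, v, u⟩ (-j) k1 r2 r1 k2 (-r0) := by
    refine hasConstants_of C.region_p C.region_y (fun P hP => hD0 P hP Y₀ hY₀)
      (fun P _ => sub_eq_add_neg _ _) hu_ne hdu hdv ?_
    intro Y hY
    have hP := hPe Y hY
    have hr := hre Y hY
    have hj := hint Y hY
    have hu' := hu₀ Y hY
    have hv' := hv₀ Y
    have h2 := hh P₀ hP₀ Y hY
    simp only
    generalize u Y = u at *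
    generalize v Y = v at *
    generalize L.r (S (P₀, Y)).1 = r at *
    generalize L.h (S (P₀, Y)).2 = h at *
    generalize L.g (S (P₀, Y)).2 = g at *
    generalize (S (P₀, Y)).1 = p at *
    apply mul_left_cancel₀ h2
    subst hv'
    subst hr
    subst hP
    subst hj
    linear_combination (u * h - 1) * hu'
  refine ⟨_, hM, ?_, ?_⟩
  · rintro K ⟨α, β, γ, δ, h1, h2, h3, h4, h5⟩
    refine ⟨α, β, γ, δ, h1, h2, h3, h4, fun Pm hPm P hP Pp hPp Y hY Y₁ hY₁ => ?_⟩
    rw [← h5 Pm hPm P hP Pp hPp Y hY Y₁ hY₁,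
      ((C.transformsTo_iff hl).1 hT Pm hPm P hP Pp hPp Y hY Y₁ hY₁).1]
    simp only [ratePlus, RTL.eq]
    rw [C.dualCoeff_S H hP hY, hA Pp hPp Y₁ hY₁, ← hK P hP Y hY, hA P hP Y hY]
    ring
  · intro P hP Y hY
    have hS := C.mem_S hP hY
    exact ⟨_, C.subset_p hS.1, _, C.subset_y hS.2.1, (C.h_mul_add hP hY).symm, hA P hP Y hY,
      hK P hP Y hY⟩

end RTL

/-! ### Changes of variables, linearity and nondegeneracy -/

namespace RTL

/-- The equations for h and g make the expression in the first integral constant, so j need not be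
known beforehand. -/
theorem exists_hasConstants_of_ode {L : RTL} (H : L.IsLattice) {r0 r1 r2 k1 k2 : ℂ}
    (h_ne : ∀ y ∈ L.Dy, L.h y ≠ 0) (hr : ∀ p ∈ L.Dp, L.r p = r2 * p ^ 2 + r1 * p + r0)
    (dh : ∀ y ∈ L.Dy, HasDerivAt L.h (L.h y * (2 * r2 * L.g y - r1 * L.h y + k1)) y)
    (dg : ∀ y ∈ L.Dy, HasDerivAt L.g (L.h y * (r1 * L.g y - 2 * r0 * L.h y + k2)) y) :
    ∃ j, L.HasConstants r0 r1 r2 k1 k2 j := by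
  obtain ⟨j, hj⟩ := H.region_y.exists_const (f := fun y =>
    r2 * L.g y ^ 2 + k1 * L.g y - r1 * (L.g y * L.h y) + r0 * L.h y ^ 2 - k2 * L.h y)
    (fun y hy => by
      refine (((((((dg y hy).pow 2).const_mul r2).add ((dg y hy).const_mul k1)).sub
        (((dg y hy).mul (dh y hy)).const_mul r1)).add (((dh y hy).pow 2).const_mul r0)).sub
        ((dh y hy).const_mul k2)).congr_deriv ?_
      simp
      ring)
  exact ⟨j, H, h_ne, hr, dh, dg, fun y hy => by linear_combination hj y hy⟩

/-- The coefficients of `L` are obtained from those of `M` by a change of variables. -/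
structure Matches (L M : RTL) (α β γ δ lam c : ℂ) : Prop where
  α_ne : α ≠ 0
  δ_ne : δ ≠ 0
  lam_ne : lam ≠ 0
  mem_p : ∀ p ∈ L.Dp, α * δ * p + β ∈ M.Dp
  mem_y : ∀ y ∈ L.Dy, α * y + γ ∈ M.Dy
  r_eq : ∀ p ∈ L.Dp, L.r p = lam * M.r (α * δ * p + β)
  h_eq : ∀ y ∈ L.Dy, M.h (α * y + γ) = lam * δ * L.h y
  g_eq : ∀ y ∈ L.Dy, M.g (α * y + γ) = α * δ ^ 2 * lam * L.g y - β * (lam * δ * L.h y) - c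

/-- Varying p₁ alone isolates the product r(p)h(y), so r and h are each determined up to reciprocal
factors. What remains determines g up to a constant. -/
theorem exists_matches {L M : RTL} (HL : L.IsLattice) (HM : M.IsLattice)
    (hh : ∀ y ∈ M.Dy, M.h y ≠ 0) (h : L.eq.ReducesTo M.eq) :
    ∃ α β γ δ lam c, L.Matches M α β γ δ lam c := by
  obtain ⟨α, β, γ, δ, hα, hδ, hp, hy, hF⟩ := h
  simp only [RTL.eq] at hp hy hF
  obtain ⟨p₀, hp₀⟩ := HL.region_p.2.nonempty
  obtain ⟨y₀, hy₀⟩ := HL.region_y.2.nonempty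
  obtain ⟨p₁, hp₁, hne⟩ : ∃ p₁ ∈ L.Dp, p₁ ≠ p₀ := by
    have h1 : ∀ᶠ q in 𝓝[≠] p₀, q ∈ L.Dp := nhdsWithin_le_nhds (HL.region_p.1.mem_nhds hp₀)
    exact (h1.and self_mem_nhdsWithin).exists
  have hrh : ∀ p ∈ L.Dp, ∀ y ∈ L.Dy,
      δ * (L.r p * L.h y) = M.r (α * δ * p + β) * M.h (α * y + γ) := fun p hp y hy => by
    have e1 := hF p₀ hp₀ p hp p₁ hp₁ y hy y hy
    have e2 := hF p₀ hp₀ p hp p₀ hp₀ y hy y hy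
    apply mul_left_cancel₀ (mul_ne_zero (mul_ne_zero hα hδ) (sub_ne_zero.2 hne))
    linear_combination e1 - e2
  have hR₀ := HM.r_ne_zero _ (hp p₀ hp₀)
  have hr₀ := HL.r_ne_zero _ hp₀
  obtain ⟨lam, hlam⟩ : ∃ lam, lam = L.r p₀ / M.r (α * δ * p₀ + β) := ⟨_, rfl⟩
  have hlam0 : lam ≠ 0 := by rw [hlam]; exact div_ne_zero hr₀ hR₀
  have hlam' : L.r p₀ = lam * M.r (α * δ * p₀ + β) := by rw [hlam]; field_simp
  have hh' : ∀ y ∈ L.Dy, M.h (α * y + γ) = lam * δ * L.h y := fun y hy => by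
    have e := hrh p₀ hp₀ y hy
    rw [hlam'] at e
    apply mul_left_cancel₀ hR₀
    linear_combination -e
  have hLh : ∀ y ∈ L.Dy, L.h y ≠ 0 := fun y hy' h0 => by
    have := hh' y hy'
    rw [h0, mul_zero] at this
    exact hh _ (hy y hy') this
  have hr : ∀ p ∈ L.Dp, L.r p = lam * M.r (α * δ * p + β) := fun p hp => by
    have e := hrh p hp y₀ hy₀
    rw [hh' y₀ hy₀] at e
    apply mul_left_cancel₀ (mul_ne_zero hδ (hLh y₀ hy₀))
    linear_combination e
  refine ⟨α, β, γ, δ, lam, α * δ ^ 2 * lam * L.g y₀ - β * (lam * δ * L.h y₀) - M.g (α * y₀ + γ),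
    hα, hδ, hlam0, hp, hy, hr, hh', fun y hy' => ?_⟩
  have e := hF p₀ hp₀ p₀ hp₀ p₀ hp₀ y₀ hy₀ y hy'
  rw [hh' y hy', hh' y₀ hy₀, hlam'] at e
  apply mul_left_cancel₀ hR₀
  linear_combination -e

namespace Matches

variable {L M : RTL} {α β γ δ lam c : ℂ}

theorem deriv_h (m : L.Matches M α β γ δ lam c) (HL : L.IsLattice) (HM : M.IsLattice) {y : ℂ}
    (hy : y ∈ L.Dy) : deriv M.h (α * y + γ) * α = lam * δ * deriv L.h y := by
  have hlin : HasDerivAt (fun y => α * y + γ) α y :=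
    (((hasDerivAt_id y).const_mul α).add_const γ).congr_deriv (mul_one α)
  refine HasDerivAt.unique ((HM.hasDerivAt_h (m.mem_y y hy)).comp y hlin)
    (((HL.hasDerivAt_h hy).const_mul (lam * δ)).congr_of_eventuallyEq ?_)
  filter_upwards [HL.region_y.1.mem_nhds hy] with w hw
  exact m.h_eq w hw

theorem deriv_g (m : L.Matches M α β γ δ lam c) (HL : L.IsLattice) (HM : M.IsLattice) {y : ℂ}
    (hy : y ∈ L.Dy) : deriv M.g (α * y + γ) * α =
      α * δ ^ 2 * lam * deriv L.g y - β * (lam * δ * deriv L.h y) := by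
  have hlin : HasDerivAt (fun y => α * y + γ) α y :=
    (((hasDerivAt_id y).const_mul α).add_const γ).congr_deriv (mul_one α)
  refine HasDerivAt.unique ((HM.hasDerivAt_g (m.mem_y y hy)).comp y hlin)
    (((((HL.hasDerivAt_g hy).const_mul (α * δ ^ 2 * lam)).sub
      (((HL.hasDerivAt_h hy).const_mul (lam * δ)).const_mul β)).sub_const c).congr_of_eventuallyEq
        ?_)
  filter_upwards [HL.region_y.1.mem_nhds hy] with w hw
  exact m.g_eq w hw

theorem dualCoeff_eq (m : L.Matches M α β γ δ lam c) (HL : L.IsLattice) (HM : M.IsLattice)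
    {p y : ℂ} (hp : p ∈ L.Dp) (hy : y ∈ L.Dy) :
    M.dualCoeff (α * δ * p + β, α * y + γ) = lam * δ ^ 2 * L.dualCoeff (p, y) := by
  have h1 := m.deriv_h HL HM hy
  have h2 := m.deriv_g HL HM hy
  simp only [dualCoeff]
  rw [m.h_eq y hy, m.r_eq p hp]
  apply mul_left_cancel₀ m.α_ne
  linear_combination (α * δ * p + β) * h1 + h2

theorem exists_hasConstants (m : L.Matches M α β γ δ lam c) (HL : L.IsLattice)
    {r0 r1 r2 k1 k2 j : ℂ} (H : M.HasConstants r0 r1 r2 k1 k2 j) (h0 : ¬ (r2 = 0 ∧ r1 = 0 ∧ k1 = 0)) :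
    ∃ s0 s1 s2 l1 l2 i : ℂ, L.HasConstants s0 s1 s2 l1 l2 i ∧ ¬ (s2 = 0 ∧ s1 = 0 ∧ l1 = 0) := by
  have hα := m.α_ne
  have hδ := m.δ_ne
  have hlam := m.lam_ne
  have hdh : ∀ y ∈ L.Dy, deriv L.h y = L.h y * (2 * (lam * α ^ 2 * δ ^ 2 * r2) * L.g y -
      lam * α * δ * (2 * r2 * β + r1) * L.h y + α * (k1 - 2 * r2 * c)) := fun y hy => by
    have e := m.deriv_h HL H.lattice hy
    rw [(H.deriv_h _ (m.mem_y y hy)).deriv, m.h_eq y hy, m.g_eq y hy] at e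
    apply mul_left_cancel₀ (mul_ne_zero hlam hδ)
    linear_combination -e
  have hdg : ∀ y ∈ L.Dy, deriv L.g y = L.h y * (lam * α * δ * (2 * r2 * β + r1) * L.g y -
      2 * (lam * (r2 * β ^ 2 + r1 * β + r0)) * L.h y +
      (k2 + β * k1 - c * (r1 + 2 * β * r2)) / δ) := fun y hy => by
    have e := m.deriv_g HL H.lattice hy
    rw [(H.deriv_g _ (m.mem_y y hy)).deriv, m.h_eq y hy, m.g_eq y hy, hdh y hy] at e
    apply mul_left_cancel₀ (mul_ne_zero (mul_ne_zero hα (pow_ne_zero 2 hδ)) hlam)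
    field_simp
    field_simp at e
    linear_combination -e
  obtain ⟨j, hj⟩ := exists_hasConstants_of_ode HL
    -- These constants come from substituting the change of variables into r and into the equations
    -- for h and g of M.
    (r0 := lam * (r2 * β ^ 2 + r1 * β + r0)) (r1 := lam * α * δ * (2 * r2 * β + r1))
    (r2 := lam * α ^ 2 * δ ^ 2 * r2) (k1 := α * (k1 - 2 * r2 * c))
    (k2 := (k2 + β * k1 - c * (r1 + 2 * β * r2)) / δ)
    (fun y hy h => H.h_ne _ (m.mem_y y hy) (by rw [m.h_eq y hy, h, mul_zero]))
    (fun p hp => by rw [m.r_eq p hp, H.r_eq _ (m.mem_p p hp)]; ring)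
    (fun y hy => (HL.hasDerivAt_h hy).congr_deriv (hdh y hy))
    (fun y hy => (HL.hasDerivAt_g hy).congr_deriv (hdg y hy))
  refine ⟨_, _, _, _, _, j, hj, ?_⟩
  rintro ⟨h2, h1, h3⟩
  have e2 : r2 = 0 := by simpa [hα, hδ, hlam] using h2
  subst e2
  have e1 : r1 = 0 := by simpa [hα, hδ, hlam] using h1
  have e3 : k1 = 0 := by simpa [hα] using h3
  exact h0 ⟨rfl, e1, e3⟩

end Matches

namespace HasConstants

variable {L : RTL} {r0 r1 r2 k1 k2 j : ℂ}

/-- D is the polynomial r2 P² + k1 P − j at P = hp + g with h ≠ 0; it can vanish on an open set of p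
only if its coefficients are zero. -/
theorem frequently_dualCoeff_ne (H : L.HasConstants r0 r1 r2 k1 k2 j)
    (h : ¬ (r2 = 0 ∧ k1 = 0 ∧ j = 0)) {p y : ℂ} (hp : p ∈ L.Dp) (hy : y ∈ L.Dy) :
    ∃ᶠ q in 𝓝 p, L.dualCoeff (q, y) ≠ 0 := by
  intro hev
  have h0 := H.h_ne y hy
  obtain ⟨e1, e2, e3⟩ := quadratic_coeff_eq_zero (p := p) (a := r2 * L.h y ^ 2)
    (b := 2 * r2 * L.h y * L.g y + k1 * L.h y) (c := r2 * L.g y ^ 2 + k1 * L.g y - j) (by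
      filter_upwards [hev, H.lattice.region_p.1.mem_nhds hp] with q hq1 hq2
      rw [not_not, H.dualCoeff_eq hq2 hy] at hq1
      linear_combination hq1)
  have hr2 : r2 = 0 := by simpa [h0] using e1
  subst hr2
  have hk1 : k1 = 0 := by simpa [h0] using e2
  subst hk1
  exact h ⟨rfl, rfl, by linear_combination -e3⟩

theorem admitsDuality_of_dualCoeff_ne (H : L.HasConstants r0 r1 r2 k1 k2 j) {p y : ℂ}
    (hp : p ∈ L.Dp) (hy : y ∈ L.Dy) (h : L.dualCoeff (p, y) ≠ 0) : L.AdmitsDuality := by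
  obtain ⟨E, hE⟩ := H.exists_hasDualAt hp hy h
  exact ⟨E, p, hp, y, hy, hE⟩

theorem admitsDuality (H : L.HasConstants r0 r1 r2 k1 k2 j)
    (h : ¬ (r2 = 0 ∧ k1 = 0 ∧ j = 0)) : L.AdmitsDuality := by
  obtain ⟨p, hp⟩ := H.lattice.region_p.2.nonempty
  obtain ⟨y, hy⟩ := H.lattice.region_y.2.nonempty
  obtain ⟨q, hq1, hq2⟩ := ((H.frequently_dualCoeff_ne h hp hy).and_eventually
    (H.lattice.region_p.1.mem_nhds hp)).exists
  exact H.admitsDuality_of_dualCoeff_ne hq2 hy hq1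

/-- The dual is identified from its constants. The relation between the variables of L and of M is
kept for cases in which the constants leave several possibilities. -/
theorem dualIs (H : L.HasConstants r0 r1 r2 k1 k2 j) (h : ¬ (r2 = 0 ∧ k1 = 0 ∧ j = 0)) {K : RTL}
    (hK : ∀ M : RTL, M.HasConstants (-j) k1 r2 r1 k2 (-r0) →
      (∀ P ∈ M.Dp, ∀ Y ∈ M.Dy, ∃ p ∈ L.Dp, ∃ y ∈ L.Dy,
        P = L.h y * p + L.g y ∧ p = M.h Y * P + M.g Y ∧
        M.h Y * M.r P = L.h y * L.r p) → M.eq.ReducesTo K.eq) : L.DualIs K := by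
  refine ⟨H.admitsDuality h, fun E hE => ?_⟩
  obtain ⟨M, hM, hred, hrel⟩ := H.exists_dual hE
  exact hred _ (hK M hM hrel)

/-- In an affine right-hand side the coefficient r(p)h(y) of p₁ is constant; then r and h are
constant, which forces r2 = r1 = 0 and k1 = 0. -/
theorem not_isLinear (H : L.HasConstants r0 r1 r2 k1 k2 j) (h : ¬ (r2 = 0 ∧ r1 = 0 ∧ k1 = 0)) :
    ¬ L.eq.IsLinear := by
  rintro ⟨a, a₁, a₂, a₃, a₄, a₅, hF⟩
  simp only [RTL.eq] at hF
  obtain ⟨p₀, hp₀⟩ := H.lattice.region_p.2.nonempty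
  obtain ⟨y₀, hy₀⟩ := H.lattice.region_y.2.nonempty
  obtain ⟨p₁, hp₁, hne⟩ : ∃ p₁ ∈ L.Dp, p₁ ≠ p₀ := by
    have h1 : ∀ᶠ q in 𝓝[≠] p₀, q ∈ L.Dp :=
      nhdsWithin_le_nhds (H.lattice.region_p.1.mem_nhds hp₀)
    exact (h1.and self_mem_nhdsWithin).exists
  have hrh : ∀ p ∈ L.Dp, ∀ y ∈ L.Dy, L.r p * L.h y = a₃ := fun p hp y hy => by
    have e1 := hF p₀ hp₀ p hp p₁ hp₁ y hy y hy
    have e2 := hF p₀ hp₀ p hp p₀ hp₀ y hy y hy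
    apply mul_left_cancel₀ (sub_ne_zero.2 hne)
    linear_combination e1 - e2
  have h0 := H.h_ne y₀ hy₀
  have hr0 := H.lattice.r_ne_zero p₀ hp₀
  obtain ⟨e1, e2, -⟩ := quadratic_coeff_eq_zero (p := p₀) (a := r2) (b := r1)
    (c := r0 - L.r p₀) (by
      filter_upwards [H.lattice.region_p.1.mem_nhds hp₀] with q hq
      have := (hrh q hq y₀ hy₀).trans (hrh p₀ hp₀ y₀ hy₀).symm
      have := mul_right_cancel₀ h0 this
      rw [H.r_eq q hq] at this
      linear_combination this)
  have hd : deriv L.h y₀ = 0 := by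
    have : L.h =ᶠ[𝓝 y₀] fun _ => L.h y₀ := by
      filter_upwards [H.lattice.region_y.1.mem_nhds hy₀] with w hw
      exact mul_left_cancel₀ hr0 ((hrh p₀ hp₀ w hw).trans (hrh p₀ hp₀ y₀ hy₀).symm)
    rw [this.deriv_eq, deriv_const]
  rw [(H.deriv_h y₀ hy₀).deriv, e1, e2] at hd
  have e3 : k1 = 0 := by simpa [h0] using hd
  exact h ⟨e1, e2, e3⟩

theorem isLinear (H : L.HasConstants r0 0 0 0 k2 j) : L.eq.IsLinear := by
  obtain ⟨h₀, hh⟩ := H.lattice.region_y.exists_const (f := L.h)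
    (fun y hy => (H.deriv_h y hy).congr_deriv (by ring))
  obtain ⟨g₀, hg⟩ := H.lattice.region_y.exists_const
    (f := fun y => L.g y - h₀ * (k2 - 2 * r0 * h₀) * y) (fun y hy => by
      refine ((H.deriv_g y hy).sub
        ((hasDerivAt_id y).const_mul (h₀ * (k2 - 2 * r0 * h₀)))).congr_deriv ?_
      rw [hh y hy]; ring)
  refine ⟨0, -(r0 * h₀), 0, r0 * h₀, -(r0 * (h₀ * (k2 - 2 * r0 * h₀))),
    r0 * (h₀ * (k2 - 2 * r0 * h₀)), fun pm _ p hp pp _ y hy y₁ hy₁ => ?_⟩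
  have hy : y ∈ L.Dy := hy
  have hy₁ : y₁ ∈ L.Dy := hy₁
  simp only [RTL.eq]
  rw [H.r_eq p hp, hh y hy, hh y₁ hy₁]
  linear_combination r0 * (hg y₁ hy₁ - hg y hy)

theorem reducesTo_d (H : L.HasConstants r0 r1 r2 k1 k2 j) (hr2 : r2 ≠ 0)
    (hκ : j + k1 ^ 2 / (4 * r2) = 0) (hk : k2 - r1 * k1 / (2 * r2) = 0)
    (hρ : r0 - r1 ^ 2 / (4 * r2) ≠ 0) : L.eq.ReducesTo Kind.d.lattice.eq := by
  have C := H.isCentered hr2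
  rw [hκ, hk] at C
  exact C.reducesTo_d hρ

theorem reducesTo_f (H : L.HasConstants r0 r1 r2 k1 k2 j) (hr2 : r2 ≠ 0)
    (hκ : j + k1 ^ 2 / (4 * r2) = 0) (hk : k2 - r1 * k1 / (2 * r2) ≠ 0) {μ : ℂ}
    (hμ : μ = 0 ↔ r0 - r1 ^ 2 / (4 * r2) = 0) : L.eq.ReducesTo (Kind.f μ).lattice.eq := by
  have C := H.isCentered hr2
  rw [hκ] at C
  exact C.reducesTo_f hk hμ

end HasConstants

/-- If z ≡ 0, then h is constant, and so is g, which is determined by z and h. This contradicts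
nondegeneracy. -/
theorem IsCentered.exists_ne_zero {L : RTL} {r2 s ρ k κ c : ℂ} {z : ℂ → ℂ}
    (H : L.IsCentered r2 s ρ k κ c z) (hN : L.Nondegenerate) : ∃ y ∈ L.Dy, z y ≠ 0 := by
  by_contra hcon
  push Not at hcon
  obtain ⟨x₀, hx⟩ := H.lattice.region_y.exists_const (f := fun y => (L.h y)⁻¹)
    (fun y hy => (H.deriv_inv y hy).congr_deriv (hcon y hy))
  obtain ⟨y, hy, h⟩ := hN.2
  have eh : L.h =ᶠ[𝓝 y] fun _ => x₀⁻¹ := by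
    filter_upwards [H.lattice.region_y.1.mem_nhds hy] with w hw
    rw [← hx w hw, inv_inv]
  have eg : L.g =ᶠ[𝓝 y] fun _ => s * x₀⁻¹ + c / (2 * r2) := by
    filter_upwards [H.lattice.region_y.1.mem_nhds hy] with w hw
    have hr2 := H.r2_ne
    have := H.g_eq w hw
    rw [hcon w hw] at this
    rw [← hx w hw, inv_inv]
    field_simp
    linear_combination this
  rw [eh.deriv_eq, eg.deriv_eq, deriv_const, deriv_const] at h
  simp at h

/-! ### Classification -/

/-- Each nondegenerate nonlinear lattice with constants, for which the Jacobian of `T` does not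
vanish identically, is in the list. -/
theorem HasConstants.exists_kind {L : RTL} {r0 r1 r2 k1 k2 j : ℂ}
    (H : L.HasConstants r0 r1 r2 k1 k2 j) (hN : L.Nondegenerate) (hl : ¬ L.eq.IsLinear)
    (h : ¬ (r2 = 0 ∧ k1 = 0 ∧ j = 0)) :
    ∃ k : Kind, k.Admissible ∧ L.eq.ReducesTo k.lattice.eq := by
  by_cases hr2 : r2 = 0
  · subst hr2
    by_cases hr1 : r1 = 0
    · subst hr1
      have hk1 : k1 ≠ 0 := by
        rintro rfl
        exact hl H.isLinear
      exact ⟨.a, by simp [Kind.Admissible], H.reducesTo_a hk1⟩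
    · by_cases hk1 : k1 = 0
      · subst hk1
        exact ⟨.b, by simp [Kind.Admissible], H.reducesTo_b hr1 fun hj => h ⟨rfl, rfl, hj⟩⟩
      -- Only the vanishing of μ and ν is significant, so the values 0 and 1 suffice.
      · obtain ⟨μ, hμ⟩ : ∃ μ : ℂ, μ = 0 ↔ ∀ y ∈ L.Dy, k1 - r1 * L.h y = 0 := by
          by_cases hc : ∀ y ∈ L.Dy, k1 - r1 * L.h y = 0
          · exact ⟨0, by simpa using hc⟩
          · exact ⟨1, by simpa using hc⟩
        obtain ⟨ν, hν⟩ : ∃ ν : ℂ, ν = 0 ↔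
            ∀ y ∈ L.Dy, r1 * L.g y - r0 * L.h y + k2 - k1 * r0 / r1 = 0 := by
          by_cases hc : ∀ y ∈ L.Dy, r1 * L.g y - r0 * L.h y + k2 - k1 * r0 / r1 = 0
          · exact ⟨0, by simpa using hc⟩
          · exact ⟨1, by simpa using hc⟩
        refine ⟨.c μ ν, ?_, H.reducesTo_c hr1 hk1 hμ hν⟩
        intro hc
        simp only [Kind.c.injEq] at hc
        have h1 := hμ.1 hc.1
        have h2 := hν.1 hc.2
        obtain ⟨y, hy, hd⟩ := hN.2
        have hh : ∀ w ∈ L.Dy, L.h w = k1 / r1 := fun w hw => by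
          field_simp
          linear_combination -h1 w hw
        have eh : L.h =ᶠ[𝓝 y] fun _ => k1 / r1 := by
          filter_upwards [H.lattice.region_y.1.mem_nhds hy] with w hw
          exact hh w hw
        have eg : L.g =ᶠ[𝓝 y] fun _ => (r0 * (k1 / r1) - k2 + k1 * r0 / r1) / r1 := by
          filter_upwards [H.lattice.region_y.1.mem_nhds hy] with w hw
          rw [eq_div_iff hr1, ← hh w hw]
          linear_combination h2 w hw
        rw [eh.deriv_eq, eg.deriv_eq, deriv_const, deriv_const] at hd
        simp at hd
  · have C := H.isCentered hr2
    obtain ⟨y, hy, hz⟩ := C.exists_ne_zero hN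
    by_cases hκ : j + k1 ^ 2 / (4 * r2) = 0
    · by_cases hk : k2 - r1 * k1 / (2 * r2) = 0
      · refine ⟨.d, by simp [Kind.Admissible], H.reducesTo_d hr2 hκ hk fun hρ => hz ?_⟩
        have := C.z_sq y hy
        rw [hκ, hk, hρ] at this
        have h2 : (r1 - (2 * r2 * L.g y + k1) * (L.h y)⁻¹) ^ 2 = 0 := by rw [this]; ring
        exact pow_eq_zero_iff (two_ne_zero) |>.1 h2
      · exact ⟨.f _, by simp [Kind.Admissible], H.reducesTo_f hr2 hκ hk Iff.rfl⟩
    · by_cases hD : (k2 - r1 * k1 / (2 * r2)) ^ 2 +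
          4 * (r0 - r1 ^ 2 / (4 * r2)) * (j + k1 ^ 2 / (4 * r2)) = 0
      · exact ⟨.e _, by simp [Kind.Admissible], C.reducesTo_e hκ hD Iff.rfl ⟨y, hy, hz⟩⟩
      · obtain ⟨m, hm⟩ := IsAlgClosed.exists_pow_nat_eq ((k2 - r1 * k1 / (2 * r2)) ^ 2 /
          ((k2 - r1 * k1 / (2 * r2)) ^ 2 +
          4 * (r0 - r1 ^ 2 / (4 * r2)) * (j + k1 ^ 2 / (4 * r2)))) (n := 2) (by norm_num)
        refine ⟨.g m, by simp [Kind.Admissible], C.reducesTo_g hκ hD ?_⟩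
        rw [hm, div_mul_cancel₀ _ hD]

end RTL

/-- The lattices of the list satisfy the differential equations, their coefficients `g`, `h` have
no common critical points, and they are neither linear nor degenerate for duality. -/
theorem Kind.exists_hasConstants (k : Kind) (hk : k.Admissible) :
    ∃ r0 r1 r2 k1 k2 j : ℂ, k.lattice.HasConstants r0 r1 r2 k1 k2 j ∧
      ¬ (r2 = 0 ∧ k1 = 0 ∧ j = 0) ∧ ¬ (r2 = 0 ∧ r1 = 0 ∧ k1 = 0) ∧
      ∀ y ∈ k.lattice.Dy, ¬ (deriv k.lattice.h y = 0 ∧ deriv k.lattice.g y = 0) := by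
  have aux : ∀ {k : Kind} {r0 r1 r2 k1 k2 j : ℂ}, k.lattice.HasConstants r0 r1 r2 k1 k2 j →
      (∀ y ∈ k.lattice.Dy, 2 * r2 * k.lattice.g y - r1 * k.lattice.h y + k1 = 0 →
        r1 * k.lattice.g y - 2 * r0 * k.lattice.h y + k2 = 0 → False) →
      ∀ y ∈ k.lattice.Dy, ¬ (deriv k.lattice.h y = 0 ∧ deriv k.lattice.g y = 0) := by
    rintro k r0 r1 r2 k1 k2 j H h y hy ⟨e1, e2⟩
    rw [(H.deriv_h y hy).deriv] at e1
    rw [(H.deriv_g y hy).deriv] at e2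
    exact h y hy ((mul_eq_zero.1 e1).resolve_left (H.h_ne y hy))
      ((mul_eq_zero.1 e2).resolve_left (H.h_ne y hy))
  cases k with
  | a =>
    refine ⟨_, _, _, _, _, _, hasConstants_a, by simp, by simp, aux hasConstants_a ?_⟩
    intro y _ h1 _
    simp at h1
  | b =>
    refine ⟨_, _, _, _, _, _, hasConstants_b, by simp, by simp, aux hasConstants_b ?_⟩
    intro y hy h1 _
    exact hasConstants_b.h_ne y hy (by linear_combination -h1)
  | c μ ν =>
    refine ⟨_, _, _, _, _, _, hasConstants_c μ ν, by simp, by simp, aux (hasConstants_c μ ν) ?_⟩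
    intro y hy h1 h2
    have hy : 1 + μ * exp (-y) ≠ 0 := hy
    simp only [Kind.lattice] at h1 h2
    have e1 := Complex.exp_ne_zero y
    have e2 := Complex.exp_ne_zero (-y)
    field_simp at h1
    have hμ : μ = 0 := by simpa [e2] using h1
    subst hμ
    have hν : ν = 0 := by simpa [e1] using h2
    exact hk (by rw [hν])
  | d =>
    refine ⟨_, _, _, _, _, _, hasConstants_d, by simp, by simp, aux hasConstants_d ?_⟩
    intro y hy h1 _
    refine hasConstants_d.h_ne y hy ?_
    simp only [Kind.lattice] at h1 ⊢
    linear_combination -h1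
  | e μ =>
    refine ⟨_, _, _, _, _, _, hasConstants_e μ, by simp, by simp, aux (hasConstants_e μ) ?_⟩
    intro y hy h1 _
    have hy : μ + exp y ≠ 0 := hy
    simp only [Kind.lattice] at h1
    field_simp at h1
    exact Complex.exp_ne_zero y (by linear_combination -h1)
  | f μ =>
    refine ⟨_, _, _, _, _, _, hasConstants_f μ, by simp, by simp, aux (hasConstants_f μ) ?_⟩
    intro y hy h1 h2
    have hy : μ + y ^ 2 ≠ 0 := hy
    simp only [Kind.lattice] at h1 h2
    field_simp at h1 h2
    have hy0 : y = 0 := by simpa using h1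
    subst hy0
    exact hy (by linear_combination -h2)
  | g μ =>
    refine ⟨_, _, _, _, _, _, hasConstants_g μ, by norm_num, by norm_num,
      aux (hasConstants_g μ) ?_⟩
    intro y hy h1 h2
    have hy : μ + cosh y ≠ 0 := hy
    have e := Complex.cosh_sq y
    simp only [Kind.lattice] at h1 h2
    field_simp at h1 h2
    have hs : sinh y = 0 := by linear_combination -h1
    rw [hs] at e
    have hc : cosh y * (μ + cosh y) = 0 := by linear_combination e - h2
    rcases mul_eq_zero.1 hc with h | h
    · rw [h] at e; norm_num at e
    · exact hy h

/-! ### The duality links -/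

namespace Kind

/-- The exchange of constants maps those of one lattice exactly to those of the other. -/
theorem linked_a_b : Kind.a.lattice.Linked Kind.b.lattice :=
  ⟨hasConstants_a.dualIs (by simp) fun _ hM _ => hM.reducesTo_b one_ne_zero (by simp),
    hasConstants_b.dualIs (by simp) fun _ hM _ => hM.reducesTo_a one_ne_zero⟩

/-- In the dual of the lattice `c`, the coefficients are constant exactly if the parameters
vanish. -/
theorem dual_c_conditions {μ ν : ℂ} {M : RTL} (hM : M.HasConstants (-0) 1 0 1 (μ * ν) (-0))
    (hrel : ∀ P ∈ M.Dp, ∀ Y ∈ M.Dy, ∃ p ∈ (Kind.c μ ν).lattice.Dp, ∃ y ∈ (Kind.c μ ν).lattice.Dy,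
        P = (Kind.c μ ν).lattice.h y * p + (Kind.c μ ν).lattice.g y ∧ p = M.h Y * P + M.g Y ∧
        M.h Y * M.r P = (Kind.c μ ν).lattice.h y * (Kind.c μ ν).lattice.r p) :
    (ν = 0 ↔ ∀ Y ∈ M.Dy, 1 - 1 * M.h Y = 0) ∧
    (μ = 0 ↔ ∀ Y ∈ M.Dy, 1 * M.g Y - -0 * M.h Y + μ * ν - 1 * -0 / 1 = 0) := by
  obtain ⟨P, hP⟩ := hM.lattice.region_p.2.nonempty
  obtain ⟨Y₀, hY₀⟩ := hM.lattice.region_y.2.nonempty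
  have hP0 : P ≠ 0 := fun h => hM.lattice.r_ne_zero P hP (by rw [hM.r_eq P hP, h]; ring)
  -- Explicitly, the dual has 1 − h = ν eʸ/P and g + μν = μ e⁻ʸ P, so each parameter controls one
  -- coefficient.
  have key : ∀ Y ∈ M.Dy, ∃ y, (1 - M.h Y) * P = ν * exp y ∧
      M.g Y + μ * ν = μ * exp (-y) * P := fun Y hY => by
    obtain ⟨p, -, y, hy, h1, h2, h3⟩ := hrel P hP Y hY
    have hy : 1 + μ * exp (-y) ≠ 0 := hy
    have e : exp (-y) * exp y = 1 := by rw [← Complex.exp_add]; simp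
    rw [hM.r_eq P hP] at h3
    simp only [Kind.lattice] at h1 h3
    have h4 : M.h Y * P = 1 / (1 + μ * exp (-y)) * p := by linear_combination h3
    refine ⟨y, by linear_combination h1 - h4, ?_⟩
    rw [h4] at h2
    have h5 : M.g Y = p - 1 / (1 + μ * exp (-y)) * p := by linear_combination -h2
    rw [h5, h1]
    field_simp
    linear_combination (-μ * ν * (1 + μ * exp (-y))) * e
  constructor
  · constructor
    · rintro rfl Y hY
      obtain ⟨y, h1, -⟩ := key Y hY
      rw [zero_mul] at h1
      rw [one_mul]
      exact (mul_eq_zero.1 h1).resolve_right hP0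
    · intro h
      obtain ⟨y, h1, -⟩ := key Y₀ hY₀
      have := h Y₀ hY₀
      rw [one_mul] at this
      rw [this, zero_mul] at h1
      exact (mul_eq_zero.1 h1.symm).resolve_right (Complex.exp_ne_zero y)
  · constructor
    · rintro rfl Y hY
      obtain ⟨y, -, h2⟩ := key Y hY
      linear_combination h2
    · intro h
      obtain ⟨y, -, h2⟩ := key Y₀ hY₀
      have h3 := h Y₀ hY₀
      have h4 : μ * exp (-y) * P = 0 := by linear_combination h3 - h2
      simpa [hP0, Complex.exp_ne_zero] using h4

theorem dualIs_c (μ ν : ℂ) : (Kind.c μ ν).lattice.DualIs (Kind.c ν μ).lattice :=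
  (hasConstants_c μ ν).dualIs (by simp) fun _ hM hrel =>
    hM.reducesTo_c one_ne_zero one_ne_zero (dual_c_conditions hM hrel).1
      (dual_c_conditions hM hrel).2

theorem selfDual_c {μ ν : ℂ} (hμ : μ ≠ 0) (hν : ν ≠ 0) : (Kind.c μ ν).lattice.SelfDual :=
  (hasConstants_c μ ν).dualIs (by simp) fun _ hM hrel =>
    hM.reducesTo_c one_ne_zero one_ne_zero
      ((iff_of_false hμ hν).trans (dual_c_conditions hM hrel).1)
      ((iff_of_false hν hμ).trans (dual_c_conditions hM hrel).2)

/-- For (d), κ = k = 0 ≠ ρ, so the dual has κ ≠ 0 and zero discriminant. It remains to exclude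
constant h; the relation between the variables gives g = −1 in the dual, hence z = 1/h ≠ 0. -/
theorem linked_d_e : Kind.d.lattice.Linked (Kind.e 0).lattice := by
  refine ⟨hasConstants_d.dualIs (by simp) fun M hM hrel => ?_,
    (hasConstants_e 0).dualIs (by simp) fun M hM _ => ?_⟩
  · refine (hM.isCentered one_ne_zero).reducesTo_e (by norm_num) (by norm_num) (by norm_num) ?_
    obtain ⟨P, hP⟩ := hM.lattice.region_p.2.nonempty
    obtain ⟨Y, hY⟩ := hM.lattice.region_y.2.nonempty
    refine ⟨Y, hY, ?_⟩
    obtain ⟨p, hp, y, hy, h1, h2, h3⟩ := hrel P hP Y hY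
    have hP0 : P ≠ 0 := fun h => hM.lattice.r_ne_zero P hP (by rw [hM.r_eq P hP, h]; ring)
    have hY0 := hM.h_ne Y hY
    rw [hM.r_eq P hP] at h3
    simp only [Kind.lattice] at h1 h3
    have h4 : M.h Y * P = p + 1 := by
      apply mul_right_cancel₀ hP0
      have : 1 / y * (p * (p + 1)) = P * (p + 1) := by rw [h1]; ring
      linear_combination h3 + this
    have h5 : M.g Y = -1 := by linear_combination -h2 - h4
    rw [h5]
    norm_num [hY0]
  · exact hM.reducesTo_d one_ne_zero (by norm_num) (by norm_num) (by norm_num)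

theorem selfDual_e {μ : ℂ} (hμ : μ ≠ 0) : (Kind.e μ).lattice.SelfDual := by
  refine (hasConstants_e μ).dualIs (by simp) fun M hM hrel => ?_
  refine (hM.isCentered one_ne_zero).reducesTo_e (by simpa using hμ) (by ring) (by simp) ?_
  obtain ⟨P, hP⟩ := hM.lattice.region_p.2.nonempty
  obtain ⟨Y, hY⟩ := hM.lattice.region_y.2.nonempty
  refine ⟨Y, hY, fun hz => ?_⟩
  -- If z vanished, the relation would force g = 0 in the dual and then p eʸ = 0, although p ≠ 0.
  obtain ⟨p, hp, y, hy, h1, h2, h3⟩ := hrel P hP Y hY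
  have hy : μ + exp y ≠ 0 := hy
  have hP0 : P ≠ 0 := fun h => hM.lattice.r_ne_zero P hP (by rw [hM.r_eq P hP, h]; ring)
  have hY0 := hM.h_ne Y hY
  rw [hM.r_eq P hP] at h3
  simp only [Kind.lattice] at h1 h3
  have h4 : M.h Y * (P - 1) = p - μ := by
    apply mul_right_cancel₀ hP0
    have : 1 / (μ + exp y) * (p * (p - μ)) = P * (p - μ) := by rw [h1]; ring
    linear_combination h3 + this
  have hz' : M.h Y = μ - 2 * M.g Y := by
    field_simp at hz
    linear_combination -hz
  have hg : M.g Y = 0 := by linear_combination h4 + h2 + hz'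
  rw [hz', hg] at h2
  have hp0 : p ≠ 0 := by
    rintro rfl
    exact hP0 (by rw [h1]; ring)
  rw [h1] at h2
  field_simp at h2
  refine Complex.exp_ne_zero y (mul_left_cancel₀ hp0 ?_)
  linear_combination h2

/-- (f) has κ = 0, ρ = μ, k = 1, so its dual has ρ = 0, κ = −μ and discriminant k², that is, type
(g) with m² = 1. In the other direction ρ = 0 becomes κ = 0, and any nonzero value of the parameter
of (f) is equivalent to any other. -/
theorem linked_f_g {μ ε : ℂ} (hμ : μ ≠ 0) (hε : ε = 1 ∨ ε = -1) :
    (Kind.f μ).lattice.Linked (Kind.g ε).lattice := by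
  have hε2 : ε ^ 2 = 1 := by rcases hε with rfl | rfl <;> norm_num
  have hε0 : ε ≠ 0 := by rintro rfl; norm_num at hε2
  refine ⟨(hasConstants_f μ).dualIs (by simp) fun M hM _ => ?_,
    (hasConstants_g ε).dualIs (by norm_num) fun M hM _ => ?_⟩
  · exact (hM.isCentered one_ne_zero).reducesTo_g (by simpa using hμ) (by norm_num)
      (by rw [hε2]; norm_num)
  · refine hM.reducesTo_f (by norm_num) (by rw [hε2]; norm_num) (by simpa using hε0) ?_
    exact iff_of_false hμ (by norm_num)

theorem selfDual_f : (Kind.f 0).lattice.SelfDual :=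
  (hasConstants_f 0).dualIs (by simp) fun _ hM _ =>
    hM.reducesTo_f one_ne_zero (by norm_num) (by norm_num) (by norm_num)

/-- For (g), m² is k² divided by the discriminant; both are preserved by duality, and μ² ≠ 1 keeps
the new κ nonzero. -/
theorem selfDual_g {μ : ℂ} (h1 : μ ≠ 1) (h2 : μ ≠ -1) : (Kind.g μ).lattice.SelfDual := by
  have h : 1 - μ ^ 2 ≠ 0 := by
    have : (1 - μ) * (1 + μ) ≠ 0 :=
      mul_ne_zero (sub_ne_zero.2 h1.symm) fun h => h2 (by linear_combination h)
    intro h'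
    exact this (by linear_combination h')
  refine (hasConstants_g μ).dualIs (by norm_num) fun M hM _ =>
    (hM.isCentered (by norm_num)).reducesTo_g ?_ ?_ ?_
  · simpa using h
  · ring_nf
    norm_num
  · ring_nf

end Kind

/-! ### The theorem -/

theorem mainTheorem2 :
    -- the nondegenerate nonlinear lattices admitting duality are, up to the changes, those listed
    (∀ L : RTL, L.IsLattice →
      ((L.Nondegenerate ∧ ¬ L.eq.IsLinear ∧ L.AdmitsDuality) ↔
        ∃ k : Kind, k.Admissible ∧ L.eq.ReducesTo k.lattice.eq)) ∧
    -- the listed lattices are lattices of the class, with duality near each point where `T` is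
    -- nondegenerate
    (∀ k : Kind, k.Admissible → k.lattice.IsLattice ∧
      ∀ p ∈ k.lattice.Dp, ∀ y ∈ k.lattice.Dy, k.lattice.jac p y ≠ 0 →
        ∃ E : LatticeEq, k.lattice.HasDualAt p y E) ∧
    -- the duality links
    Kind.a.lattice.Linked Kind.b.lattice ∧
    Kind.d.lattice.Linked (Kind.e 0).lattice ∧
    (∀ μ ε : ℂ, μ ≠ 0 → (ε = 1 ∨ ε = -1) → (Kind.f μ).lattice.Linked (Kind.g ε).lattice) ∧
    (∀ μ ν : ℂ, (Kind.c μ ν).Admissible →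
      (Kind.c μ ν).lattice.Linked (Kind.c ν μ).lattice) ∧
    (∀ μ ν : ℂ, μ ≠ 0 → ν ≠ 0 → (Kind.c μ ν).lattice.SelfDual) ∧
    (∀ μ : ℂ, μ ≠ 0 → (Kind.e μ).lattice.SelfDual) ∧
    (Kind.f 0).lattice.SelfDual ∧
    (∀ μ : ℂ, μ ≠ 1 → μ ≠ -1 → (Kind.g μ).lattice.SelfDual) := by
  refine ⟨fun L HL => ⟨?_, ?_⟩, fun k hk => ?_, Kind.linked_a_b, Kind.linked_d_e,
    fun μ ε hμ hε => Kind.linked_f_g hμ hε, fun μ ν _ => ⟨Kind.dualIs_c μ ν, Kind.dualIs_c ν μ⟩,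
    fun μ ν hμ hν => Kind.selfDual_c hμ hν, fun μ hμ => Kind.selfDual_e hμ, Kind.selfDual_f,
    fun μ h1 h2 => Kind.selfDual_g h1 h2⟩
  · rintro ⟨hN, hl, hA⟩
    obtain ⟨r0, r1, r2, k1, k2, j, H, h⟩ := RTL.exists_hasConstants HL hN hA
    exact H.exists_kind hN hl h
  · rintro ⟨k, hk, hred⟩
    obtain ⟨r0, r1, r2, k1, k2, j, H, h1, h2, h3⟩ := k.exists_hasConstants hk
    have HM := H.lattice
    obtain ⟨α, β, γ, δ, lam, c, m⟩ := RTL.exists_matches HL HM H.h_ne hred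
    obtain ⟨s0, s1, s2, l1, l2, i, HC, h4⟩ := m.exists_hasConstants HL H h2
    obtain ⟨p, hp⟩ := HL.region_p.2.nonempty
    obtain ⟨y, hy⟩ := HL.region_y.2.nonempty
    have hα := m.α_ne
    have hδ := m.δ_ne
    refine ⟨⟨⟨y, hy, HC.h_ne y hy⟩, y, hy, ?_⟩, HC.not_isLinear h4, ?_⟩
    · by_contra hcon
      push Not at hcon
      have e1 := m.deriv_h HL HM hy
      have e2 := m.deriv_g HL HM hy
      rw [hcon.2] at e1 e2
      rw [hcon.1] at e2
      refine h3 _ (m.mem_y y hy) ⟨?_, ?_⟩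
      · simpa [hα] using e1
      · simpa [hα] using e2
    -- D of L is a nonzero multiple of D of the listed lattice at corresponding points, so a point
    -- where the latter is nonzero is found near the image of p and pulled back to L.
    · have hfr := H.frequently_dualCoeff_ne h1 (m.mem_p p hp) (m.mem_y y hy)
      have hαδ : α * δ ≠ 0 := mul_ne_zero hα hδ
      have hcont : ContinuousAt (fun q => (q - β) / (α * δ)) (α * δ * p + β) := by fun_prop
      have hval : (α * δ * p + β - β) / (α * δ) = p := by field_simp; ring
      have hmem : ∀ᶠ q in 𝓝 (α * δ * p + β), (q - β) / (α * δ) ∈ L.Dp := by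
        refine hcont (HL.region_p.1.mem_nhds ?_)
        rw [show (fun q => (q - β) / (α * δ)) (α * δ * p + β) = p from hval]
        exact hp
      obtain ⟨q, hq1, hq2⟩ := (hfr.and_eventually hmem).exists
      refine HC.admitsDuality_of_dualCoeff_ne hq2 hy fun h0 => hq1 ?_
      have e := m.dualCoeff_eq HL HM hq2 hy
      rw [h0, mul_zero, mul_div_cancel₀ _ hαδ, sub_add_cancel] at e
      exact e
  · obtain ⟨r0, r1, r2, k1, k2, j, H, -⟩ := k.exists_hasConstants hk
    refine ⟨H.lattice, fun p hp y hy hj => H.exists_hasDualAt hp hy fun h => hj ?_⟩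
    rw [RTL.jac_eq _ y (H.lattice.r_ne_zero p hp), h, zero_div]
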